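/- Let $d\ge 1$ and put $p_{\min}(d)=d+1+\frac d2\bigl(\sqrt{1+4/d^2}-1\bigr)$. Let $(\mathcal M_n,\mathfrak g_n)$ ($n\in\mathbb N$), $(\mathcal M,\mathfrak g)$ and $(\mathcal N,\mathfrak h)$ be non-empty compact oriented smooth $d$-dimensional Riemannian manifolds, possibly with corners, equipped with their Riemannian distances (infima of lengths of paths; $\infty$ between different components) and Riemannian volume measures. Let $E_n$, $E^{\mathcal M}$, $E^{\mathcal N}$ be smooth global frame fields on $\mathcal M_n$, $\mathcal M$, $\mathcal N$. For $p\in[p_{\min}(d),\infty)$, say that $(\mathcal M_n,\mathfrak g_n,E_n)$ converges to $(\mathcal M,\mathfrak g,E^{\mathcal M})$ with exponent $p$ with respect to diffeomorphisms $F_n:A_n\to\mathcal M_n$, where $A_n\subset\mathcal M$, if, as $n\to\infty$: 1. $\mathrm{Vol}_{\mathfrak g}(\mathcal M\setminus A_n)\,\mathrm{Lip}(F_n)^2\to0$ and $\mathrm{Vol}_{\mathfrak g}(\mathcal M\setminus A_n)\,\mathrm{Lip}(F_n^{-1})^2\to0$, where $\mathrm{Lip}$ is the Lipschitz constant and $A_n$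 carries the distance $d_{\mathcal M}$ of $\mathcal M$; 2. $\operatorname{dis}F_n=\sup_{x,y\in A_n}|d_{\mathcal M_n}(F_n(x),F_n(y))-d_{\mathcal M}(x,y)|\to0$ (with $|\infty-\infty|=0$); 3. $\int_{A_n}\operatorname{dist}^p(dF_n,\mathrm{SO}(\mathfrak g,\mathfrak g_n))\,d\mathrm{Vol}_{\mathfrak g}\to0$ and $\int_{\mathcal M_n}\operatorname{dist}^p(dF_n^{-1},\mathrm{SO}(\mathfrak g_n,\mathfrak g))\,d\mathrm{Vol}_{\mathfrak g_n}\to0$, where at each point $\mathrm{SO}$ is the set of orientation-preserving linear isometries between the two tangent spaces concerned, and the distance is taken in the operator norm; 4. $\int_{A_n}|F_n^\star E_n-E^{\mathcal M}|_{\mathfrak g}^p\,d\mathrm{Vol}_{\mathfrak g}\to0$, where $F_n^\star E_n=(dF_n)^{-1}(E_n\circ F_n)$ and $|(v_1,\dots,v_d)|_{\mathfrak g}^2=\sum_i|v_i|_{\mathfrak g}^2$. Suppose that, for one and the same exponent $p\in[p_{\min}(d),\infty)$, $(\mathcal M_n,\mathfrak g_n,E_n)$ converges to $(\mathcal M,\mathfrak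 g,E^{\mathcal M})$ with respect to $F_n:A_n\subset\mathcal M\to\mathcal M_n$ and to $(\mathcal N,\mathfrak h,E^{\mathcal N})$ with respect to $G_n:B_n\subset\mathcal N\to\mathcal M_n$. Put $H_n=G_n^{-1}\circ F_n:A_n\to\mathcal N$. Say that a continuous map $H:\mathcal M\to\mathcal N$ is the uniform limit of a subsequence $(H_{n_k})$ if $\sup_{x\in A_{n_k}}d_{\mathcal N}(H_{n_k}(x),H(x))\to0$ as $k\to\infty$. Then some subsequence of $(H_n)$ has such a uniform limit; and whenever $H:\mathcal M\to\mathcal N$ is the uniform limit of a subsequence of $(H_n)$ (in particular of the whole sequence), $H$ is an isometry of Riemannian manifolds, that is, a smooth diffeomorphism with $H^\star\mathfrak h=\mathfrak g$, and $H_\star E^{\mathcal M}=E^{\mathcal N}$, that is, $dH_x(E^{\mathcal M}_i(x))=E^{\mathcal N}_i(H(x))$ for all $x\in\mathcal M$ and $1\le i\le d$. -/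

import Mathlib

open Set Filter Topology MeasureTheory Manifold Bundle
open scoped ENNReal ContDiff

noncomputable section

namespace WeitzenbockLimit

/-- The model `[0, ∞)^d ⊆ ℝ^d` of `d`-dimensional manifolds with corners. Manifolds without
boundary, or with smooth boundary, have charts in this model too. -/
abbrev cornerModel (d : ℕ) :
    ModelWithCorners ℝ (EuclideanSpace ℝ (Fin d)) (EuclideanQuadrant d) :=
  modelWithCornersEuclideanQuadrant d

/-- The exponent `p_min(d) = d + 1 + (d / 2) (√(1 + 4 / d²) - 1)`. -/
def pMin (d : ℕ) : ℝ := d + 1 + (d : ℝ) / 2 * (√(1 + 4 / (d : ℝ) ^ 2) - 1)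

/-- The Lipschitz constant of `f` on `s`: the supremum of `d (f x) (f y) / d x y` over `x, y ∈ s`
(where `0 / 0 = 0`). -/
def lipConst {X Y : Type*} [EMetricSpace X] [EMetricSpace Y] (f : X → Y) (s : Set X) : ℝ≥0∞ :=
  ⨆ x ∈ s, ⨆ y ∈ s, edist (f x) (f y) / edist x y

/-- The distortion of `f` on `s`: the supremum of `|d (f x) (f y) - d x y|` over `x, y ∈ s`.
Subtraction is truncated in `ℝ≥0∞`, so the absolute value of a difference is the maximum of the
two differences; `∞ - ∞ = 0`. -/
def distortion {X Y : Type*} [EMetricSpace X] [EMetricSpace Y] (f : X → Y) (s : Set X) : ℝ≥0∞ :=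
  ⨆ x ∈ s, ⨆ y ∈ s,
    max (edist (f x) (f y) - edist x y) (edist x y - edist (f x) (f y))

section OneManifold

variable (d : ℕ) (M : Type*) [TopologicalSpace M] [ChartedSpace (EuclideanQuadrant d) M]
  [IsManifold (cornerModel d) ∞ M]

/-- A smooth frame field: a basis of each tangent space whose members are smooth vector fields. -/
structure FrameField where
  /-- the frame at each point -/
  frame : ∀ x : M, Module.Basis (Fin d) ℝ (TangentSpace (cornerModel d) x)
  smooth : ∀ i, ContMDiff (cornerModel d) (cornerModel d).tangent ∞
    (fun x : M ↦ (⟨x, frame x i⟩ : TangentBundle (cornerModel d) M))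

/-- An orientation of a manifold: an orientation of each tangent space which, near each point, is
the orientation of a smooth local frame field. -/
structure ManifoldOrientation where
  /-- the orientation of each tangent space -/
  at_ : ∀ x : M, Orientation ℝ (TangentSpace (cornerModel d) x) (Fin d)
  locally_framed : ∀ x₀ : M, ∃ U ∈ 𝓝 x₀,
    ∃ b : ∀ x : M, Module.Basis (Fin d) ℝ (TangentSpace (cornerModel d) x),
      (∀ i, ContMDiffOn (cornerModel d) (cornerModel d).tangent ∞
        (fun x : M ↦ (⟨x, b x i⟩ : TangentBundle (cornerModel d) M)) U) ∧
      ∀ x ∈ U, (b x).orientation = at_ x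

/-- The `i`-th coordinate vector field of the chart at `x₀`, at the point with coordinates `z`: the
differential of the inverse of the chart, applied to the `i`-th standard basis vector. -/
def coordVector (x₀ : M) (z : EuclideanSpace ℝ (Fin d)) (i : Fin d) :
    TangentSpace (cornerModel d) ((extChartAt (cornerModel d) x₀).symm z) :=
  letI : ChartedSpace (EuclideanSpace ℝ (Fin d)) (EuclideanSpace ℝ (Fin d)) := chartedSpaceSelf _
  mfderivWithin 𝓘(ℝ, EuclideanSpace ℝ (Fin d)) (cornerModel d)
    (extChartAt (cornerModel d) x₀).symm (range (cornerModel d)) z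
    (EuclideanSpace.single i (1 : ℝ) : EuclideanSpace ℝ (Fin d))

/-- The density `√(det g_ij)` of the Riemannian volume in the coordinates of the chart at `x₀`,
where `g_ij` is the inner product of the `i`-th and `j`-th coordinate vector fields. -/
def chartVolumeDensity [RiemannianBundle (fun x : M ↦ TangentSpace (cornerModel d) x)]
    (x₀ : M) (z : EuclideanSpace ℝ (Fin d)) : ℝ :=
  √(Matrix.det (Matrix.of fun i j : Fin d ↦
    inner ℝ (coordVector d M x₀ z i) (coordVector d M x₀ z j)))

variable [RiemannianBundle (fun x : M ↦ TangentSpace (cornerModel d) x)]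

/-- The Riemannian volume of the part of a set inside the domain of the chart at `x₀`: the image
of `√(det g_ij) dz` under the inverse of the chart. -/
def chartVolume [MeasurableSpace M] (x₀ : M) : Measure M :=
  (((volume : Measure (EuclideanSpace ℝ (Fin d))).restrict
      (extChartAt (cornerModel d) x₀).target).withDensity
        (fun z ↦ ENNReal.ofReal (chartVolumeDensity d M x₀ z))).map
    (extChartAt (cornerModel d) x₀).symm

/-- The Riemannian volume measure. The chart volumes agree on the overlaps of chart domains, so
their least upper bound is the unique measure which restricts to each of them. -/
def riemVolume [MeasurableSpace M] : Measure M := ⨆ x₀ : M, chartVolume d M x₀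

end OneManifold

section TwoManifolds

variable {d : ℕ}
  {X : Type*} [EMetricSpace X] [ChartedSpace (EuclideanQuadrant d) X]
  [IsManifold (cornerModel d) ∞ X]
  [RiemannianBundle (fun x : X ↦ TangentSpace (cornerModel d) x)]
  {Y : Type*} [EMetricSpace Y] [ChartedSpace (EuclideanQuadrant d) Y]
  [IsManifold (cornerModel d) ∞ Y]
  [RiemannianBundle (fun y : Y ↦ TangentSpace (cornerModel d) y)]

/-- `SO(T_x X, T_y Y)`: the orientation-preserving linear isometries from `T_x X` to `T_y Y`. -/
def SOset (oX : ManifoldOrientation d X) (oY : ManifoldOrientation d Y) (x : X) (y : Y) :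
    Set (TangentSpace (cornerModel d) x →L[ℝ] TangentSpace (cornerModel d) y) :=
  {A | ∃ Q : TangentSpace (cornerModel d) x ≃ₗᵢ[ℝ] TangentSpace (cornerModel d) y,
    Orientation.map (Fin d) Q.toLinearEquiv (oX.at_ x) = oY.at_ y ∧ ∀ v, A v = Q v}

/-- `|F^⋆ E' - E|` at `x`, for `F : A ⊆ X → Y`: here `F^⋆ E' = (dF)⁻¹ (E' ∘ F)`, and the norm of a
`d`-tuple of tangent vectors is the square root of the sum of their squared norms. -/
def framePullbackDist (F : X → Y) (A : Set X) (E' : FrameField d Y) (E : FrameField d X) (x : X) :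
    ℝ≥0∞ :=
  (∑ i : Fin d,
    ‖VectorField.mpullbackWithin (cornerModel d) (cornerModel d) F
      (fun y ↦ E'.frame y i) A x - E.frame x i‖ₑ ^ 2) ^ (1 / 2 : ℝ)

/-- `H` is an isometry of Riemannian manifolds: a diffeomorphism whose differential preserves the
norms of tangent vectors. -/
def IsRiemannianIsometry (H : X → Y) : Prop :=
  (∃ Φ : X ≃ₘ^∞⟮cornerModel d, cornerModel d⟯ Y, ∀ x, Φ x = H x) ∧
    ∀ (x : X) (v : TangentSpace (cornerModel d) x),
      ‖mfderiv (cornerModel d) (cornerModel d) H x v‖ = ‖v‖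

end TwoManifolds

/-- The sequence `(Mₙ, gₙ, Eₙ)` converges to `(M, g, E)` with exponent `p` with respect to the
diffeomorphisms `Fₙ : Aₙ ⊆ M → Mₙ`. Here `Aₙ` is `(F n).source`, and `Fₙ` is onto `Mₙ`. Distances
between points of `Aₙ` are those of `M`. -/
structure ConvergesVia {d : ℕ} (p : ℝ)
    {Ms : ℕ → Type*} [∀ n, EMetricSpace (Ms n)]
    [∀ n, ChartedSpace (EuclideanQuadrant d) (Ms n)]
    [∀ n, IsManifold (cornerModel d) ∞ (Ms n)]
    [∀ n, RiemannianBundle (fun x : Ms n ↦ TangentSpace (cornerModel d) x)]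
    [∀ n, MeasurableSpace (Ms n)]
    (os : ∀ n, ManifoldOrientation d (Ms n)) (Es : ∀ n, FrameField d (Ms n))
    {M : Type*} [EMetricSpace M] [ChartedSpace (EuclideanQuadrant d) M]
    [IsManifold (cornerModel d) ∞ M]
    [RiemannianBundle (fun x : M ↦ TangentSpace (cornerModel d) x)] [MeasurableSpace M]
    (o : ManifoldOrientation d M) (E : FrameField d M)
    (F : ∀ n, PartialEquiv M (Ms n)) : Prop where
  le_exponent : pMin d ≤ p
  target_eq : ∀ n, (F n).target = univ
  smooth : ∀ n, ContMDiffOn (cornerModel d) (cornerModel d) ∞ (F n) (F n).source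
  smooth_symm : ∀ n, ContMDiff (cornerModel d) (cornerModel d) ∞ (F n).symm
  covers : Tendsto (fun n ↦ riemVolume d M (F n).sourceᶜ * lipConst (F n) (F n).source ^ 2)
    atTop (𝓝 0)
  covers_symm : Tendsto (fun n ↦ riemVolume d M (F n).sourceᶜ * lipConst (F n).symm univ ^ 2)
    atTop (𝓝 0)
  distortion_tendsto : Tendsto (fun n ↦ distortion (F n) (F n).source) atTop (𝓝 0)
  rigid : Tendsto
    (fun n ↦ ∫⁻ x in (F n).source,
      Metric.infEDist (mfderivWithin (cornerModel d) (cornerModel d) (F n) (F n).source x)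
        (SOset o (os n) x (F n x)) ^ p ∂(riemVolume d M)) atTop (𝓝 0)
  rigid_symm : Tendsto
    (fun n ↦ ∫⁻ y,
      Metric.infEDist (mfderiv (cornerModel d) (cornerModel d) (F n).symm y)
        (SOset (os n) o y ((F n).symm y)) ^ p ∂(riemVolume d (Ms n))) atTop (𝓝 0)
  frames : Tendsto
    (fun n ↦ ∫⁻ x in (F n).source,
      framePullbackDist (F n) (F n).source (Es n) E x ^ p ∂(riemVolume d M)) atTop (𝓝 0)

/-- `H : M → N` is the uniform limit along the subsequence `φ` of the maps
`Hₙ = Gₙ⁻¹ ∘ Fₙ : Aₙ → N`: it is continuous, and `sup_{x ∈ Aₙ} d (Hₙ x) (H x)` tends to `0`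
along `φ`. Continuity is needed because a point may lie outside all of the sets `Aₙ`. -/
def IsUniformLimitAlong {Ms : ℕ → Type*} {M N : Type*} [EMetricSpace M] [EMetricSpace N]
    (F : ∀ n, PartialEquiv M (Ms n)) (G : ∀ n, PartialEquiv N (Ms n)) (φ : ℕ → ℕ) (H : M → N) :
    Prop :=
  Continuous H ∧
    Tendsto (fun k ↦ ⨆ x ∈ (F (φ k)).source, edist ((G (φ k)).symm (F (φ k) x)) (H x))
      atTop (𝓝 0)

end WeitzenbockLimit

end

/-! Metric part. The distortions tend to `0` and the sets `Aₙ` become dense, so the maps `Hₙ` are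
almost isometries between compact spaces. Limits along an ultrafilter, made uniform by a finite net,
give a convergent subsequence (`exists_isUniformLimitAlong`). Every uniform limit `H` is a
distance-preserving bijection whose inverse is the uniform limit of the inverse transition maps.
Density comes from condition 1: the Lipschitz constants of `Fₙ` and `Fₙ⁻¹` cannot both be small, so
`Vol(M \ Aₙ) → 0`.

Convergence of differentials. Write `dHₙ = dGₙ⁻¹ ∘ dFₙ`. By Chebyshev's inequality, outside sets of
small volume both factors have norm at most `1 + ε` and both pulled-back frames are `ε`-close to the
given ones, so `dHₙ` takes `E^M` to within `5ε` of `E^N ∘ Hₙ` (`exists_goodSets`). On the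
exceptional sets the product `‖dGₙ⁻¹‖ ‖dFₙ‖` has to be integrated: Young's inequality splits it with
exponents `p - d` and `p`, and moving the first term to `Mₙ` costs a Jacobian `‖dFₙ⁻¹‖ ^ d`, which
brings its exponent up to `p`. This requires `1/p + 1/(p - d) ≤ 1`, which is what `p ≥ p_min(d)`
provides. Hence `dHₙ E^M - E^N ∘ Hₙ → 0` in `L¹` (`tendsto_lintegral_transitionDeriv_frame_sub`).

Differentiability of the limit. In charts, the coordinates of `Hₙ` are Lipschitz on `Aₙ` and extend
to Lipschitz functions, which can be integrated by parts. If `Vol(M \ Aₙ) Lip(Hₙ) → 0`, the part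
outside `Aₙ` disappears in the limit, so `H` has the linear map taking frame to frame as a
continuous weak derivative. It is then a true derivative in the interior, and by continuity also at
the corners (`hasMFDerivAt_limit`). Since `Lip(Hₙ) ≤ Lip(Fₙ) Lip(Gₙ⁻¹)` and `ab ≤ a² + b²`, the
volume condition holds where `Vol(M \ Aₙ) ≤ Vol(N \ Bₙ)`. If this fails eventually, the argument
applies to `H⁻¹`, and the result is inverted.

Conclusion. In charts `H` solves a first-order system with smooth coefficients, so it is smooth by
induction on the order of differentiability, and so is its inverse. Near each point there are points
where `‖dHₙ‖ ≤ (1 + ε)²` and the frames are almost preserved, so in the limit the map taking frame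
to frame does not increase norms. The same holds for the inverse, and `dH` is isometric. -/

noncomputable section

namespace WeitzenbockLimit

open scoped NNReal

set_option linter.unusedSectionVars false

/-! ### Gram determinants under linear maps -/

section LinearAlgebra

variable {d : ℕ} {V W : Type*} [NormedAddCommGroup V] [InnerProductSpace ℝ V]
  [NormedAddCommGroup W] [InnerProductSpace ℝ W]

/-- The Gram determinant of `d` vectors of a `d`-dimensional space is the square of their
determinant in an orthonormal basis. -/
lemma det_gram_eq_sq (b : OrthonormalBasis (Fin d) ℝ V) (v : Fin d → V) :
    (Matrix.gram ℝ v).det = (b.toBasis.det v) ^ 2 := by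
  have h := Matrix.gram_eq_conjTranspose_mul (𝕜 := ℝ) b v
  have e : (Matrix.of fun i j ↦ b.repr (v j) i) = b.toBasis.toMatrix v := by
    ext i j
    simp [Module.Basis.toMatrix_apply]
  rw [h, Matrix.det_mul, Matrix.det_conjTranspose, Module.Basis.det_apply]
  simp only [star_trivial, sq]
  rw [← e]

/-- A linear map multiplies the Gram determinant by at most `‖Ψ‖ ^ (2 * d)`. -/
lemma sqrt_det_gram_comp_le (hV : Module.finrank ℝ V = d) (hW : Module.finrank ℝ W = d)
    [FiniteDimensional ℝ V] [FiniteDimensional ℝ W]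
    (Ψ : V →L[ℝ] W) (v : Fin d → V) :
    √(Matrix.gram ℝ (fun i ↦ Ψ (v i))).det ≤ ‖Ψ‖ ^ d * √(Matrix.gram ℝ v).det := by
  let b : OrthonormalBasis (Fin d) ℝ V := (stdOrthonormalBasis ℝ V).reindex (finCongr hV)
  let c : OrthonormalBasis (Fin d) ℝ W := (stdOrthonormalBasis ℝ W).reindex (finCongr hW)
  -- The target is identified isometrically with `V`, so that `Ψ` becomes an endomorphism with a
  -- determinant.
  let U : W ≃ₗᵢ[ℝ] V := c.equiv b (Equiv.refl _)
  let f : V →ₗ[ℝ] V := U.toLinearEquiv.toLinearMap ∘ₗ Ψ.toLinearMap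
  have hg : Matrix.gram ℝ (fun i ↦ Ψ (v i)) = Matrix.gram ℝ (f ∘ v) := by
    ext i j
    simp [Matrix.gram_apply, f]
  -- Hadamard's inequality: the determinant is at most the product of the norms of the images of an
  -- orthonormal basis.
  have hf : |LinearMap.det f| ≤ ‖Ψ‖ ^ d := by
    have : Fact (Module.finrank ℝ V = d) := ⟨hV⟩
    have h1 := (b.toBasis.orientation).abs_volumeForm_apply_le (f ∘ b)
    rw [(b.toBasis.orientation).volumeForm_robust b rfl, ← b.coe_toBasis,
      Module.Basis.det_comp, Module.Basis.det_self, mul_one] at h1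
    refine h1.trans ?_
    calc ∏ i : Fin d, ‖(f ∘ b.toBasis) i‖ ≤ ∏ i : Fin d, ‖Ψ‖ := by
          refine Finset.prod_le_prod (fun _ _ ↦ norm_nonneg _) fun i _ ↦ ?_
          have : ‖(f ∘ b.toBasis) i‖ = ‖Ψ (b i)‖ := by simp [f]
          rw [this]
          simpa using Ψ.le_opNorm (b i)
      _ = ‖Ψ‖ ^ d := by simp
  rw [hg, det_gram_eq_sq b, det_gram_eq_sq b, Module.Basis.det_comp, Real.sqrt_sq_eq_abs,
    Real.sqrt_sq_eq_abs, abs_mul]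
  gcongr

/-- The Gram determinant of the images of the standard basis under `P ∘ A`. -/
lemma sqrt_det_gram_comp_endo [FiniteDimensional ℝ V] (hV : Module.finrank ℝ V = d)
    (P : EuclideanSpace ℝ (Fin d) →L[ℝ] V)
    (A : EuclideanSpace ℝ (Fin d) →L[ℝ] EuclideanSpace ℝ (Fin d)) :
    √(Matrix.gram ℝ (fun i ↦ P (A (EuclideanSpace.single i (1 : ℝ))))).det
      = |A.det| * √(Matrix.gram ℝ (fun i ↦ P (EuclideanSpace.single i (1 : ℝ)))).det := by
  let b : OrthonormalBasis (Fin d) ℝ V := (stdOrthonormalBasis ℝ V).reindex (finCongr hV)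
  let s := EuclideanSpace.basisFun (Fin d) ℝ
  -- The left side is an alternating form of top degree in `w`, hence a multiple of the standard
  -- determinant.
  have key : ∀ w : Fin d → EuclideanSpace ℝ (Fin d), b.toBasis.det (fun i ↦ P (w i)) =
      s.toBasis.det w * b.toBasis.det (fun i ↦ P (s i)) := by
    intro w
    have := (b.toBasis.det.compLinearMap P.toLinearMap).eq_smul_basis_det s.toBasis
    have h2 := congrArg (fun f ↦ f w) this
    simp only [AlternatingMap.compLinearMap_apply, AlternatingMap.smul_apply, smul_eq_mul] at h2
    rw [mul_comm]
    simpa using h2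
  have hA : s.toBasis.det (fun i ↦ A (s i)) = A.det := by
    have := Module.Basis.det_comp s.toBasis A.toLinearMap s.toBasis
    rw [Module.Basis.det_self, mul_one] at this
    rw [ContinuousLinearMap.det, ← this]
    congr 1
  rw [det_gram_eq_sq b, det_gram_eq_sq b, Real.sqrt_sq_eq_abs, Real.sqrt_sq_eq_abs]
  have h1 := key (fun i ↦ A (s i))
  rw [hA] at h1
  simp only [s, EuclideanSpace.basisFun_apply] at h1
  rw [h1, abs_mul]

end LinearAlgebra

/-! ### Tangent spaces and differentials of charts -/

section Infrastructure

variable {d : ℕ} {X : Type*} [EMetricSpace X] [ChartedSpace (EuclideanQuadrant d) X]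
  [IsManifold (cornerModel d) ∞ X]

scoped instance instFiniteDimensionalTangentSpace (x : X) :
    FiniteDimensional ℝ (TangentSpace (cornerModel d) x) :=
  inferInstanceAs (FiniteDimensional ℝ (EuclideanSpace ℝ (Fin d)))

lemma finrank_tangentSpace (x : X) : Module.finrank ℝ (TangentSpace (cornerModel d) x) = d :=
  finrank_euclideanSpace_fin (𝕜 := ℝ) (n := d)

scoped instance instIsManifoldOne : IsManifold (cornerModel d) 1 X :=
  IsManifold.of_le (n := ∞) (by simp)

/-- The differential of the chart at `x₀`. -/
def dChart (x₀ x : X) : TangentSpace (cornerModel d) x →L[ℝ] EuclideanSpace ℝ (Fin d) :=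
  mfderiv (cornerModel d) 𝓘(ℝ, EuclideanSpace ℝ (Fin d)) (extChartAt (cornerModel d) x₀) x

/-- The differential of the inverse of the chart at `x₀`. -/
def dChartSymm (x₀ : X) (z : EuclideanSpace ℝ (Fin d)) : EuclideanSpace ℝ (Fin d) →L[ℝ]
    TangentSpace (cornerModel d) ((extChartAt (cornerModel d) x₀).symm z) :=
  mfderivWithin 𝓘(ℝ, EuclideanSpace ℝ (Fin d)) (cornerModel d)
    (extChartAt (cornerModel d) x₀).symm (range (cornerModel d)) z

lemma dChartSymm_dChart {x₀ : X} {z : EuclideanSpace ℝ (Fin d)}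
    (hz : z ∈ (extChartAt (cornerModel d) x₀).target)
    (v : TangentSpace (cornerModel d) ((extChartAt (cornerModel d) x₀).symm z)) :
    dChartSymm x₀ z (dChart x₀ _ v) = v :=
  congrArg (fun L ↦ L v) (mfderivWithin_extChartAt_symm_comp_mfderiv_extChartAt hz)

lemma dChart_dChartSymm {x₀ : X} {z : EuclideanSpace ℝ (Fin d)}
    (hz : z ∈ (extChartAt (cornerModel d) x₀).target) (v : EuclideanSpace ℝ (Fin d)) :
    dChart x₀ _ (dChartSymm x₀ z v) = v :=
  congrArg (fun L ↦ L v) (mfderiv_extChartAt_comp_mfderivWithin_extChartAt_symm hz)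

lemma hasMFDerivWithinAt_extChartAt_symm {x₀ : X} {z : EuclideanSpace ℝ (Fin d)}
    (hz : z ∈ (extChartAt (cornerModel d) x₀).target) :
    HasMFDerivWithinAt 𝓘(ℝ, EuclideanSpace ℝ (Fin d)) (cornerModel d)
      (extChartAt (cornerModel d) x₀).symm (range (cornerModel d)) z (dChartSymm x₀ z) :=
  (mdifferentiableWithinAt_extChartAt_symm hz).hasMFDerivWithinAt

lemma hasMFDerivAt_extChartAt' {x₀ x : X} (hx : x ∈ (extChartAt (cornerModel d) x₀).source) :
    HasMFDerivAt (cornerModel d) 𝓘(ℝ, EuclideanSpace ℝ (Fin d))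
      (extChartAt (cornerModel d) x₀) x (dChart x₀ x) :=
  (mdifferentiableAt_extChartAt (by simpa using hx)).hasMFDerivAt

variable [RiemannianBundle (fun x : X ↦ TangentSpace (cornerModel d) x)]

lemma chartVolumeDensity_eq (x₀ : X) (z : EuclideanSpace ℝ (Fin d)) :
    chartVolumeDensity d X x₀ z =
      √(Matrix.gram ℝ (fun i ↦ dChartSymm x₀ z (EuclideanSpace.single i (1 : ℝ)))).det := rfl

variable [IsContMDiffRiemannianBundle (cornerModel d) ∞ (EuclideanSpace ℝ (Fin d))
      (fun x : X ↦ TangentSpace (cornerModel d) x)]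

scoped instance instIsContinuousRiemannianBundleTangent : IsContinuousRiemannianBundle
    (EuclideanSpace ℝ (Fin d)) (fun x : X ↦ TangentSpace (cornerModel d) x) := by
  obtain ⟨g, hg, hgInner⟩ := IsContMDiffRiemannianBundle.exists_contMDiff
    (IB := cornerModel d) (n := ∞) (F := EuclideanSpace ℝ (Fin d))
    (E := fun x : X ↦ TangentSpace (cornerModel d) x)
  exact ⟨g, hg.continuous, hgInner⟩

/-- The differential of a chart is bounded near its centre. -/
lemma eventually_norm_dChart_lt (x₀ : X) :
    ∃ C > 0, ∀ᶠ x in 𝓝 x₀, ‖dChart (d := d) x₀ x‖ < C := by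
  obtain ⟨C, hC, h⟩ := eventually_norm_trivializationAt_lt (EuclideanSpace ℝ (Fin d))
    (fun x : X ↦ TangentSpace (cornerModel d) x) x₀
  refine ⟨C, hC, ?_⟩
  filter_upwards [h, chart_source_mem_nhds (EuclideanQuadrant d) x₀] with y hy h'y
  have e : dChart (d := d) x₀ y = Trivialization.continuousLinearMapAt ℝ
      (trivializationAt (EuclideanSpace ℝ (Fin d)) (TangentSpace (cornerModel d)) x₀) y :=
    (TangentBundle.continuousLinearMapAt_trivializationAt h'y).symm
  rw [e]
  exact hy

lemma eventually_norm_dChartSymm_comp_lt (x₀ : X) :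
    ∃ C > 0, ∀ᶠ x in 𝓝 x₀, ‖dChartSymm x₀ (extChartAt (cornerModel d) x₀ x)‖ < C := by
  obtain ⟨C, hC, h⟩ := eventually_norm_symmL_trivializationAt_lt (EuclideanSpace ℝ (Fin d))
    (fun x : X ↦ TangentSpace (cornerModel d) x) x₀
  refine ⟨C, hC, ?_⟩
  filter_upwards [h, chart_source_mem_nhds (EuclideanQuadrant d) x₀] with y hy h'y
  have e : Trivialization.symmL ℝ
      (trivializationAt (EuclideanSpace ℝ (Fin d)) (TangentSpace (cornerModel d)) x₀) y
      = dChartSymm x₀ (extChartAt (cornerModel d) x₀ y) :=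
    TangentBundle.symmL_trivializationAt h'y
  have hxy : (extChartAt (cornerModel d) x₀).symm (extChartAt (cornerModel d) x₀ y) = y :=
    (extChartAt (cornerModel d) x₀).left_inv (by simpa using h'y)
  -- All tangent spaces are the same Euclidean space, but their norms depend on the base point. The
  -- base points here are equal only by `hxy`, so that equality has to be substituted.
  have key : ∀ (y' : X) (_ : y' = y)
      (L : EuclideanSpace ℝ (Fin d) →L[ℝ] TangentSpace (cornerModel d) y')
      (L' : EuclideanSpace ℝ (Fin d) →L[ℝ] TangentSpace (cornerModel d) y),
      (∀ v, (L v : EuclideanSpace ℝ (Fin d)) = L' v) → ‖L‖ = ‖L'‖ := by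
    rintro y' rfl L L' hL
    have : L = L' := by ext1 v; exact hL v
    rw [this]
  rw [key _ hxy (dChartSymm x₀ (extChartAt (cornerModel d) x₀ y)) (Trivialization.symmL ℝ
      (trivializationAt (EuclideanSpace ℝ (Fin d)) (TangentSpace (cornerModel d)) x₀) y) ?_]
  · exact hy
  · intro v
    exact congrArg (fun L ↦ L v) e.symm

end Infrastructure

/-! ### Volume and change of variables in a single chart -/

section ChartVolume

variable {d : ℕ} {X : Type*} [EMetricSpace X] [ChartedSpace (EuclideanQuadrant d) X]
  [IsManifold (cornerModel d) ∞ X]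

lemma measurableSet_extChartAt_target (x₀ : X) :
    MeasurableSet (extChartAt (cornerModel d) x₀).target := by
  rw [extChartAt_target]
  exact (((chartAt (EuclideanQuadrant d) x₀).open_target.preimage
    (cornerModel d).continuous_symm).measurableSet).inter
    (cornerModel d).isClosed_range.measurableSet

/-- Identifying the differential of the inverse chart with the inverse of the bundle trivialization
makes the coordinate vector fields continuous, and with them the volume density. -/
lemma dChartSymm_eq_symm {x₀ : X} {z : EuclideanSpace ℝ (Fin d)}
    (hz : z ∈ (extChartAt (cornerModel d) x₀).target) (v : EuclideanSpace ℝ (Fin d)) :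
    dChartSymm x₀ z v = (trivializationAt (EuclideanSpace ℝ (Fin d))
      (TangentSpace (cornerModel d)) x₀).symm ((extChartAt (cornerModel d) x₀).symm z) v := by
  have hs : (extChartAt (cornerModel d) x₀).symm z ∈ (chartAt (EuclideanQuadrant d) x₀).source := by
    simpa using (extChartAt (cornerModel d) x₀).map_target hz
  have e := TangentBundle.symmL_trivializationAt (I := cornerModel d) hs
  have hz' : extChartAt (cornerModel d) x₀ ((extChartAt (cornerModel d) x₀).symm z) = z :=
    (extChartAt (cornerModel d) x₀).right_inv hz
  have key : ∀ z' : EuclideanSpace ℝ (Fin d), z' = z →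
      (mfderivWithin 𝓘(ℝ, EuclideanSpace ℝ (Fin d)) (cornerModel d)
        (extChartAt (cornerModel d) x₀).symm (range (cornerModel d)) z' v :
          EuclideanSpace ℝ (Fin d)) = dChartSymm x₀ z v := by
    rintro z' rfl
    rfl
  refine ((congrArg (fun L ↦ L v) e).trans (key _ hz')).symm.trans ?_
  rw [Trivialization.symmL_apply]
  simpa [TangentBundle.trivializationAt_baseSet] using hs

lemma continuousOn_dChartSymm (x₀ : X) (v : EuclideanSpace ℝ (Fin d)) :
    ContinuousOn (fun z ↦ (⟨(extChartAt (cornerModel d) x₀).symm z, dChartSymm x₀ z v⟩ :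
      TangentBundle (cornerModel d) X)) (extChartAt (cornerModel d) x₀).target := by
  have h := (trivializationAt (EuclideanSpace ℝ (Fin d))
      (TangentSpace (cornerModel d) (M := X)) x₀).continuousOn_symm
  have h2 : ContinuousOn (fun z ↦ ((extChartAt (cornerModel d) x₀).symm z, v))
      (extChartAt (cornerModel d) x₀).target :=
    (continuousOn_extChartAt_symm x₀).prodMk continuousOn_const
  refine (h.comp h2 fun z hz ↦ ⟨?_, mem_univ _⟩).congr fun z hz ↦ ?_
  · simpa [TangentBundle.trivializationAt_baseSet] using
      (extChartAt (cornerModel d) x₀).map_target hz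
  · simp only [Function.comp]
    rw [dChartSymm_eq_symm hz]

/-- The derivative of a map read in charts. -/
lemma hasFDerivWithinAt_writtenInCharts {Y : Type*} [EMetricSpace Y]
    [ChartedSpace (EuclideanQuadrant d) Y] [IsManifold (cornerModel d) ∞ Y]
    {x₀ : X} {y₀ : Y} {S : Set X} {Φ : X → Y}
    {z : EuclideanSpace ℝ (Fin d)} (hz : z ∈ (extChartAt (cornerModel d) x₀).target)
    (hΦz : Φ ((extChartAt (cornerModel d) x₀).symm z) ∈ (extChartAt (cornerModel d) y₀).source)
    {Φ' : TangentSpace (cornerModel d) ((extChartAt (cornerModel d) x₀).symm z) →L[ℝ]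
      TangentSpace (cornerModel d) (Φ ((extChartAt (cornerModel d) x₀).symm z))}
    (hΦ : HasMFDerivWithinAt (cornerModel d) (cornerModel d) Φ S
      ((extChartAt (cornerModel d) x₀).symm z) Φ') :
    HasFDerivWithinAt (fun w ↦ extChartAt (cornerModel d) y₀
        (Φ ((extChartAt (cornerModel d) x₀).symm w)))
      ((dChart y₀ (Φ ((extChartAt (cornerModel d) x₀).symm z))).comp
        (Φ'.comp (dChartSymm x₀ z)))
      ((extChartAt (cornerModel d) x₀).target ∩ (extChartAt (cornerModel d) x₀).symm ⁻¹' S) z := by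
  have h1 := (hasMFDerivWithinAt_extChartAt_symm hz).mono
    (s := (extChartAt (cornerModel d) x₀).target ∩ (extChartAt (cornerModel d) x₀).symm ⁻¹' S)
    (inter_subset_left.trans (extChartAt_target_subset_range x₀))
  have h2 := HasMFDerivWithinAt.comp z hΦ h1 inter_subset_right
  have h3 := (hasMFDerivAt_extChartAt' hΦz).comp_hasMFDerivWithinAt z h2
  exact h3.hasFDerivWithinAt

variable [RiemannianBundle (fun x : X ↦ TangentSpace (cornerModel d) x)]
  [IsContMDiffRiemannianBundle (cornerModel d) ∞ (EuclideanSpace ℝ (Fin d))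
      (fun x : X ↦ TangentSpace (cornerModel d) x)]

lemma continuousOn_chartVolumeDensity (x₀ : X) :
    ContinuousOn (chartVolumeDensity d X x₀) (extChartAt (cornerModel d) x₀).target := by
  refine Real.continuous_sqrt.comp_continuousOn ?_
  have : ∀ i j, ContinuousOn (fun z ↦ inner ℝ (coordVector d X x₀ z i) (coordVector d X x₀ z j))
      (extChartAt (cornerModel d) x₀).target := fun i j ↦
    ContinuousOn.inner_bundle (continuousOn_dChartSymm x₀ _) (continuousOn_dChartSymm x₀ _)
  have hc : ContinuousOn (fun z ↦ Matrix.of fun i j : Fin d ↦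
    inner ℝ (coordVector d X x₀ z i) (coordVector d X x₀ z j))
      (extChartAt (cornerModel d) x₀).target :=
    continuousOn_pi.2 fun i ↦ continuousOn_pi.2 fun j ↦ this i j
  exact (Continuous.matrix_det continuous_id).comp_continuousOn hc

variable [MeasurableSpace X] [BorelSpace X]

lemma aemeasurable_chartVolumeDensity (x₀ : X) :
    AEMeasurable (fun z ↦ ENNReal.ofReal (chartVolumeDensity d X x₀ z))
      ((volume : Measure (EuclideanSpace ℝ (Fin d))).restrict
        (extChartAt (cornerModel d) x₀).target) :=
  ((continuousOn_chartVolumeDensity x₀).aemeasurable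
    (measurableSet_extChartAt_target x₀)).ennreal_ofReal

lemma aemeasurable_extChartAt_symm (x₀ : X) :
    AEMeasurable (extChartAt (cornerModel d) x₀).symm
      ((volume : Measure (EuclideanSpace ℝ (Fin d))).restrict
        (extChartAt (cornerModel d) x₀).target) :=
  (continuousOn_extChartAt_symm x₀).aemeasurable (measurableSet_extChartAt_target x₀)

lemma lintegral_chartVolume (x₀ : X) {f : X → ℝ≥0∞} (hf : Measurable f) :
    ∫⁻ x, f x ∂(chartVolume d X x₀) =
      ∫⁻ z in (extChartAt (cornerModel d) x₀).target,
        ENNReal.ofReal (chartVolumeDensity d X x₀ z) * f ((extChartAt (cornerModel d) x₀).symm z) := by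
  have hac : ((volume : Measure (EuclideanSpace ℝ (Fin d))).restrict
      (extChartAt (cornerModel d) x₀).target).withDensity
        (fun z ↦ ENNReal.ofReal (chartVolumeDensity d X x₀ z)) ≪
      ((volume : Measure (EuclideanSpace ℝ (Fin d))).restrict
        (extChartAt (cornerModel d) x₀).target) := withDensity_absolutelyContinuous _ _
  rw [chartVolume, lintegral_map' hf.aemeasurable
    ((aemeasurable_extChartAt_symm x₀).mono_ac hac)]
  exact lintegral_withDensity_eq_lintegral_mul₀ (aemeasurable_chartVolumeDensity x₀)
    (hf.comp_aemeasurable (aemeasurable_extChartAt_symm x₀))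

lemma measurableSet_inter_preimage_of_continuousOn {α β : Type*} [TopologicalSpace α]
    [MeasurableSpace α] [OpensMeasurableSpace α] [TopologicalSpace β] [MeasurableSpace β]
    [BorelSpace β] {f : α → β} {t : Set α} (hf : ContinuousOn f t) (ht : MeasurableSet t)
    {s : Set β} (hs : MeasurableSet s) : MeasurableSet (t ∩ f ⁻¹' s) := by
  have h := (continuousOn_iff_continuous_domRestrict.1 hf).measurable hs
  have h2 := ht.subtype_image h
  convert h2 using 1
  ext x
  simp [and_comm]

lemma setLIntegral_chartVolume (x₀ : X) {f : X → ℝ≥0∞} (hf : Measurable f) {s : Set X}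
    (hs : MeasurableSet s) :
    ∫⁻ x in s, f x ∂(chartVolume d X x₀) =
      ∫⁻ z in (extChartAt (cornerModel d) x₀).target ∩ (extChartAt (cornerModel d) x₀).symm ⁻¹' s,
        ENNReal.ofReal (chartVolumeDensity d X x₀ z) *
          f ((extChartAt (cornerModel d) x₀).symm z) := by
  have hm : MeasurableSet ((extChartAt (cornerModel d) x₀).target ∩
      (extChartAt (cornerModel d) x₀).symm ⁻¹' s) :=
    measurableSet_inter_preimage_of_continuousOn (continuousOn_extChartAt_symm x₀)
      (measurableSet_extChartAt_target x₀) hs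
  rw [← lintegral_indicator hs, lintegral_chartVolume x₀ (hf.indicator hs),
    ← lintegral_indicator hm, ← lintegral_indicator (measurableSet_extChartAt_target x₀)]
  refine lintegral_congr fun z ↦ ?_
  by_cases h1 : z ∈ (extChartAt (cornerModel d) x₀).target <;>
  by_cases h2 : (extChartAt (cornerModel d) x₀).symm z ∈ s <;>
  simp [indicator, h1, h2, -extChartAt]

lemma chartVolume_apply (x₀ : X) {s : Set X} (hs : MeasurableSet s) :
    chartVolume d X x₀ s =
      ∫⁻ z in (extChartAt (cornerModel d) x₀).target ∩ (extChartAt (cornerModel d) x₀).symm ⁻¹' s,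
        ENNReal.ofReal (chartVolumeDensity d X x₀ z) := by
  have := setLIntegral_chartVolume (d := d) x₀ (f := fun _ ↦ 1) measurable_const hs
  simpa using this

variable {Y : Type*} [EMetricSpace Y] [ChartedSpace (EuclideanQuadrant d) Y]
  [IsManifold (cornerModel d) ∞ Y]
  [RiemannianBundle (fun x : Y ↦ TangentSpace (cornerModel d) x)]
  [IsContMDiffRiemannianBundle (cornerModel d) ∞ (EuclideanSpace ℝ (Fin d))
      (fun x : Y ↦ TangentSpace (cornerModel d) x)]
  [MeasurableSpace Y] [BorelSpace Y]

/-- In charts, the Jacobian of a linear map `L` is at most `‖L‖ ^ d` times the ratio of the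
volume densities. -/
lemma abs_det_mul_chartVolumeDensity_le {x₀ : X} {y₀ y : Y} {z w : EuclideanSpace ℝ (Fin d)}
    (hw : w ∈ (extChartAt (cornerModel d) y₀).target)
    (hy : y = (extChartAt (cornerModel d) y₀).symm w)
    (L : TangentSpace (cornerModel d) ((extChartAt (cornerModel d) x₀).symm z) →L[ℝ]
      TangentSpace (cornerModel d) y) :
    |((dChart y₀ y).comp (L.comp (dChartSymm x₀ z))).det| * chartVolumeDensity d Y y₀ w ≤
      ‖L‖ ^ d * chartVolumeDensity d X x₀ z := by
  subst hy
  have h1 := sqrt_det_gram_comp_endo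
    (V := TangentSpace (cornerModel d) ((extChartAt (cornerModel d) y₀).symm w))
    (finrank_tangentSpace (d := d) _) (dChartSymm y₀ w)
    ((dChart y₀ _).comp (L.comp (dChartSymm x₀ z)))
  have h2 := sqrt_det_gram_comp_le
    (V := TangentSpace (cornerModel d) ((extChartAt (cornerModel d) x₀).symm z))
    (W := TangentSpace (cornerModel d) ((extChartAt (cornerModel d) y₀).symm w))
    (finrank_tangentSpace (d := d) _) (finrank_tangentSpace (d := d) _) L
    (fun i ↦ dChartSymm x₀ z (EuclideanSpace.single i (1 : ℝ)))
  rw [chartVolumeDensity_eq, chartVolumeDensity_eq, ← h1]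
  have e : (fun i ↦ dChartSymm y₀ w (((dChart y₀ _).comp (L.comp (dChartSymm x₀ z)))
      (EuclideanSpace.single i (1 : ℝ)))) =
      fun i ↦ L (dChartSymm x₀ z (EuclideanSpace.single i (1 : ℝ))) := by
    ext1 i
    exact dChartSymm_dChart hw _
  rw [e]
  exact h2

/-- Change of variables between two charts: a differentiable injective map increases the volume
by at most the `d`-th power of the norm of its differential. -/
lemma setLIntegral_chartVolume_image_le {x₀ : X} {y₀ : Y} {S : Set X} (hS : MeasurableSet S)
    (hSs : S ⊆ (extChartAt (cornerModel d) x₀).source) {Φ : X → Y}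
    (hΦs : MapsTo Φ S (extChartAt (cornerModel d) y₀).source) (hinj : InjOn Φ S)
    (him : MeasurableSet (Φ '' S))
    {Φ' : ∀ x, TangentSpace (cornerModel d) x →L[ℝ] TangentSpace (cornerModel d) (Φ x)}
    (hΦ : ∀ x ∈ S, HasMFDerivWithinAt (cornerModel d) (cornerModel d) Φ S x (Φ' x))
    {f : Y → ℝ≥0∞} (hf : Measurable f) {g : X → ℝ≥0∞} (hg : Measurable g)
    (hfg : ∀ x ∈ S, f (Φ x) * ‖Φ' x‖ₑ ^ d ≤ g x) :
    ∫⁻ y in Φ '' S, f y ∂(chartVolume d Y y₀) ≤ ∫⁻ x in S, g x ∂(chartVolume d X x₀) := by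
  set φ := extChartAt (cornerModel d) x₀ with hφ
  set ψ := extChartAt (cornerModel d) y₀ with hψ
  rw [setLIntegral_chartVolume y₀ hf him, setLIntegral_chartVolume x₀ hg hS]
  rw [← hφ, ← hψ]
  set s := φ.target ∩ φ.symm ⁻¹' S with hs
  have hsm : MeasurableSet s := measurableSet_inter_preimage_of_continuousOn
    (continuousOn_extChartAt_symm x₀) (measurableSet_extChartAt_target x₀) hS
  let G : EuclideanSpace ℝ (Fin d) → EuclideanSpace ℝ (Fin d) := fun w ↦ ψ (Φ (φ.symm w))
  let G' : EuclideanSpace ℝ (Fin d) → EuclideanSpace ℝ (Fin d) →L[ℝ] EuclideanSpace ℝ (Fin d) :=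
    fun z ↦ (dChart y₀ (Φ (φ.symm z))).comp ((Φ' (φ.symm z)).comp (dChartSymm x₀ z))
  have hG' : ∀ z ∈ s, HasFDerivWithinAt G (G' z) s z := fun z hz ↦
    hasFDerivWithinAt_writtenInCharts hz.1 (hΦs hz.2) (hΦ _ hz.2)
  have hGinj : InjOn G s := by
    intro z hz w hw hzw
    exact φ.symm.injOn hz.1 hw.1 (hinj hz.2 hw.2 (ψ.injOn (hΦs hz.2) (hΦs hw.2) hzw))
  have himage : ψ.target ∩ ψ.symm ⁻¹' (Φ '' S) = G '' s := by
    ext w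
    constructor
    · rintro ⟨hw, x, hx, hxw⟩
      refine ⟨φ x, ⟨φ.map_source (hSs hx), ?_⟩, ?_⟩
      · simpa [-extChartAt, φ.left_inv (hSs hx)] using hx
      · simp only [G, φ.left_inv (hSs hx), hxw, ψ.right_inv hw]
    · rintro ⟨z, hz, rfl⟩
      refine ⟨ψ.map_source (hΦs hz.2), ?_⟩
      simp only [mem_preimage, G, ψ.left_inv (hΦs hz.2)]
      exact mem_image_of_mem _ hz.2
  rw [himage, lintegral_image_eq_lintegral_abs_det_fderiv_mul _ hsm hG' hGinj]
  refine setLIntegral_mono' hsm fun z hz ↦ ?_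
  have hΦz : Φ (φ.symm z) ∈ ψ.source := hΦs hz.2
  have hleft : ψ.symm (G z) = Φ (φ.symm z) := ψ.left_inv hΦz
  have hGt : G z ∈ ψ.target := ψ.map_source hΦz
  -- the density at the image point
  have hden : |(G' z).det| * chartVolumeDensity d Y y₀ (G z) ≤
      ‖Φ' (φ.symm z)‖ ^ d * chartVolumeDensity d X x₀ z :=
    abs_det_mul_chartVolumeDensity_le hGt hleft.symm (Φ' (φ.symm z))
  calc ENNReal.ofReal |(G' z).det| *
        (ENNReal.ofReal (chartVolumeDensity d Y y₀ (G z)) * f (ψ.symm (G z)))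
      = ENNReal.ofReal (|(G' z).det| * chartVolumeDensity d Y y₀ (G z)) * f (Φ (φ.symm z)) := by
        rw [hleft, ← mul_assoc, ENNReal.ofReal_mul (abs_nonneg _)]
    _ ≤ ENNReal.ofReal (‖Φ' (φ.symm z)‖ ^ d * chartVolumeDensity d X x₀ z) * f (Φ (φ.symm z)) := by
        gcongr
    _ = ENNReal.ofReal (chartVolumeDensity d X x₀ z) *
          (f (Φ (φ.symm z)) * ‖Φ' (φ.symm z)‖ₑ ^ d) := by
        rw [ENNReal.ofReal_mul (by positivity), ENNReal.ofReal_pow (norm_nonneg (Φ' (φ.symm z))),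
          ofReal_norm]
        ring
    _ ≤ _ := by
        gcongr
        exact hfg _ hz.2

end ChartVolume

/-! ### The Riemannian volume measure and global change of variables -/

section RiemannianVolume

variable {d : ℕ} {X : Type*} [EMetricSpace X] [ChartedSpace (EuclideanQuadrant d) X]
  [IsManifold (cornerModel d) ∞ X]
  [RiemannianBundle (fun x : X ↦ TangentSpace (cornerModel d) x)]
  [IsContMDiffRiemannianBundle (cornerModel d) ∞ (EuclideanSpace ℝ (Fin d))
      (fun x : X ↦ TangentSpace (cornerModel d) x)]
  [MeasurableSpace X] [BorelSpace X]
  {Y : Type*} [EMetricSpace Y] [ChartedSpace (EuclideanQuadrant d) Y]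
  [IsManifold (cornerModel d) ∞ Y]
  [RiemannianBundle (fun x : Y ↦ TangentSpace (cornerModel d) x)]
  [IsContMDiffRiemannianBundle (cornerModel d) ∞ (EuclideanSpace ℝ (Fin d))
      (fun x : Y ↦ TangentSpace (cornerModel d) x)]
  [MeasurableSpace Y] [BorelSpace Y]

lemma chartVolume_le_riemVolume (x₀ : X) : chartVolume d X x₀ ≤ riemVolume d X :=
  le_iSup (fun x ↦ chartVolume d X x) x₀

lemma measurableSet_extChartAt_source (x₀ : X) :
    MeasurableSet (extChartAt (cornerModel d) x₀).source :=
  (isOpen_extChartAt_source x₀).measurableSet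

lemma chartVolume_compl_source (x₀ : X) :
    chartVolume d X x₀ (extChartAt (cornerModel d) x₀).sourceᶜ = 0 := by
  rw [chartVolume_apply x₀ (measurableSet_extChartAt_source x₀).compl]
  have : (extChartAt (cornerModel d) x₀).target ∩ (extChartAt (cornerModel d) x₀).symm ⁻¹'
      (extChartAt (cornerModel d) x₀).sourceᶜ = ∅ := by
    ext z
    simp only [mem_inter_iff, mem_preimage, mem_compl_iff, mem_empty_iff_false, iff_false, not_and,
      not_not]
    exact (extChartAt (cornerModel d) x₀).map_target
  rw [this]
  simp

/-- The chart volumes agree on overlaps. -/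
lemma chartVolume_le_chartVolume (x₀ x₁ : X) {s : Set X} (hs : MeasurableSet s)
    (hss : s ⊆ (extChartAt (cornerModel d) x₀).source) :
    chartVolume d X x₁ s ≤ chartVolume d X x₀ s := by
  set t := s ∩ (extChartAt (cornerModel d) x₁).source with ht
  have htm : MeasurableSet t := hs.inter (measurableSet_extChartAt_source x₁)
  have h1 : chartVolume d X x₁ s ≤ chartVolume d X x₁ t := by
    have := measure_le_inter_add_sdiff (chartVolume d X x₁) s
      (extChartAt (cornerModel d) x₁).source
    refine this.trans ?_
    rw [measure_mono_null (sdiff_subset_compl s _) (chartVolume_compl_source x₁), add_zero]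
  have h2 : chartVolume d X x₁ t ≤ chartVolume d X x₀ t := by
    have := setLIntegral_chartVolume_image_le (d := d) (x₀ := x₀) (y₀ := x₁) (S := t) htm
      (inter_subset_left.trans hss) (Φ := id) (fun x hx ↦ hx.2) (injOn_id _) (by simpa using htm)
      (Φ' := fun x ↦ ContinuousLinearMap.id ℝ (TangentSpace (cornerModel d) x))
      (fun x _ ↦ hasMFDerivWithinAt_id _ x) (f := fun _ ↦ 1) measurable_const
      (g := fun _ ↦ 1) measurable_const (fun x _ ↦ by
        rw [one_mul]
        refine pow_le_one' ?_ d
        rw [← ofReal_norm, ENNReal.ofReal_le_one]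
        exact ContinuousLinearMap.norm_id_le)
    simpa using this
  exact h1.trans (h2.trans (measure_mono inter_subset_left))

/-- The chart volume at `x₀` plus the restriction of the Riemannian volume to the complement of the
chart domain dominates every chart volume, hence their supremum. On subsets of the domain the second
summand vanishes. -/
lemma riemVolume_le_chartVolume (x₀ : X) {s : Set X} (hs : MeasurableSet s)
    (hss : s ⊆ (extChartAt (cornerModel d) x₀).source) :
    riemVolume d X s ≤ chartVolume d X x₀ s := by
  set U := (extChartAt (cornerModel d) x₀).source
  have hU : MeasurableSet U := measurableSet_extChartAt_source x₀
  have h : riemVolume d X ≤ chartVolume d X x₀ + (riemVolume d X).restrict Uᶜ := by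
    refine iSup_le fun x₁ ↦ ?_
    rw [Measure.le_iff]
    intro t ht
    rw [← measure_inter_add_sdiff t hU, Measure.add_apply]
    refine add_le_add ?_ ?_
    · exact (chartVolume_le_chartVolume x₀ x₁ (ht.inter hU) inter_subset_right).trans
        (measure_mono inter_subset_left)
    · rw [Measure.restrict_apply ht]
      exact chartVolume_le_riemVolume x₁ _
  refine (h s).trans ?_
  rw [Measure.add_apply, Measure.restrict_apply hs]
  have : s ∩ Uᶜ = ∅ := by
    rw [← sdiff_eq, sdiff_eq_empty]
    exact hss
  rw [this, measure_empty, add_zero]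

lemma setLIntegral_riemVolume_le_chartVolume (x₀ : X) {s : Set X} (hs : MeasurableSet s)
    (hss : s ⊆ (extChartAt (cornerModel d) x₀).source) (f : X → ℝ≥0∞) :
    ∫⁻ x in s, f x ∂(riemVolume d X) ≤ ∫⁻ x in s, f x ∂(chartVolume d X x₀) := by
  refine lintegral_mono' ?_ le_rfl
  rw [Measure.le_iff]
  intro t ht
  rw [Measure.restrict_apply ht, Measure.restrict_apply ht]
  exact riemVolume_le_chartVolume x₀ (ht.inter hs) (inter_subset_right.trans hss)

/-- Change of variables: an injective differentiable map increases the Riemannian volume by at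
most the `d`-th power of the norm of its differential. -/
lemma setLIntegral_riemVolume_image_le [SecondCountableTopology X] {S : Set X}
    (hS : MeasurableSet S) {Φ : X → Y} (hinj : InjOn Φ S)
    (him : ∀ T ⊆ S, MeasurableSet T → MeasurableSet (Φ '' T))
    {Φ' : ∀ x, TangentSpace (cornerModel d) x →L[ℝ] TangentSpace (cornerModel d) (Φ x)}
    (hΦ : ∀ x ∈ S, HasMFDerivWithinAt (cornerModel d) (cornerModel d) Φ S x (Φ' x))
    {f : Y → ℝ≥0∞} (hf : Measurable f) {g : X → ℝ≥0∞} (hg : Measurable g)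
    (hfg : ∀ x ∈ S, f (Φ x) * ‖Φ' x‖ₑ ^ d ≤ g x) :
    ∫⁻ y in Φ '' S, f y ∂(riemVolume d Y) ≤ ∫⁻ x in S, g x ∂(riemVolume d X) := by
  have hcov : ∀ x ∈ S, ∃ u : Set X, IsOpen u ∧ x ∈ u ∧
      u ∩ S ⊆ (extChartAt (cornerModel d) x).source ∩
        Φ ⁻¹' (extChartAt (cornerModel d) (Φ x)).source := by
    intro x hx
    have h1 : (extChartAt (cornerModel d) x).source ∩
        Φ ⁻¹' (extChartAt (cornerModel d) (Φ x)).source ∈ 𝓝[S] x :=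
      inter_mem (mem_nhdsWithin_of_mem_nhds (extChartAt_source_mem_nhds x))
        ((hΦ x hx).continuousWithinAt.preimage_mem_nhdsWithin (extChartAt_source_mem_nhds _))
    exact mem_nhdsWithin.1 h1
  choose! u hu1 hu2 hu3 using hcov
  obtain ⟨t, htS, htc, hSt⟩ := TopologicalSpace.countable_cover_nhdsWithin
    (s := S) (f := u) fun x hx ↦ mem_nhdsWithin_of_mem_nhds ((hu1 x hx).mem_nhds (hu2 x hx))
  rcases S.eq_empty_or_nonempty with rfl | ⟨x₁, hx₁⟩
  · simp
  have htne : t.Nonempty := by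
    obtain ⟨x, hx, -⟩ := mem_iUnion₂.1 (hSt hx₁)
    exact ⟨x, hx⟩
  obtain ⟨e, rfl⟩ := htc.exists_eq_range htne
  have he : ∀ k, e k ∈ S := fun k ↦ htS (mem_range_self k)
  -- Countably many open sets, on each of which one chart of `X` and one of `Y` suffice, cover `S`.
  -- Making them disjoint lets the local inequalities be summed.
  let D : ℕ → Set X := disjointed fun k ↦ u (e k)
  have hDm : ∀ k, MeasurableSet (D k) := fun k ↦
    MeasurableSet.disjointed (fun k ↦ (hu1 _ (he k)).measurableSet) k
  have hSD : S = ⋃ k, S ∩ D k := by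
    rw [← inter_iUnion, iUnion_disjointed, eq_comm, inter_eq_left]
    simpa using hSt
  have hpiece : ∀ k, ∫⁻ y in Φ '' (S ∩ D k), f y ∂(riemVolume d Y) ≤
      ∫⁻ x in S ∩ D k, g x ∂(riemVolume d X) := by
    intro k
    have hsub : ∀ x ∈ S ∩ D k, x ∈ (extChartAt (cornerModel d) (e k)).source ∩
        Φ ⁻¹' (extChartAt (cornerModel d) (Φ (e k))).source := fun x hx ↦
      hu3 _ (he k) ⟨disjointed_subset (fun k ↦ u (e k)) k hx.2, hx.1⟩
    have hm : MeasurableSet (S ∩ D k) := hS.inter (hDm k)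
    have him' := him _ inter_subset_left hm
    calc ∫⁻ y in Φ '' (S ∩ D k), f y ∂(riemVolume d Y)
        ≤ ∫⁻ y in Φ '' (S ∩ D k), f y ∂(chartVolume d Y (Φ (e k))) :=
          setLIntegral_riemVolume_le_chartVolume _ him'
            (image_subset_iff.2 fun x hx ↦ (hsub x hx).2) f
      _ ≤ ∫⁻ x in S ∩ D k, g x ∂(chartVolume d X (e k)) :=
          setLIntegral_chartVolume_image_le hm (fun x hx ↦ (hsub x hx).1)
            (fun x hx ↦ (hsub x hx).2) (hinj.mono inter_subset_left) him'
            (fun x hx ↦ (hΦ x hx.1).mono inter_subset_left) hf hg (fun x hx ↦ hfg x hx.1)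
      _ ≤ ∫⁻ x in S ∩ D k, g x ∂(riemVolume d X) :=
          lintegral_mono' (Measure.restrict_mono le_rfl (chartVolume_le_riemVolume _)) le_rfl
  calc ∫⁻ y in Φ '' S, f y ∂(riemVolume d Y)
      = ∫⁻ y in ⋃ k, Φ '' (S ∩ D k), f y ∂(riemVolume d Y) := by
        rw [← image_iUnion, ← hSD]
    _ ≤ ∑' k, ∫⁻ y in Φ '' (S ∩ D k), f y ∂(riemVolume d Y) := lintegral_iUnion_le _ _
    _ ≤ ∑' k, ∫⁻ x in S ∩ D k, g x ∂(riemVolume d X) := ENNReal.tsum_le_tsum hpiece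
    _ = ∫⁻ x in ⋃ k, S ∩ D k, g x ∂(riemVolume d X) := by
        rw [lintegral_iUnion (fun k ↦ hS.inter (hDm k))]
        intro i j hij
        exact (disjoint_disjointed (fun k ↦ u (e k)) hij).mono inter_subset_right
          inter_subset_right
    _ = _ := by rw [← hSD]

lemma sqrt_det_gram_pos {V : Type*} [NormedAddCommGroup V] [InnerProductSpace ℝ V]
    (P : EuclideanSpace ℝ (Fin d) →L[ℝ] V) (hP : Function.Injective P) :
    0 < √(Matrix.gram ℝ (fun i ↦ P (EuclideanSpace.single i (1 : ℝ)))).det := by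
  rw [Real.sqrt_pos]
  refine Matrix.PosDef.det_pos (Matrix.posDef_gram_of_linearIndependent ?_)
  have hb := (EuclideanSpace.basisFun (Fin d) ℝ).toBasis.linearIndependent
  have hker : LinearMap.ker P.toLinearMap = ⊥ := LinearMap.ker_eq_bot.2 hP
  have := hb.map' _ hker
  have e : (fun i ↦ P (EuclideanSpace.single i (1 : ℝ))) =
      P.toLinearMap ∘ (EuclideanSpace.basisFun (Fin d) ℝ).toBasis := by
    ext1 i
    simp
  rw [e]
  exact this

lemma chartVolumeDensity_pos {x₀ : X} {z : EuclideanSpace ℝ (Fin d)}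
    (hz : z ∈ (extChartAt (cornerModel d) x₀).target) : 0 < chartVolumeDensity d X x₀ z := by
  rw [chartVolumeDensity_eq]
  refine sqrt_det_gram_pos (V := TangentSpace (cornerModel d) _) (dChartSymm x₀ z) ?_
  intro v w hvw
  have := congrArg (dChart x₀ _) hvw
  rwa [dChart_dChartSymm hz, dChart_dChartSymm hz] at this

/-- The upper bound makes the volume locally finite. The lower bound lets Lebesgue measure in the
chart be estimated by the Riemannian volume. -/
lemma exists_ball_chartVolumeDensity_bounds (x₀ : X) : ∃ c > 0, ∃ C > 0, ∃ r > 0,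
    Metric.ball (extChartAt (cornerModel d) x₀ x₀) r ∩ range (cornerModel d) ⊆
      (extChartAt (cornerModel d) x₀).target ∩
        {z | c < chartVolumeDensity d X x₀ z ∧ chartVolumeDensity d X x₀ z < C} := by
  set z₀ := extChartAt (cornerModel d) x₀ x₀
  have hz₀ : z₀ ∈ (extChartAt (cornerModel d) x₀).target := mem_extChartAt_target x₀
  have hpos := chartVolumeDensity_pos hz₀
  refine ⟨chartVolumeDensity d X x₀ z₀ / 2, by positivity, chartVolumeDensity d X x₀ z₀ * 2,
    by positivity, Metric.mem_nhdsWithin_iff.1 ?_⟩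
  have hT : (extChartAt (cornerModel d) x₀).target ∈ 𝓝[range (cornerModel d)] z₀ :=
    extChartAt_target_mem_nhdsWithin x₀
  refine inter_mem hT ?_
  have hc := (continuousOn_chartVolumeDensity x₀) z₀ hz₀
  have hle : 𝓝[range (cornerModel d)] z₀ ≤ 𝓝[(extChartAt (cornerModel d) x₀).target] z₀ :=
    nhdsWithin_le_of_mem hT
  exact hle (hc (Ioo_mem_nhds (by linarith) (by linarith)))

scoped instance instIsFiniteMeasureRiemVolume [CompactSpace X] : IsFiniteMeasure (riemVolume d X) := by
  refine ⟨isCompact_univ.measure_lt_top_of_nhdsWithin fun x₀ _ ↦ ?_⟩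
  obtain ⟨c, -, C, hC, r, hr, hsub⟩ := exists_ball_chartVolumeDensity_bounds (d := d) x₀
  let O := (extChartAt (cornerModel d) x₀).source ∩
    extChartAt (cornerModel d) x₀ ⁻¹' (Metric.ball (extChartAt (cornerModel d) x₀ x₀) r)
  have hO : IsOpen O := isOpen_extChartAt_preimage' x₀ Metric.isOpen_ball
  have hxO : x₀ ∈ O := ⟨mem_extChartAt_source x₀, by simpa using hr⟩
  refine ⟨O, mem_nhdsWithin_of_mem_nhds (hO.mem_nhds hxO), ?_⟩
  refine (riemVolume_le_chartVolume x₀ hO.measurableSet inter_subset_left).trans_lt ?_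
  rw [chartVolume_apply x₀ hO.measurableSet]
  set W := (extChartAt (cornerModel d) x₀).target ∩ (extChartAt (cornerModel d) x₀).symm ⁻¹' O
  have hW : MeasurableSet W := measurableSet_inter_preimage_of_continuousOn
    (continuousOn_extChartAt_symm x₀) (measurableSet_extChartAt_target x₀) hO.measurableSet
  have hWb : W ⊆ Metric.ball (extChartAt (cornerModel d) x₀ x₀) r ∩ range (cornerModel d) := by
    rintro z ⟨hz, hz'⟩
    refine ⟨?_, extChartAt_target_subset_range x₀ hz⟩
    have := hz'.2
    rwa [mem_preimage, (extChartAt (cornerModel d) x₀).right_inv hz] at this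
  calc ∫⁻ z in W, ENNReal.ofReal (chartVolumeDensity d X x₀ z)
      ≤ ∫⁻ _ in W, ENNReal.ofReal C := by
        refine setLIntegral_mono' hW fun z hz ↦ ENNReal.ofReal_le_ofReal ?_
        exact (hsub (hWb hz)).2.2.le
    _ = ENNReal.ofReal C * volume W := by simp
    _ < ⊤ := by
        refine ENNReal.mul_lt_top ENNReal.ofReal_lt_top ?_
        exact (measure_mono (hWb.trans inter_subset_left)).trans_lt measure_ball_lt_top

/-- Lebesgue integrals in a chart are controlled by integrals for the Riemannian volume. -/
lemma mul_setLIntegral_chart_le {x₀ : X} {U : Set (EuclideanSpace ℝ (Fin d))}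
    (hU : MeasurableSet U) (hUt : U ⊆ (extChartAt (cornerModel d) x₀).target) {c : ℝ}
    (hc : ∀ z ∈ U, c ≤ chartVolumeDensity d X x₀ z) {f : X → ℝ≥0∞} (hf : Measurable f) :
    ENNReal.ofReal c * ∫⁻ z in U, f ((extChartAt (cornerModel d) x₀).symm z) ≤
      ∫⁻ x, f x ∂(riemVolume d X) := by
  calc ENNReal.ofReal c * ∫⁻ z in U, f ((extChartAt (cornerModel d) x₀).symm z)
      = ∫⁻ z in U, ENNReal.ofReal c * f ((extChartAt (cornerModel d) x₀).symm z) := by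
        rw [lintegral_const_mul' _ _ ENNReal.ofReal_ne_top]
    _ ≤ ∫⁻ z in U, ENNReal.ofReal (chartVolumeDensity d X x₀ z) *
          f ((extChartAt (cornerModel d) x₀).symm z) := by
        refine setLIntegral_mono' hU fun z hz ↦ ?_
        gcongr
        exact hc z hz
    _ ≤ ∫⁻ z in (extChartAt (cornerModel d) x₀).target,
          ENNReal.ofReal (chartVolumeDensity d X x₀ z) *
          f ((extChartAt (cornerModel d) x₀).symm z) := lintegral_mono_set hUt
    _ = ∫⁻ x, f x ∂(chartVolume d X x₀) := (lintegral_chartVolume x₀ hf).symm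
    _ ≤ _ := lintegral_mono' (chartVolume_le_riemVolume x₀) le_rfl

scoped instance instIsOpenPosMeasureRiemVolume : (riemVolume d X).IsOpenPosMeasure := by
  refine ⟨fun O hO ⟨x₀, hx₀⟩ h0 ↦ ?_⟩
  obtain ⟨c, hc, C, -, r, hr, hsub⟩ := exists_ball_chartVolumeDensity_bounds (d := d) x₀
  set z₀ := extChartAt (cornerModel d) x₀ x₀ with hz₀
  have hpre : (extChartAt (cornerModel d) x₀).symm ⁻¹' O ∈ 𝓝 z₀ :=
    (continuousAt_extChartAt_symm x₀).preimage_mem_nhds (by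
      rw [extChartAt_to_inv]
      exact hO.mem_nhds hx₀)
  obtain ⟨r', hr', hball⟩ := Metric.mem_nhds_iff.1 hpre
  -- The point may lie on the boundary, where a ball around `z₀` leaves the quadrant. Its part in
  -- the interior of the quadrant is still open and non-empty.
  let U := Metric.ball z₀ (min r r') ∩ interior (range (cornerModel d))
  have hUo : IsOpen U := Metric.isOpen_ball.inter isOpen_interior
  have hUne : U.Nonempty := by
    have h1 : z₀ ∈ closure (interior (range (cornerModel d))) :=
      (cornerModel d).range_subset_closure_interior
        (extChartAt_target_subset_range x₀ (mem_extChartAt_target x₀))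
    exact mem_closure_iff.1 h1 _ Metric.isOpen_ball (Metric.mem_ball_self (lt_min hr hr'))
  have hUsub : U ⊆ Metric.ball z₀ r ∩ range (cornerModel d) :=
    inter_subset_inter (Metric.ball_subset_ball (min_le_left _ _)) interior_subset
  have h1 := mul_setLIntegral_chart_le (d := d) (x₀ := x₀) hUo.measurableSet
    (hUsub.trans (hsub.trans inter_subset_left)) (c := c)
    (fun z hz ↦ (hsub (hUsub hz)).2.1.le) (f := O.indicator fun _ ↦ 1)
    (measurable_const.indicator hO.measurableSet)
  rw [lintegral_indicator_const hO.measurableSet, one_mul, h0] at h1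
  have h2 : ∫⁻ z in U, O.indicator (fun _ ↦ (1 : ℝ≥0∞)) ((extChartAt (cornerModel d) x₀).symm z)
      = volume U := by
    rw [← setLIntegral_one U]
    refine setLIntegral_congr_fun hUo.measurableSet fun z hz ↦ ?_
    have hzO : (extChartAt (cornerModel d) x₀).symm z ∈ O :=
      hball (Metric.ball_subset_ball (min_le_right _ _) hz.1)
    simp only [indicator_of_mem hzO]
  rw [h2] at h1
  have h3 : 0 < ENNReal.ofReal c * volume U :=
    ENNReal.mul_pos (by simpa using hc) (hUo.measure_pos _ hUne).ne'
  exact absurd h1 (not_le.2 h3)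

end RiemannianVolume

/-! ### From weak derivatives of limits to classical derivatives -/

section WeakDerivative

variable {E : Type*} [NormedAddCommGroup E] [NormedSpace ℝ E] [FiniteDimensional ℝ E]
  [MeasurableSpace E] [BorelSpace E] {μ : Measure E} [μ.IsAddHaarMeasure]

/-- A continuous function with a continuous weak derivative is differentiable. -/
lemma hasFDerivAt_of_weak {U : Set E} (hU : IsOpen U) {u : E → ℝ} (hu : ContinuousOn u U)
    (hui : LocallyIntegrable u μ) {T : E → E →L[ℝ] ℝ} (hT : ContinuousOn T U)
    (hw : ∀ g : E → ℝ, ContDiff ℝ 1 g → HasCompactSupport g → tsupport g ⊆ U → ∀ v,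
      ∫ x, lineDeriv ℝ g x (-v) * u x ∂μ = ∫ x, T x v * g x ∂μ) {x₀ : E} (hx₀ : x₀ ∈ U) :
    HasFDerivAt u (T x₀) x₀ := by
  -- Mollifiers with support radius `1 / (n + 1)`.
  let φ : ℕ → ContDiffBump (0 : E) := fun n ↦
    ⟨1 / ((n : ℝ) + 2), 1 / ((n : ℝ) + 1), by positivity, by
      exact one_div_lt_one_div_of_lt (by positivity) (by linarith)⟩
  have hφ : Tendsto (fun n ↦ (φ n).rOut) atTop (𝓝 0) := tendsto_one_div_add_atTop_nhds_zero_nat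
  have hsm : ∀ n, ContDiff ℝ 1 ((φ n).normed μ) := fun n ↦ (φ n).contDiff_normed (n := 1)
  have hcs : ∀ n, HasCompactSupport ((φ n).normed μ) := fun n ↦ (φ n).hasCompactSupport_normed
  let L : ℝ →L[ℝ] ℝ →L[ℝ] ℝ := ContinuousLinearMap.lsmul ℝ ℝ
  let f : ℕ → E → ℝ := fun n ↦ convolution ((φ n).normed μ) u L μ
  let f' : ℕ → E → E →L[ℝ] ℝ := fun n x ↦
    convolution (fderiv ℝ ((φ n).normed μ)) u (ContinuousLinearMap.precompL E L) μ x
  have hff' : ∀ n x, HasFDerivAt (f n) (f' n x) x := fun n x ↦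
    (hcs n).hasFDerivAt_convolution_left L (hsm n) hui x
  -- the derivative of the mollification
  have hf'v : ∀ n z v, Metric.closedBall z (φ n).rOut ⊆ U →
      f' n z v = ∫ t, T t v * (φ n).normed μ (z - t) ∂μ := by
    intro n z v hz
    have hIntegrable : Integrable (fun t ↦ (ContinuousLinearMap.precompL E L)
        (fderiv ℝ ((φ n).normed μ) (z - t)) (u t)) μ :=
      (HasCompactSupport.convolutionExists_left (ContinuousLinearMap.precompL E L)
        ((hcs n).fderiv (𝕜 := ℝ)) ((hsm n).continuous_fderiv one_ne_zero) hui z).integrable_swap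
    have h1 : f' n z v = ∫ t, fderiv ℝ ((φ n).normed μ) (z - t) v * u t ∂μ := by
      simp only [f']
      rw [convolution_eq_swap, ContinuousLinearMap.integral_apply hIntegrable]
      rfl
    let g : E → ℝ := fun t ↦ (φ n).normed μ (z - t)
    have hg : ContDiff ℝ 1 g := (hsm n).comp (contDiff_const.sub contDiff_id)
    have hgs : ∀ t, g t ≠ 0 → t ∈ Metric.ball z (φ n).rOut := by
      intro t ht
      have h2 : z - t ∈ Function.support ((φ n).normed μ) := ht
      rw [(φ n).support_normed_eq] at h2
      rw [Metric.mem_ball, dist_comm, dist_eq_norm]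
      simpa using h2
    have hts : tsupport g ⊆ Metric.closedBall z (φ n).rOut :=
      closure_minimal (fun t ht ↦ Metric.ball_subset_closedBall (hgs t ht))
        Metric.isClosed_closedBall
    have hgc : HasCompactSupport g :=
      (isCompact_closedBall z (φ n).rOut).of_isClosed_subset (isClosed_tsupport g) hts
    have h2 := hw g hg hgc (hts.trans hz) v
    rw [h1, ← h2]
    refine integral_congr_ae (Eventually.of_forall fun t ↦ ?_)
    simp only
    congr 1
    have hd : HasFDerivAt g ((fderiv ℝ ((φ n).normed μ) (z - t)).comp
        (-(ContinuousLinearMap.id ℝ E))) t := by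
      have h3 : HasFDerivAt ((φ n).normed μ) (fderiv ℝ ((φ n).normed μ) (z - t)) (z - t) :=
        ((hsm n).differentiable one_ne_zero _).hasFDerivAt
      exact h3.comp t ((hasFDerivAt_id t).const_sub z)
    rw [hd.differentiableAt.lineDeriv_eq_fderiv, hd.fderiv]
    simp
  -- By the preceding identity the derivative of the mollification is an average of `T` over a small
  -- ball, hence close to `T`, uniformly near `x₀`, by continuity of `T`.
  have hclose : ∀ ε > 0, ∃ δ > 0, ∀ n, (φ n).rOut < δ → ∀ z ∈ Metric.ball x₀ δ,
      ‖f' n z - T z‖ ≤ ε := by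
    intro ε hε
    have hTc : ContinuousAt T x₀ := hT.continuousAt (hU.mem_nhds hx₀)
    have hev : ∀ᶠ z in 𝓝 x₀, z ∈ U ∧ dist (T z) (T x₀) < ε / 2 :=
      Filter.Eventually.and (hU.mem_nhds hx₀)
        (Metric.tendsto_nhds.1 hTc (ε / 2) (by positivity))
    obtain ⟨δ, hδ, hb⟩ := Metric.eventually_nhds_iff_ball.1 hev
    refine ⟨δ / 2, by positivity, fun n hn z hz ↦ ?_⟩
    have hsub : Metric.closedBall z (φ n).rOut ⊆ Metric.ball x₀ δ := by
      intro t ht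
      rw [Metric.mem_closedBall] at ht
      rw [Metric.mem_ball] at hz ⊢
      linarith [dist_triangle t z x₀]
    refine ContinuousLinearMap.opNorm_le_bound _ hε.le fun v ↦ ?_
    rw [sub_apply,
      hf'v n z v (hsub.trans fun t ht ↦ (hb t ht).1)]
    have hz' : z ∈ Metric.ball x₀ δ := Metric.ball_subset_ball (by linarith) hz
    have hnn : ∀ t, 0 ≤ (φ n).normed μ (z - t) := fun t ↦ (φ n).nonneg_normed _
    have hone : ∫ t, (φ n).normed μ (z - t) ∂μ = 1 := by
      rw [integral_sub_left_eq_self, (φ n).integral_normed]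
    have hint1 : Integrable (fun t ↦ (φ n).normed μ (z - t)) μ :=
      ((hsm n).continuous.integrable_of_hasCompactSupport (hcs n)).comp_sub_left z
    have hzero : ∀ t, t ∉ Metric.ball z (φ n).rOut → (φ n).normed μ (z - t) = 0 := by
      intro t ht
      by_contra h
      have h2 : z - t ∈ Function.support ((φ n).normed μ) := h
      rw [(φ n).support_normed_eq] at h2
      apply ht
      rw [Metric.mem_ball, dist_comm, dist_eq_norm]
      simpa using h2
    by_cases hi : Integrable (fun t ↦ T t v * (φ n).normed μ (z - t)) μ
    · have e1 : ∫ t, T t v * (φ n).normed μ (z - t) ∂μ - T z v =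
          ∫ t, (T t v - T z v) * (φ n).normed μ (z - t) ∂μ := by
        have : T z v = ∫ t, T z v * (φ n).normed μ (z - t) ∂μ := by
          rw [integral_const_mul, hone, mul_one]
        conv_lhs => rw [this]
        rw [← integral_sub hi (hint1.const_mul _)]
        refine integral_congr_ae (Eventually.of_forall fun t ↦ ?_)
        simp only
        ring
      rw [e1]
      calc ‖∫ t, (T t v - T z v) * (φ n).normed μ (z - t) ∂μ‖
          ≤ ∫ t, ε * ‖v‖ * (φ n).normed μ (z - t) ∂μ := by
            refine norm_integral_le_of_norm_le (hint1.const_mul _)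
              (Eventually.of_forall fun t ↦ ?_)
            by_cases ht : t ∈ Metric.ball z (φ n).rOut
            · rw [norm_mul, Real.norm_of_nonneg (hnn t)]
              refine mul_le_mul_of_nonneg_right ?_ (hnn t)
              rw [← sub_apply]
              refine (ContinuousLinearMap.le_opNorm _ _).trans ?_
              refine mul_le_mul_of_nonneg_right ?_ (norm_nonneg _)
              have h1 := (hb t (hsub (Metric.ball_subset_closedBall ht))).2
              have h2 := (hb z hz').2
              rw [← dist_eq_norm]
              linarith [dist_triangle_right (T t) (T z) (T x₀)]
            · simp [hzero t ht]
        _ = ε * ‖v‖ := by rw [integral_const_mul, hone, mul_one]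
    -- The map `T` is continuous only on `U`, but the mollifier vanishes outside a closed ball
    -- inside `U`. The product is therefore continuous with compact support, so it is integrable.
    · exfalso
      apply hi
      have hcont : Continuous (fun t ↦ T t v * (φ n).normed μ (z - t)) := by
        refine continuous_of_tsupport fun t ht ↦ ?_
        have htb : t ∈ Metric.closedBall z (φ n).rOut := by
          refine closure_minimal (fun s hs ↦ ?_) Metric.isClosed_closedBall ht
          by_contra hs'
          apply hs
          simp [hzero s fun h ↦ hs' (Metric.ball_subset_closedBall h)]
        have htU := (hb t (hsub htb)).1
        have hTt : ContinuousAt T t := hT.continuousAt (hU.mem_nhds htU)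
        exact (hTt.clm_apply continuousAt_const).mul
          ((hsm n).continuous.comp (continuous_const.sub continuous_id)).continuousAt
      refine hcont.integrable_of_hasCompactSupport ?_
      refine HasCompactSupport.intro (isCompact_closedBall z (φ n).rOut) fun t ht ↦ ?_
      simp [hzero t fun h ↦ ht (Metric.ball_subset_closedBall h)]
  -- Uniform convergence of the derivatives near `x₀` and pointwise convergence of the
  -- mollifications identify the derivative of the limit.
  refine hasFDerivAt_of_tendstoUniformlyOnFilter (f := f) (f' := f') (g' := T) (l := atTop) ?_
    (Eventually.of_forall fun p ↦ hff' p.1 p.2) ?_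
  · rw [Metric.tendstoUniformlyOnFilter_iff]
    intro ε hε
    obtain ⟨δ, hδ, h⟩ := hclose (ε / 2) (by positivity)
    have h1 : ∀ᶠ n in atTop, (φ n).rOut < δ := hφ.eventually (gt_mem_nhds hδ)
    filter_upwards [h1.prod_mk (Metric.ball_mem_nhds x₀ hδ)] with p hp
    rw [dist_comm, dist_eq_norm]
    linarith [h p.1 hp.1 p.2 hp.2]
  · filter_upwards [hU.mem_nhds hx₀] with y hy
    refine ContDiffBump.convolution_tendsto_right hφ
      (Eventually.of_forall fun _ ↦ hui.aestronglyMeasurable) ?_ tendsto_const_nhds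
    exact (hu.continuousAt (hU.mem_nhds hy)).tendsto.comp tendsto_snd

/-- A uniform limit of Lipschitz functions on large subsets, whose derivatives converge in mean,
has the limit of the derivatives as its weak derivative. -/
lemma weak_of_tendsto {U : Set E} (hU : IsOpen U) (hUf : μ U ≠ ⊤) {u : E → ℝ}
    (hu : ContinuousOn u U) {T : E → E →L[ℝ] ℝ} (hT : ContinuousOn T U) {B C : ℝ≥0}
    (huB : ∀ x ∈ U, ‖u x‖ ≤ B) (hTC : ∀ x ∈ U, ‖T x‖ ≤ C)
    {A : ℕ → Set E} (hA : ∀ n, MeasurableSet (A n)) {K : ℕ → ℝ≥0} {w : ℕ → E → ℝ}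
    (hwK : ∀ n, LipschitzOnWith (K n) (w n) (A n ∩ U)) (hwB : ∀ n, ∀ x ∈ A n ∩ U, ‖w n x‖ ≤ B)
    {T' : ℕ → E → E →L[ℝ] ℝ}
    (hwT : ∀ n, ∀ x ∈ A n ∩ U, HasFDerivWithinAt (w n) (T' n x) (A n ∩ U) x)
    (huniq : ∀ n, ∀ x ∈ A n ∩ U, UniqueDiffWithinAt ℝ (A n ∩ U) x)
    (hlim : ∀ ε : ℝ≥0, 0 < ε → ∀ᶠ n in atTop, ∀ x ∈ A n ∩ U, ‖w n x - u x‖ ≤ ε)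
    (hvol : Tendsto (fun n ↦ μ (U \ A n)) atTop (𝓝 0))
    (hvolK : Tendsto (fun n ↦ μ (U \ A n) * K n) atTop (𝓝 0))
    (hder : ∀ v, Tendsto (fun n ↦ ∫⁻ x in A n ∩ U, ‖T' n x v - T x v‖ₑ ∂μ) atTop (𝓝 0))
    {g : E → ℝ} (hg : ContDiff ℝ 1 g) (hgc : HasCompactSupport g) (hgU : tsupport g ⊆ U) (v : E) :
    ∫ x, lineDeriv ℝ g x (-v) * u x ∂μ = ∫ x, T x v * g x ∂μ := by
  obtain ⟨D, hD⟩ := ContDiff.lipschitzWith_of_hasCompactSupport hgc hg one_ne_zero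
  -- extensions of the approximating functions
  have hext : ∀ n, ∃ f : E → ℝ, LipschitzWith (K n) f ∧ EqOn f (w n) (A n ∩ U) ∧
      ∀ x, ‖f x‖ ≤ B := by
    intro n
    obtain ⟨f, hf, hfw⟩ := (hwK n).extend_real
    -- Truncating the Lipschitz extension at `±B` keeps its Lipschitz constant and its values on `A
    -- n ∩ U`, and bounds it off `A n` independently of `n`.
    refine ⟨fun x ↦ max (-(B : ℝ)) (min B (f x)), (hf.const_min _).const_max _, ?_, ?_⟩
    · intro x hx
      have h := abs_le.1 (hwB n x hx)
      simp only
      rw [← hfw hx, min_eq_right h.2, max_eq_right h.1]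
    · intro x
      rw [Real.norm_eq_abs, abs_le]
      refine ⟨le_max_left _ _, max_le ?_ (min_le_left _ _)⟩
      have := B.2
      simp only [NNReal.val_eq_coe] at this
      linarith
  choose f hfK hfw hfB using hext
  -- Integration by parts for Lipschitz functions. The two sides are passed to the limit separately
  -- below.
  have hkey : ∀ n, ∫ x, lineDeriv ℝ (f n) x v * g x ∂μ = ∫ x, lineDeriv ℝ g x (-v) * f n x ∂μ :=
    fun n ↦ (hfK n).integral_lineDeriv_mul_eq hD hgc v
  -- the test function and its derivative
  have hgd : ∀ x, lineDeriv ℝ g x (-v) = fderiv ℝ g x (-v) := fun x ↦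
    (hg.differentiable one_ne_zero x).lineDeriv_eq_fderiv
  have hg'c : Continuous (fun x ↦ fderiv ℝ g x (-v)) :=
    (hg.continuous_fderiv one_ne_zero).clm_apply continuous_const
  have hg'cs : HasCompactSupport (fun x ↦ fderiv ℝ g x (-v)) :=
    hgc.fderiv_apply (𝕜 := ℝ) (-v)
  have hg'U : tsupport (fun x ↦ fderiv ℝ g x (-v)) ⊆ U :=
    (tsupport_fderiv_apply_subset ℝ (-v)).trans hgU
  obtain ⟨c, hc⟩ := hg'cs.exists_bound_of_continuous hg'c
  obtain ⟨c₀, hc₀⟩ := hgc.exists_bound_of_continuous hg.continuous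
  simp only [hgd] at hkey ⊢
  have hmA : ∀ n, MeasurableSet (A n ∩ U) := fun n ↦ (hA n).inter hU.measurableSet
  -- first limit
  have hi1 : Integrable (fun x ↦ fderiv ℝ g x (-v) * u x) μ := by
    refine Continuous.integrable_of_hasCompactSupport ?_ hg'cs.mul_right
    refine continuous_of_tsupport fun x hx ↦ ?_
    exact hg'c.continuousAt.mul
      (hu.continuousAt (hU.mem_nhds (hg'U (tsupport_mul_subset_left hx))))
  have hi2 : ∀ n, Integrable (fun x ↦ fderiv ℝ g x (-v) * f n x) μ := fun n ↦
    (hg'c.mul (hfK n).continuous).integrable_of_hasCompactSupport hg'cs.mul_right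
  have lim1 : Tendsto (fun n ↦ ∫ x, fderiv ℝ g x (-v) * f n x ∂μ) atTop
      (𝓝 (∫ x, fderiv ℝ g x (-v) * u x ∂μ)) := by
    rw [tendsto_iff_edist_tendsto_0]
    have hbound : ∀ ε : ℝ≥0, 0 < ε → ∀ᶠ n in atTop,
        edist (∫ x, fderiv ℝ g x (-v) * f n x ∂μ) (∫ x, fderiv ℝ g x (-v) * u x ∂μ) ≤
        ENNReal.ofReal c * (ε * μ U + (2 * B) * μ (U \ A n)) := by
      intro ε hε
      filter_upwards [hlim ε hε] with n hn
      rw [edist_eq_enorm_sub, ← integral_sub (hi2 n) hi1]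
      refine (enorm_integral_le_lintegral_enorm _).trans ?_
      have hpt : ∀ x, ‖fderiv ℝ g x (-v) * f n x - fderiv ℝ g x (-v) * u x‖ₑ ≤
          U.indicator (fun x ↦ ENNReal.ofReal c * ((A n).indicator (fun _ ↦ (ε : ℝ≥0∞)) x +
            (A n)ᶜ.indicator (fun _ ↦ (2 * B : ℝ≥0∞)) x)) x := by
        intro x
        by_cases hx : x ∈ U
        · rw [indicator_of_mem hx, ← mul_sub, enorm_mul]
          refine mul_le_mul' ?_ ?_
          · rw [← ofReal_norm]
            exact ENNReal.ofReal_le_ofReal (hc x)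
          · by_cases hxA : x ∈ A n
            · rw [indicator_of_mem hxA, indicator_of_notMem (by simpa using hxA), add_zero,
                hfw n ⟨hxA, hx⟩]
              exact_mod_cast enorm_le_coe.2 (hn x ⟨hxA, hx⟩)
            · rw [indicator_of_notMem hxA, indicator_of_mem (by simpa using hxA), zero_add]
              have h3 : ‖f n x - u x‖₊ ≤ 2 * B := by
                rw [← NNReal.coe_le_coe]
                push_cast
                have := norm_sub_le (f n x) (u x)
                linarith [hfB n x, huB x hx]
              exact_mod_cast enorm_le_coe.2 h3
        · have h0 : fderiv ℝ g x (-v) = 0 := by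
            by_contra h
            exact hx (hg'U (subset_tsupport _ h))
          simp [h0, hx]
      refine (lintegral_mono hpt).trans ?_
      rw [lintegral_indicator hU.measurableSet, lintegral_const_mul' _ _ ENNReal.ofReal_ne_top,
        lintegral_add_left (measurable_const.indicator (hA n)),
        lintegral_indicator_const (hA n), lintegral_indicator_const (hA n).compl,
        Measure.restrict_apply (hA n), Measure.restrict_apply (hA n).compl]
      gcongr
      · exact inter_subset_right
      · rw [inter_comm, ← sdiff_eq]
    refine ENNReal.tendsto_nhds_zero.2 fun δ hδ ↦ ?_
    obtain ⟨ε, hε, hεδ⟩ : ∃ ε : ℝ≥0, 0 < ε ∧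
        ENNReal.ofReal c * (ε * μ U) < δ := by
      have ht : Tendsto (fun ε : ℝ≥0 ↦ ENNReal.ofReal c * (ε * μ U)) (𝓝[>] 0) (𝓝 0) := by
        have h1 : Tendsto (fun ε : ℝ≥0 ↦ ENNReal.ofReal c * (ε * μ U)) (𝓝 0)
            (𝓝 (ENNReal.ofReal c * (((0 : ℝ≥0) : ℝ≥0∞) * μ U))) := by
          refine ENNReal.Tendsto.const_mul ?_ (Or.inr ENNReal.ofReal_ne_top)
          exact ENNReal.Tendsto.mul_const ENNReal.continuous_coe.continuousAt (Or.inr hUf)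
        simp only [ENNReal.coe_zero, zero_mul, mul_zero] at h1
        exact h1.mono_left nhdsWithin_le_nhds
      obtain ⟨ε, h1, h2⟩ := ((ht.eventually (gt_mem_nhds hδ)).and self_mem_nhdsWithin).exists
      exact ⟨ε, h2, h1⟩
    have ht2 : Tendsto (fun n ↦ ENNReal.ofReal c * (ε * μ U + (2 * B) * μ (U \ A n))) atTop
        (𝓝 (ENNReal.ofReal c * (ε * μ U + (2 * B) * 0))) := by
      refine ENNReal.Tendsto.const_mul ?_ (Or.inr ENNReal.ofReal_ne_top)
      refine tendsto_const_nhds.add (ENNReal.Tendsto.const_mul hvol (Or.inr ?_))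
      exact ENNReal.mul_ne_top (by simp) (by simp)
    rw [mul_zero, add_zero] at ht2
    filter_upwards [hbound ε hε, ht2.eventually (gt_mem_nhds hεδ)] with n h1 h2
    exact h1.trans h2.le
  -- second limit
  have hi3 : Integrable (fun x ↦ T x v * g x) μ := by
    refine Continuous.integrable_of_hasCompactSupport ?_ hgc.mul_left
    refine continuous_of_tsupport fun x hx ↦ ?_
    have hxU := hgU (tsupport_mul_subset_right hx)
    exact ((hT.continuousAt (hU.mem_nhds hxU)).clm_apply continuousAt_const).mul
      hg.continuous.continuousAt
  have hbl : ∀ n x, ‖lineDeriv ℝ (f n) x v‖ ≤ K n * ‖v‖ := fun n x ↦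
    norm_lineDeriv_le_of_lipschitz ℝ (hfK n)
  have hi4 : ∀ n, Integrable (fun x ↦ lineDeriv ℝ (f n) x v * g x) μ := fun n ↦
    (hg.continuous.integrable_of_hasCompactSupport hgc).bdd_mul (c := K n * ‖v‖)
      (aestronglyMeasurable_lineDeriv (hfK n).continuous μ) (Eventually.of_forall (hbl n))
  have lim2 : Tendsto (fun n ↦ ∫ x, lineDeriv ℝ (f n) x v * g x ∂μ) atTop
      (𝓝 (∫ x, T x v * g x ∂μ)) := by
    rw [tendsto_iff_edist_tendsto_0]
    have hbound : ∀ n, edist (∫ x, lineDeriv ℝ (f n) x v * g x ∂μ) (∫ x, T x v * g x ∂μ) ≤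
        ENNReal.ofReal c₀ * (∫⁻ x in A n ∩ U, ‖T' n x v - T x v‖ₑ ∂μ +
          (μ (U \ A n) * K n + μ (U \ A n) * C) * ‖v‖ₑ) := by
      intro n
      rw [edist_eq_enorm_sub, ← integral_sub (hi4 n) hi3]
      refine (enorm_integral_le_lintegral_enorm _).trans ?_
      -- On `A n` the a.e. derivative of the extension is the given `T' n`, by uniqueness of
      -- derivatives within `A n ∩ U`. Off `A n` only the bound by `K n` is available, and its
      -- contribution is absorbed by `hvolK`.
      have hae : ∀ᵐ x ∂μ, ‖lineDeriv ℝ (f n) x v * g x - T x v * g x‖ₑ ≤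
          ENNReal.ofReal c₀ * ((A n ∩ U).indicator (fun x ↦ ‖T' n x v - T x v‖ₑ) x +
            (U \ A n).indicator (fun _ ↦ ((K n : ℝ≥0∞) + C) * ‖v‖ₑ) x) := by
        filter_upwards [(hfK n).ae_differentiableAt (μ := μ)] with x hdx
        by_cases hx : x ∈ U
        · rw [← sub_mul, mul_comm, enorm_mul]
          refine mul_le_mul' ?_ ?_
          · rw [← ofReal_norm]
            exact ENNReal.ofReal_le_ofReal (hc₀ x)
          · by_cases hxA : x ∈ A n
            · have hm : x ∈ A n ∩ U := ⟨hxA, hx⟩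
              rw [indicator_of_mem hm, indicator_of_notMem (fun h ↦ h.2 hxA), add_zero,
                hdx.lineDeriv_eq_fderiv]
              have h1 : HasFDerivWithinAt (w n) (fderiv ℝ (f n) x) (A n ∩ U) x :=
                hdx.hasFDerivAt.hasFDerivWithinAt.congr (fun y hy ↦ (hfw n hy).symm)
                  (hfw n hm).symm
              rw [(huniq n x hm).eq h1 (hwT n x hm)]
            · rw [indicator_of_notMem (fun h ↦ hxA h.1), indicator_of_mem (show x ∈ U \ A n from ⟨hx, hxA⟩),
                zero_add]
              refine (enorm_sub_le).trans ?_
              rw [add_mul]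
              refine add_le_add ?_ ?_
              · have := ENNReal.ofReal_le_ofReal (hbl n x)
                rwa [ENNReal.ofReal_mul (by positivity), ofReal_norm, ofReal_norm,
                  ENNReal.ofReal_coe_nnreal] at this
              · have h2 : ‖T x v‖ ≤ C * ‖v‖ :=
                  (ContinuousLinearMap.le_opNorm _ _).trans (by gcongr; exact hTC x hx)
                have := ENNReal.ofReal_le_ofReal h2
                rwa [ENNReal.ofReal_mul (by positivity), ofReal_norm, ofReal_norm,
                  ENNReal.ofReal_coe_nnreal] at this
        · have h0 : g x = 0 := by
            by_contra h
            exact hx (hgU (subset_tsupport _ h))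
          simp [h0]
      refine (lintegral_mono_ae hae).trans ?_
      have hmd : MeasurableSet (U \ A n) := hU.measurableSet.diff (hA n)
      rw [lintegral_const_mul' _ _ ENNReal.ofReal_ne_top,
        lintegral_add_right _ (measurable_const.indicator hmd),
        lintegral_indicator (hmA n), lintegral_indicator_const hmd]
      refine le_of_eq ?_
      ring
    have ht := ((hder v).add (ENNReal.Tendsto.mul_const (b := ‖v‖ₑ)
      (hvolK.add (ENNReal.Tendsto.mul_const (b := (C : ℝ≥0∞)) hvol (Or.inr (by simp))))
        (Or.inr (by simp))))
    have ht' := ENNReal.Tendsto.const_mul (a := ENNReal.ofReal c₀) ht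
      (Or.inr ENNReal.ofReal_ne_top)
    simp only [zero_mul, add_zero, mul_zero] at ht'
    exact tendsto_of_tendsto_of_tendsto_of_le_of_le tendsto_const_nhds ht'
      (fun _ ↦ zero_le) hbound
  simp only [hkey] at lim2
  exact tendsto_nhds_unique lim1 lim2

/-- A uniform limit of Lipschitz functions on large subsets, whose derivatives converge in mean
to a continuous map `T`, is differentiable with derivative `T`. -/
lemma hasFDerivAt_of_tendsto {U : Set E} (hU : IsOpen U) (hUf : μ U ≠ ⊤) {u : E → ℝ}
    (hu : ContinuousOn u U) {T : E → E →L[ℝ] ℝ} (hT : ContinuousOn T U) {B C : ℝ≥0}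
    (huB : ∀ x ∈ U, ‖u x‖ ≤ B) (hTC : ∀ x ∈ U, ‖T x‖ ≤ C)
    {A : ℕ → Set E} (hA : ∀ n, MeasurableSet (A n)) {K : ℕ → ℝ≥0} {w : ℕ → E → ℝ}
    (hwK : ∀ n, LipschitzOnWith (K n) (w n) (A n ∩ U)) (hwB : ∀ n, ∀ x ∈ A n ∩ U, ‖w n x‖ ≤ B)
    {T' : ℕ → E → E →L[ℝ] ℝ}
    (hwT : ∀ n, ∀ x ∈ A n ∩ U, HasFDerivWithinAt (w n) (T' n x) (A n ∩ U) x)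
    (huniq : ∀ n, ∀ x ∈ A n ∩ U, UniqueDiffWithinAt ℝ (A n ∩ U) x)
    (hlim : ∀ ε : ℝ≥0, 0 < ε → ∀ᶠ n in atTop, ∀ x ∈ A n ∩ U, ‖w n x - u x‖ ≤ ε)
    (hvol : Tendsto (fun n ↦ μ (U \ A n)) atTop (𝓝 0))
    (hvolK : Tendsto (fun n ↦ μ (U \ A n) * K n) atTop (𝓝 0))
    (hder : ∀ v, Tendsto (fun n ↦ ∫⁻ x in A n ∩ U, ‖T' n x v - T x v‖ₑ ∂μ) atTop (𝓝 0))
    {x₀ : E} (hx₀ : x₀ ∈ U) : HasFDerivAt u (T x₀) x₀ := by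
  -- Nothing is known about `u` outside `U`. Cutting it off there makes it locally integrable
  -- without changing it near `x₀`.
  have hcongr : EqOn (U.indicator u) u U := fun x hx ↦ indicator_of_mem hx u
  have hui : LocallyIntegrable (U.indicator u) μ := by
    refine Integrable.locallyIntegrable ?_
    rw [integrable_indicator_iff hU.measurableSet]
    exact IntegrableOn.of_bound hUf.lt_top (hu.aestronglyMeasurable hU.measurableSet) B
      ((ae_restrict_mem hU.measurableSet).mono huB)
  have h := hasFDerivAt_of_weak (μ := μ) hU (hu.congr hcongr) hui hT (fun g hg hgc hgU v ↦ by
    rw [← weak_of_tendsto hU hUf hu hT huB hTC hA hwK hwB hwT huniq hlim hvol hvolK hder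
      hg hgc hgU v]
    refine integral_congr_ae (Eventually.of_forall fun x ↦ ?_)
    by_cases hx : x ∈ U
    · simp only [indicator_of_mem hx]
    · have h0 : lineDeriv ℝ g x (-v) = 0 := by
        rw [(hg.differentiable one_ne_zero x).lineDeriv_eq_fderiv]
        by_contra h
        exact hx (hgU (tsupport_fderiv_apply_subset ℝ (-v) (subset_tsupport _ h)))
      simp [h0]) hx₀
  exact h.congr_of_eventuallyEq (hcongr.eventuallyEq_of_mem (hU.mem_nhds hx₀)).symm

end WeakDerivative

/-! ### Compactness and limits of almost isometries -/

section MetricLimit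

lemma edist_map_le_add_distortion {X Y : Type*} [EMetricSpace X] [EMetricSpace Y] (f : X → Y)
    {s : Set X} {x y : X} (hx : x ∈ s) (hy : y ∈ s) :
    edist (f x) (f y) ≤ edist x y + distortion f s := by
  refine tsub_le_iff_left.1 (le_trans ?_ (le_iSup₂_of_le x hx (le_iSup₂_of_le y hy le_rfl)))
  exact le_max_left _ _

lemma edist_le_map_add_distortion {X Y : Type*} [EMetricSpace X] [EMetricSpace Y] (f : X → Y)
    {s : Set X} {x y : X} (hx : x ∈ s) (hy : y ∈ s) :
    edist x y ≤ edist (f x) (f y) + distortion f s := by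
  refine tsub_le_iff_left.1 (le_trans ?_ (le_iSup₂_of_le x hx (le_iSup₂_of_le y hy le_rfl)))
  exact le_max_right _ _

variable {Ms : ℕ → Type*} [∀ n, EMetricSpace (Ms n)] {M N : Type*} [EMetricSpace M]
  [EMetricSpace N] {F : ∀ n, PartialEquiv M (Ms n)} {G : ∀ n, PartialEquiv N (Ms n)}

/-- The sets `Aₙ` are compact, non-empty and asymptotically dense, the maps `Fₙ` are onto and
their distortion tends to zero. -/
structure IsApproxIsometry (F : ∀ n, PartialEquiv M (Ms n)) : Prop where
  target_eq : ∀ n, (F n).target = univ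
  compact : ∀ n, IsCompact (F n).source
  nonempty : ∀ n, (F n).source.Nonempty
  dense : ∀ ε : ℝ≥0∞, 0 < ε → ∀ᶠ n in atTop, ∀ x, Metric.infEDist x (F n).source ≤ ε
  distortion : Tendsto (fun n ↦ distortion (F n) (F n).source) atTop (𝓝 0)

lemma IsApproxIsometry.exists_approx (hF : IsApproxIsometry F) :
    ∃ a : ℕ → M → M, (∀ n x, a n x ∈ (F n).source) ∧
      ∀ ε : ℝ≥0∞, 0 < ε → ∀ᶠ n in atTop, ∀ x, edist x (a n x) ≤ ε := by
  have : ∀ n x, ∃ y ∈ (F n).source, Metric.infEDist x (F n).source = edist x y := fun n x ↦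
    (hF.compact n).exists_infEDist_eq_edist (hF.nonempty n) x
  choose a ha ha' using this
  refine ⟨a, ha, fun ε hε ↦ ?_⟩
  filter_upwards [hF.dense ε hε] with n hn x
  rw [← ha']
  exact hn x

lemma IsApproxIsometry.tendsto_approx {a : ℕ → M → M}
    (ha : ∀ ε : ℝ≥0∞, 0 < ε → ∀ᶠ n in atTop, ∀ x, edist x (a n x) ≤ ε) (x : M) :
    Tendsto (fun n ↦ a n x) atTop (𝓝 x) := by
  rw [tendsto_iff_edist_tendsto_0, ENNReal.tendsto_nhds_zero]
  intro ε hε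
  filter_upwards [ha ε hε] with n hn
  rw [edist_comm]
  exact hn x

/-- The transition maps `Hₙ = Gₙ⁻¹ ∘ Fₙ` take values in the domain of `Gₙ`. -/
lemma IsApproxIsometry.symm_mem (hG : IsApproxIsometry G) (n : ℕ) (y : Ms n) :
    (G n).symm y ∈ (G n).source :=
  (G n).map_target (by rw [hG.target_eq]; trivial)

lemma IsApproxIsometry.apply_symm (hG : IsApproxIsometry G) (n : ℕ) (y : Ms n) :
    G n ((G n).symm y) = y :=
  (G n).right_inv (by rw [hG.target_eq]; trivial)

/-- Both distances are compared with the distance of `F n x` and `F n y` in `Ms n`. Each comparison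
costs one distortion. -/
lemma edist_transition_le (hG : IsApproxIsometry G) (n : ℕ) {x y : M}
    (hx : x ∈ (F n).source) (hy : y ∈ (F n).source) :
    edist ((G n).symm (F n x)) ((G n).symm (F n y)) ≤
      edist x y + (distortion (F n) (F n).source + distortion (G n) (G n).source) := by
  have h1 := edist_le_map_add_distortion (G n) (hG.symm_mem n (F n x)) (hG.symm_mem n (F n y))
  rw [hG.apply_symm, hG.apply_symm] at h1
  have h2 := edist_map_le_add_distortion (F n) hx hy
  calc _ ≤ _ := h1
    _ ≤ (edist x y + distortion (F n) (F n).source) + distortion (G n) (G n).source := by gcongr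
    _ = _ := add_assoc _ _ _

lemma edist_le_transition (hG : IsApproxIsometry G) (n : ℕ) {x y : M}
    (hx : x ∈ (F n).source) (hy : y ∈ (F n).source) :
    edist x y ≤ edist ((G n).symm (F n x)) ((G n).symm (F n y)) +
      (distortion (F n) (F n).source + distortion (G n) (G n).source) := by
  have h1 := edist_map_le_add_distortion (G n) (hG.symm_mem n (F n x)) (hG.symm_mem n (F n y))
  rw [hG.apply_symm, hG.apply_symm] at h1
  have h2 := edist_le_map_add_distortion (F n) hx hy
  calc _ ≤ _ := h2
    _ ≤ (edist ((G n).symm (F n x)) ((G n).symm (F n y)) + distortion (G n) (G n).source) +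
        distortion (F n) (F n).source := by gcongr
    _ = _ := by rw [add_assoc, add_comm (distortion (G n) _)]

lemma tendsto_distortion_add (hF : IsApproxIsometry F) (hG : IsApproxIsometry G) :
    Tendsto (fun n ↦ distortion (F n) (F n).source + distortion (G n) (G n).source)
      atTop (𝓝 0) := by
  simpa using hF.distortion.add hG.distortion

/-- The transition maps have a uniformly convergent subsequence. -/
lemma exists_isUniformLimitAlong [CompactSpace M] [CompactSpace N]
    (hF : IsApproxIsometry F) (hG : IsApproxIsometry G) :
    ∃ φ : ℕ → ℕ, StrictMono φ ∧ ∃ H : M → N, IsUniformLimitAlong F G φ H := by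
  obtain ⟨a, ha, ha'⟩ := hF.exists_approx
  let h : ℕ → M → N := fun n x ↦ (G n).symm (F n (a n x))
  -- A non-principal ultrafilter gives limits at all points at once, without a diagonal argument.
  let 𝒰 : Ultrafilter ℕ := hyperfilter ℕ
  have h𝒰 : (𝒰 : Filter ℕ) ≤ atTop := Nat.hyperfilter_le_atTop
  have hlim : ∀ x, ∃ y : N, Tendsto (fun n ↦ h n x) 𝒰 (𝓝 y) := by
    intro x
    obtain ⟨y, -, hy⟩ := isCompact_iff_ultrafilter_le_nhds.1 (isCompact_univ (X := N))
      (𝒰.map fun n ↦ h n x) (by simp)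
    exact ⟨y, hy⟩
  choose H hH using hlim
  let δ : ℕ → ℝ≥0∞ := fun n ↦ distortion (F n) (F n).source + distortion (G n) (G n).source
  have hδ : Tendsto δ atTop (𝓝 0) := tendsto_distortion_add hF hG
  have hHlip : ∀ x y, edist (H x) (H y) ≤ edist x y := by
    intro x y
    have t1 : Tendsto (fun n ↦ edist (h n x) (h n y)) 𝒰 (𝓝 (edist (H x) (H y))) :=
      (hH x).edist (hH y)
    have t2 : Tendsto (fun n ↦ edist (a n x) (a n y) + δ n) 𝒰 (𝓝 (edist x y + 0)) :=
      ((((IsApproxIsometry.tendsto_approx ha' x).edist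
        (IsApproxIsometry.tendsto_approx ha' y)).add hδ).mono_left h𝒰)
    rw [add_zero] at t2
    exact le_of_tendsto_of_tendsto' t1 t2 fun n ↦ edist_transition_le hG n (ha n x) (ha n y)
  have hHc : Continuous H := (LipschitzWith.of_edist_le hHlip).continuous
  -- Pointwise convergence is made uniform with a finite `ε`-net. The five terms are twice the
  -- distance to the net (in `M` and after applying `H`), the approximation of the net point in `(F
  -- n).source`, the distortions, and the convergence at the net point.
  have hunif : ∀ ε : ℝ≥0∞, 0 < ε → ∀ᶠ n in (𝒰 : Filter ℕ),
      ⨆ x ∈ (F n).source, edist ((G n).symm (F n x)) (H x) ≤ 5 * ε := by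
    intro ε hε
    obtain ⟨t, ht⟩ : ∃ t : Finset M, ∀ x, ∃ y ∈ t, edist x y < ε := by
      obtain ⟨t, ht⟩ := isCompact_univ.elim_finite_subcover (fun y : M ↦ Metric.eball y ε)
        (fun y ↦ Metric.isOpen_eball) fun x _ ↦ mem_iUnion.2 ⟨x, Metric.mem_eball_self hε⟩
      refine ⟨t, fun x ↦ ?_⟩
      obtain ⟨y, hy, hxy⟩ := mem_iUnion₂.1 (ht (mem_univ x))
      exact ⟨y, hy, hxy⟩
    have e1 : ∀ᶠ n in (𝒰 : Filter ℕ), ∀ y ∈ t, edist (h n y) (H y) ≤ ε := by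
      rw [Filter.eventually_all_finset]
      intro y _
      exact ENNReal.tendsto_nhds_zero.1 (tendsto_iff_edist_tendsto_0.1 (hH y)) ε hε
    have e2 : ∀ᶠ n in (𝒰 : Filter ℕ), δ n ≤ ε := h𝒰 (ENNReal.tendsto_nhds_zero.1 hδ ε hε)
    have e3 : ∀ᶠ n in (𝒰 : Filter ℕ), ∀ x, edist x (a n x) ≤ ε := h𝒰 (ha' ε hε)
    filter_upwards [e1, e2, e3] with n h1 h2 h3
    refine iSup₂_le fun x hx ↦ ?_
    obtain ⟨y, hy, hxy⟩ := ht x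
    calc edist ((G n).symm (F n x)) (H x)
        ≤ edist ((G n).symm (F n x)) (h n y) + edist (h n y) (H y) + edist (H y) (H x) :=
          edist_triangle4 _ _ _ _
      _ ≤ ((edist x y + edist y (a n y)) + δ n) + ε + edist x y := by
          gcongr
          · refine (edist_transition_le hG n hx (ha n y)).trans ?_
            change _ + δ n ≤ _
            gcongr
            exact edist_triangle _ _ _
          · exact h1 y hy
          · rw [edist_comm x y]
            exact hHlip y x
      _ ≤ ((ε + ε) + ε) + ε + ε := by
          gcongr
          exact h3 y
      _ = 5 * ε := by ring
  -- An event of the ultrafilter happens for infinitely many `n`, which is enough to extract a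
  -- subsequence.
  have hfreq : ∀ k : ℕ, ∃ᶠ n in atTop,
      ⨆ x ∈ (F n).source, edist ((G n).symm (F n x)) (H x) ≤ 5 * ((k : ℝ≥0∞) + 1)⁻¹ := by
    intro k
    have h1 := hunif ((k : ℝ≥0∞) + 1)⁻¹ (by simp)
    exact h1.frequently.filter_mono h𝒰
  obtain ⟨φ, hφ, hφ'⟩ := extraction_forall_of_frequently hfreq
  refine ⟨φ, hφ, H, hHc, ?_⟩
  have ht : Tendsto (fun k : ℕ ↦ 5 * ((k : ℝ≥0∞) + 1)⁻¹) atTop (𝓝 0) := by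
    have h1 : Tendsto (fun k : ℕ ↦ (((k + 1 : ℕ) : ℝ≥0∞))⁻¹) atTop (𝓝 0) :=
      ENNReal.tendsto_inv_nat_nhds_zero.comp (tendsto_add_atTop_nat 1)
    have h2 := ENNReal.Tendsto.const_mul (a := 5) h1 (Or.inr (by simp))
    simpa using h2
  exact tendsto_of_tendsto_of_tendsto_of_le_of_le tendsto_const_nhds ht (fun _ ↦ zero_le) hφ'

/-- The point `x` may lie outside every source, so the transition maps are evaluated at
approximating points. Uniform convergence and continuity of `H` combine to give the limit. -/
lemma tendsto_transition_approx {H : M → N} (hH : IsUniformLimitAlong F G id H)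
    {x : M} {a : ℕ → M} (ha : ∀ n, a n ∈ (F n).source) (hax : Tendsto a atTop (𝓝 x)) :
    Tendsto (fun n ↦ (G n).symm (F n (a n))) atTop (𝓝 (H x)) := by
  rw [tendsto_iff_edist_tendsto_0]
  have h1 : Tendsto (fun n ↦ (⨆ x ∈ (F n).source, edist ((G n).symm (F n x)) (H x)) +
      edist (H (a n)) (H x)) atTop (𝓝 0) := by
    have h3 := tendsto_iff_edist_tendsto_0.1 ((hH.1.tendsto x).comp hax)
    simpa using hH.2.add h3
  refine tendsto_of_tendsto_of_tendsto_of_le_of_le tendsto_const_nhds h1 (fun _ ↦ zero_le)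
    fun n ↦ (edist_triangle _ (H (a n)) _).trans ?_
  gcongr
  exact le_iSup₂ (f := fun x (_ : x ∈ (F n).source) ↦ edist ((G n).symm (F n x)) (H x))
    (a n) (ha n)

lemma IsUniformLimitAlong.isometry (hF : IsApproxIsometry F) (hG : IsApproxIsometry G)
    {H : M → N} (hH : IsUniformLimitAlong F G id H) : Isometry H := by
  obtain ⟨a, ha, ha'⟩ := hF.exists_approx
  intro x y
  have tx := IsApproxIsometry.tendsto_approx ha' x
  have ty := IsApproxIsometry.tendsto_approx ha' y
  have t1 := (tendsto_transition_approx hH (fun n ↦ ha n x) tx).edist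
    (tendsto_transition_approx hH (fun n ↦ ha n y) ty)
  have t2 := tx.edist ty
  have t3 := tendsto_distortion_add hF hG
  refine le_antisymm ?_ ?_
  · have := t2.add t3
    rw [add_zero] at this
    exact le_of_tendsto_of_tendsto' t1 this fun n ↦ edist_transition_le hG n (ha n x) (ha n y)
  · have := t1.add t3
    rw [add_zero] at this
    exact le_of_tendsto_of_tendsto' t2 this fun n ↦ edist_le_transition hG n (ha n x) (ha n y)

/-- Near `y` there are points of `(G n).source`, which are values of the transition maps and so
close to values of `H`. The range of `H` is compact, hence closed. -/
lemma IsUniformLimitAlong.surjective [CompactSpace M] (hF : IsApproxIsometry F)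
    (hG : IsApproxIsometry G) {H : M → N} (hH : IsUniformLimitAlong F G id H) :
    Function.Surjective H := by
  obtain ⟨b, hb, hb'⟩ := hG.exists_approx
  intro y
  have hcl : IsClosed (range H) := (isCompact_range hH.1).isClosed
  let x : ℕ → M := fun n ↦ (F n).symm (G n (b n y))
  have hx : ∀ n, x n ∈ (F n).source := fun n ↦ hF.symm_mem n _
  have hHx : ∀ n, (G n).symm (F n (x n)) = b n y := fun n ↦ by
    simp only [x, hF.apply_symm, (G n).left_inv (hb n y)]
  have ht : Tendsto (fun n ↦ H (x n)) atTop (𝓝 y) := by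
    rw [tendsto_iff_edist_tendsto_0]
    have h1 := hH.2.add (tendsto_iff_edist_tendsto_0.1 (IsApproxIsometry.tendsto_approx hb' y))
    rw [add_zero] at h1
    refine tendsto_of_tendsto_of_tendsto_of_le_of_le tendsto_const_nhds h1 (fun _ ↦ zero_le)
      fun n ↦ (edist_triangle _ (b n y) _).trans ?_
    gcongr
    rw [← hHx n, edist_comm]
    exact le_iSup₂ (f := fun x (_ : x ∈ (F n).source) ↦ edist ((G n).symm (F n x)) (H x))
      (x n) (hx n)
  exact hcl.mem_of_tendsto ht (Eventually.of_forall fun n ↦ mem_range_self _)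

/-- The inverse of the limit is the limit of the inverses. -/
lemma IsUniformLimitAlong.symm (hF : IsApproxIsometry F) (hG : IsApproxIsometry G)
    {H : M → N} (hH : IsUniformLimitAlong F G id H) {K : N → M}
    (hHK : ∀ y, H (K y) = y) : IsUniformLimitAlong G F id K := by
  have hiso := hH.isometry hF hG
  have hKiso : Isometry K := fun x y ↦ by rw [← hiso (K x) (K y), hHK, hHK]
  refine ⟨hKiso.continuous, ?_⟩
  refine tendsto_of_tendsto_of_tendsto_of_le_of_le tendsto_const_nhds hH.2 (fun _ ↦ zero_le)
    fun n ↦ iSup₂_le fun y hy ↦ ?_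
  have hx : (F n).symm (G n y) ∈ (F n).source := hF.symm_mem n _
  -- With `x = (F n).symm (G n y)`, the distance from `x` to `K y` equals that from `H x` to `y`
  -- because `H` is an isometry, and `y` is the image of `x` under the transition map.
  refine le_trans (le_of_eq ?_)
    (le_iSup₂ (f := fun x (_ : x ∈ (F n).source) ↦ edist ((G n).symm (F n x)) (H x)) _ hx)
  rw [← hiso, hHK, hF.apply_symm, (G n).left_inv hy, edist_comm]
  rfl

end MetricLimit

/-- Turns bounds by the lengths `b` of almost shortest paths into bounds by the distance `a`. The
threshold `t` allows only short paths to be considered, so that they stay in a chart. -/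
lemma le_mul_of_forall_lt_le {a t c C : ℝ≥0∞} (hC : C ≠ ⊤) (hat : a < t)
    (h : ∀ b, a < b → b ≤ t → c ≤ C * b) : c ≤ C * a := by
  have : (𝓝[>] a).NeBot := nhdsGT_neBot_of_exists_gt ⟨t, hat⟩
  refine ge_of_tendsto ((ENNReal.continuous_const_mul hC).continuousAt.tendsto.mono_left
    (nhdsWithin_le_nhds (s := Ioi a))) ?_
  filter_upwards [Ioc_mem_nhdsGT hat] with b hb using h b hb.1 hb.2

/-! ### Lipschitz estimates through lengths of paths -/

section ChartLipschitz

variable {d : ℕ} {X : Type*} [EMetricSpace X] [ChartedSpace (EuclideanQuadrant d) X]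
  [IsManifold (cornerModel d) ∞ X]
  [RiemannianBundle (fun x : X ↦ TangentSpace (cornerModel d) x)]
  [IsContMDiffRiemannianBundle (cornerModel d) ∞ (EuclideanSpace ℝ (Fin d))
      (fun x : X ↦ TangentSpace (cornerModel d) x)]
  [IsRiemannianManifold (cornerModel d) X]

lemma eventually_norm_dChartSymm_lt (x₀ : X) :
    ∃ C > 0, ∀ᶠ z in 𝓝[range (cornerModel d)] (extChartAt (cornerModel d) x₀ x₀),
      ‖dChartSymm (d := d) x₀ z‖ < C := by
  obtain ⟨C, hC, h⟩ := eventually_norm_dChartSymm_comp_lt (d := d) x₀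
  refine ⟨C, hC, ?_⟩
  have hn : 𝓝 x₀ = 𝓝 ((extChartAt (cornerModel d) x₀).symm (extChartAt (cornerModel d) x₀ x₀)) := by
    rw [extChartAt_to_inv]
  rw [hn] at h
  have hc : ContinuousAt (extChartAt (cornerModel d) x₀).symm (extChartAt (cornerModel d) x₀ x₀) :=
    continuousAt_extChartAt_symm _
  filter_upwards [nhdsWithin_le_nhds (hc.preimage_mem_nhds h),
    extChartAt_target_mem_nhdsWithin x₀] with z hz h'z
  have hz' : extChartAt (cornerModel d) x₀ ((extChartAt (cornerModel d) x₀).symm z) = z :=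
    (extChartAt (cornerModel d) x₀).right_inv h'z
  have h2 : ‖dChartSymm (d := d) x₀ (extChartAt (cornerModel d) x₀
    ((extChartAt (cornerModel d) x₀).symm z))‖ < C := hz
  rwa [hz'] at h2

/-- Near the centre of a chart, the inverse of the chart is Lipschitz. -/
lemma exists_ball_edist_symm_le (x₀ : X) : ∃ C : ℝ≥0, ∃ r > 0,
    Metric.ball (extChartAt (cornerModel d) x₀ x₀) r ∩ range (cornerModel d) ⊆
      (extChartAt (cornerModel d) x₀).target ∧
    ∀ z ∈ Metric.ball (extChartAt (cornerModel d) x₀ x₀) r ∩ range (cornerModel d),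
    ∀ w ∈ Metric.ball (extChartAt (cornerModel d) x₀ x₀) r ∩ range (cornerModel d),
      edist ((extChartAt (cornerModel d) x₀).symm z) ((extChartAt (cornerModel d) x₀).symm w) ≤
        C * edist z w := by
  obtain ⟨C, hC0, hC⟩ := eventually_norm_dChartSymm_lt (d := d) x₀
  lift C to ℝ≥0 using hC0.le
  obtain ⟨r, r_pos, hr⟩ := Metric.mem_nhdsWithin_iff.1
    (inter_mem (extChartAt_target_mem_nhdsWithin (I := cornerModel d) x₀) hC)
  refine ⟨C, r, r_pos, hr.trans inter_subset_left, fun z hz w hw ↦ ?_⟩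
  rw [IsRiemannianManifold.out (I := cornerModel d)]
  -- The segment stays in the image of the chart because the quadrant and the ball are convex. Its
  -- image is a path in `X`.
  let η := ContinuousAffineMap.lineMap (R := ℝ) z w
  set γ := (extChartAt (cornerModel d) x₀).symm ∘ η with hγ
  have hη : Icc 0 1 ⊆ ⇑η ⁻¹' ((extChartAt (cornerModel d) x₀).target ∩
      {z | ‖dChartSymm (d := d) x₀ z‖ < C}) := by
    rw [← image_subset_iff]
    refine Subset.trans ?_ hr
    have := ((convex_ball (extChartAt (cornerModel d) x₀ x₀) r).inter
      (cornerModel d).convex_range).segment_subset hz hw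
    rw [segment_eq_image_lineMap] at this
    exact this
  have η_smooth : ContMDiffOn 𝓘(ℝ, ℝ) 𝓘(ℝ, EuclideanSpace ℝ (Fin d)) 1 η (Icc 0 1) :=
    (contMDiff_iff_contDiff.2 (ContinuousAffineMap.contDiff _)).contMDiffOn
  have hle : riemannianEDist (cornerModel d) ((extChartAt (cornerModel d) x₀).symm z)
      ((extChartAt (cornerModel d) x₀).symm w) ≤ pathELength (cornerModel d) γ 0 1 := by
    refine riemannianEDist_le_pathELength ?_ ?_ ?_ zero_le_one
    · exact (contMDiffOn_extChartAt_symm x₀).comp η_smooth fun t ht ↦ (hη ht).1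
    · simp [γ, η, ContinuousAffineMap.coe_lineMap_eq, -extChartAt]
    · simp [γ, η, ContinuousAffineMap.coe_lineMap_eq, -extChartAt]
  refine hle.trans ?_
  rw [← lintegral_fderiv_lineMap_eq_edist, pathELength_eq_lintegral_mfderivWithin_Icc,
    ← lintegral_const_mul' _ _ ENNReal.coe_ne_top]
  refine setLIntegral_mono' measurableSet_Icc fun t ht ↦ ?_
  have h1 : HasFDerivWithinAt η (fderivWithin ℝ η (Icc (0 : ℝ) 1) t) (Icc (0 : ℝ) 1) t :=
    η.differentiable.differentiableAt.differentiableWithinAt.hasFDerivWithinAt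
  have h2 := HasMFDerivWithinAt.comp t
    ((hasMFDerivWithinAt_extChartAt_symm (hη ht).1).mono (extChartAt_target_subset_range x₀))
    h1.hasMFDerivWithinAt
    (fun t ht ↦ (hη ht).1)
  have huniq : UniqueMDiffWithinAt 𝓘(ℝ, ℝ) (Icc (0 : ℝ) 1) t :=
    uniqueMDiffWithinAt_iff_uniqueDiffWithinAt.2
      (uniqueDiffOn_Icc (zero_lt_one (α := ℝ)) t ht)
  have h3 := h2.mfderivWithin huniq
  have h4 : mfderivWithin 𝓘(ℝ, ℝ) (cornerModel d) γ (Icc 0 1) t 1 =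
      dChartSymm x₀ (η t) (fderivWithin ℝ η (Icc (0 : ℝ) 1) t (1 : ℝ)) := congrArg (fun L ↦ L 1) h3
  rw [h4]
  refine (ContinuousLinearMap.le_opENorm (dChartSymm x₀ (η t)) _).trans ?_
  gcongr
  rw [← ofReal_norm, ← ENNReal.ofReal_coe_nnreal]
  exact ENNReal.ofReal_le_ofReal (hη ht).2.le

/-- Near its centre, a chart is Lipschitz. -/
lemma exists_nhds_edist_chart_le (x₀ : X) : ∃ C : ℝ≥0, ∃ V ∈ 𝓝 x₀,
    V ⊆ (extChartAt (cornerModel d) x₀).source ∧ ∀ x ∈ V, ∀ y ∈ V,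
      edist (extChartAt (cornerModel d) x₀ x) (extChartAt (cornerModel d) x₀ y) ≤
        C * edist x y := by
  obtain ⟨C, hC0, hC⟩ := eventually_norm_dChart_lt (d := d) x₀
  lift C to ℝ≥0 using hC0.le
  obtain ⟨ε, hε, hball⟩ := Metric.nhds_basis_eball.mem_iff.1
    (inter_mem (extChartAt_source_mem_nhds (I := cornerModel d) x₀) hC)
  refine ⟨C, Metric.eball x₀ (ε / 3), Metric.eball_mem_nhds _ (by simpa using hε.ne'),
    (Metric.eball_subset_eball (ENNReal.div_le_of_le_mul (by
      calc ε = ε * 1 := (mul_one ε).symm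
        _ ≤ ε * 3 := by gcongr; norm_num))).trans (hball.trans inter_subset_left),
    fun x hx y hy ↦ ?_⟩
  have hxy : edist x y < ε / 3 + ε / 3 :=
    (edist_triangle_right x y x₀).trans_lt (ENNReal.add_lt_add hx hy)
  -- A path of length below `2ε/3` that starts within `ε/3` of `x₀` stays in the `ε`-ball, where the
  -- differential of the chart is bounded.
  have key : ∀ b, edist x y < b → b ≤ ε / 3 + ε / 3 →
      edist (extChartAt (cornerModel d) x₀ x) (extChartAt (cornerModel d) x₀ y) ≤ C * b := by
    intro b hb hbε
    rw [IsRiemannianManifold.out (I := cornerModel d)] at hb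
    obtain ⟨γ, h0, h1, hγ, hlen⟩ := exists_lt_of_riemannianEDist_lt hb
    have hmem : ∀ t ∈ Icc (0 : ℝ) 1, γ t ∈ Metric.eball x₀ ε := by
      intro t ht
      have hxt : edist x (γ t) < ε / 3 + ε / 3 := by
        rw [IsRiemannianManifold.out (I := cornerModel d)]
        refine (riemannianEDist_le_pathELength (hγ.mono (Icc_subset_Icc le_rfl ht.2)) h0 rfl
          ht.1).trans_lt ?_
        exact ((pathELength_mono le_rfl ht.2).trans_lt hlen).trans_le hbε
      calc edist (γ t) x₀ ≤ edist x (γ t) + edist x x₀ := edist_triangle_left _ _ _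
        _ < (ε / 3 + ε / 3) + ε / 3 := ENNReal.add_lt_add hxt hx
        _ = ε := ENNReal.add_thirds ε
    have hC' : ∀ t ∈ Icc (0 : ℝ) 1, ‖dChart (d := d) x₀ (γ t)‖ < C :=
      fun t ht ↦ (hball (hmem t ht)).2
    have hsrc : ∀ t ∈ Icc (0 : ℝ) 1, γ t ∈ (extChartAt (cornerModel d) x₀).source :=
      fun t ht ↦ (hball (hmem t ht)).1
    have hsm : ContMDiffOn 𝓘(ℝ, ℝ) 𝓘(ℝ, EuclideanSpace ℝ (Fin d)) 1
        (extChartAt (cornerModel d) x₀ ∘ γ) (Icc 0 1) :=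
      (contMDiffOn_extChartAt (n := 1)).comp hγ fun t ht ↦ by simpa using hsrc t ht
    have hle := enorm_sub_le_lintegral_derivWithin_Icc_of_contDiffOn_Icc
      (contMDiffOn_iff_contDiffOn.1 hsm) zero_le_one
    simp only [Function.comp_apply, h0, h1] at hle
    rw [edist_comm, edist_eq_enorm_sub]
    refine hle.trans (le_trans ?_ (mul_le_mul_right hlen.le _))
    rw [pathELength_eq_lintegral_mfderivWithin_Icc, ← lintegral_const_mul' _ _ ENNReal.coe_ne_top]
    refine setLIntegral_mono' measurableSet_Icc fun t ht ↦ ?_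
    have hd1 : MDifferentiableWithinAt 𝓘(ℝ, ℝ) (cornerModel d) γ (Icc 0 1) t :=
      (hγ t ht).mdifferentiableWithinAt (by simp)
    have hd2 := (hasMFDerivAt_extChartAt' (hsrc t ht)).comp_hasMFDerivWithinAt t
      hd1.hasMFDerivWithinAt
    have hd3 : HasFDerivWithinAt (extChartAt (cornerModel d) x₀ ∘ γ)
      ((dChart x₀ (γ t)).comp (mfderivWithin 𝓘(ℝ, ℝ) (cornerModel d) γ (Icc 0 1) t))
      (Icc 0 1) t := hd2.hasFDerivWithinAt
    have hd4 : derivWithin (extChartAt (cornerModel d) x₀ ∘ γ) (Icc 0 1) t =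
        dChart x₀ (γ t) (mfderivWithin 𝓘(ℝ, ℝ) (cornerModel d) γ (Icc 0 1) t 1) :=
      hd3.hasDerivWithinAt.derivWithin (uniqueDiffOn_Icc zero_lt_one t ht)
    rw [hd4]
    refine (ContinuousLinearMap.le_opENorm (dChart (d := d) x₀ (γ t)) _).trans ?_
    gcongr
    rw [← ofReal_norm, ← ENNReal.ofReal_coe_nnreal]
    exact ENNReal.ofReal_le_ofReal (hC' t ht).le
  exact le_mul_of_forall_lt_le ENNReal.coe_ne_top hxy key

/-- A `C¹` map with differential bounded by `C` is `C`-Lipschitz. -/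
lemma edist_map_le_of_enorm_mfderiv_le {Y : Type*} [EMetricSpace Y]
    [ChartedSpace (EuclideanQuadrant d) Y] [IsManifold (cornerModel d) ∞ Y]
    [RiemannianBundle (fun y : Y ↦ TangentSpace (cornerModel d) y)]
    [IsContMDiffRiemannianBundle (cornerModel d) ∞ (EuclideanSpace ℝ (Fin d))
      (fun y : Y ↦ TangentSpace (cornerModel d) y)]
    [IsRiemannianManifold (cornerModel d) Y] {Φ : X → Y} {C : ℝ≥0}
    (hΦ : ContMDiff (cornerModel d) (cornerModel d) 1 Φ) (hC0 : C ≠ 0)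
    (hC : ∀ x, ‖mfderiv (cornerModel d) (cornerModel d) Φ x‖ₑ ≤ C) (x y : X) :
    edist (Φ x) (Φ y) ≤ C * edist x y := by
  rcases eq_or_ne (edist x y) ⊤ with h | h
  · rw [h, ENNReal.mul_top (by simpa using hC0)]
    exact le_top
  refine le_mul_of_forall_lt_le ENNReal.coe_ne_top (lt_top_iff_ne_top.2 h) fun b hb _ ↦ ?_
  rw [IsRiemannianManifold.out (I := cornerModel d)] at hb
  obtain ⟨γ, h0, h1, hγ, hlen⟩ := exists_lt_of_riemannianEDist_lt hb
  have hle : riemannianEDist (cornerModel d) (Φ x) (Φ y) ≤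
      pathELength (cornerModel d) (Φ ∘ γ) 0 1 :=
    riemannianEDist_le_pathELength (hΦ.comp_contMDiffOn hγ) (by simp [h0]) (by simp [h1])
      zero_le_one
  rw [IsRiemannianManifold.out (I := cornerModel d)]
  refine hle.trans (le_trans ?_ (mul_le_mul_right hlen.le _))
  rw [pathELength_eq_lintegral_mfderivWithin_Icc, pathELength_eq_lintegral_mfderivWithin_Icc,
    ← lintegral_const_mul' _ _ ENNReal.coe_ne_top]
  refine setLIntegral_mono' measurableSet_Icc fun t ht ↦ ?_
  have huniq : UniqueMDiffWithinAt 𝓘(ℝ, ℝ) (Icc (0 : ℝ) 1) t :=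
    uniqueMDiffWithinAt_iff_uniqueDiffWithinAt.2
      (uniqueDiffOn_Icc (zero_lt_one (α := ℝ)) t ht)
  have hd1 : MDifferentiableWithinAt 𝓘(ℝ, ℝ) (cornerModel d) γ (Icc 0 1) t :=
    (hγ t ht).mdifferentiableWithinAt (by simp)
  have hd2 := ((hΦ (γ t)).mdifferentiableAt (by simp)).hasMFDerivAt.comp_hasMFDerivWithinAt t
    hd1.hasMFDerivWithinAt
  have hd4 : mfderivWithin 𝓘(ℝ, ℝ) (cornerModel d) (Φ ∘ γ) (Icc 0 1) t 1 =
      mfderiv (cornerModel d) (cornerModel d) Φ (γ t)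
        (mfderivWithin 𝓘(ℝ, ℝ) (cornerModel d) γ (Icc 0 1) t 1) :=
    congrArg (fun L ↦ L 1) (hd2.mfderivWithin huniq)
  rw [hd4]
  refine (ContinuousLinearMap.le_opENorm
    (mfderiv (cornerModel d) (cornerModel d) Φ (γ t)) _).trans ?_
  gcongr
  exact hC _

end ChartLipschitz

/-! ### Diffeomorphisms from a subset onto a manifold -/

section SingleMap

variable {d : ℕ}
  {X : Type*} [EMetricSpace X] [ChartedSpace (EuclideanQuadrant d) X]
  [IsManifold (cornerModel d) ∞ X]
  {Y : Type*} [EMetricSpace Y] [ChartedSpace (EuclideanQuadrant d) Y]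
  [IsManifold (cornerModel d) ∞ Y]

/-- A diffeomorphism from a subset of `X` onto `Y`. -/
structure IsDiffeoOnto (F : PartialEquiv X Y) : Prop where
  target_eq : F.target = univ
  smooth : ContMDiffOn (cornerModel d) (cornerModel d) ∞ F F.source
  smooth_symm : ContMDiff (cornerModel d) (cornerModel d) ∞ F.symm

namespace IsDiffeoOnto

variable {F : PartialEquiv X Y}

lemma symm_mem (h : IsDiffeoOnto (d := d) F) (y : Y) : F.symm y ∈ F.source := F.map_target (h.target_eq ▸ mem_univ y)

lemma apply_symm (h : IsDiffeoOnto (d := d) F) (y : Y) : F (F.symm y) = y := F.right_inv (h.target_eq ▸ mem_univ y)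

lemma range_symm (h : IsDiffeoOnto (d := d) F) : range F.symm = F.source := by
  refine Subset.antisymm (range_subset_iff.2 h.symm_mem) fun x hx ↦ ⟨F x, F.left_inv hx⟩

lemma injective_symm (h : IsDiffeoOnto (d := d) F) : Function.Injective F.symm :=
  fun y y' hy ↦ by rw [← h.apply_symm y, hy, h.apply_symm]

lemma image_symm_preimage (h : IsDiffeoOnto (d := d) F) {T : Set X} (hT : T ⊆ F.source) : F.symm '' (F.symm ⁻¹' T) = T := by
  rw [image_preimage_eq_inter_range, h.range_symm, inter_eq_left.2 hT]

lemma isCompact_source (h : IsDiffeoOnto (d := d) F) [CompactSpace Y] : IsCompact F.source :=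
  h.range_symm ▸ isCompact_range h.smooth_symm.continuous

lemma measurableEmbedding_symm (h : IsDiffeoOnto (d := d) F) [CompactSpace Y] [MeasurableSpace X] [BorelSpace X]
    [MeasurableSpace Y] [BorelSpace Y] : MeasurableEmbedding F.symm :=
  (h.smooth_symm.continuous.isClosedEmbedding h.injective_symm).measurableEmbedding

lemma hasMFDerivAt_symm (h : IsDiffeoOnto (d := d) F) (y : Y) : HasMFDerivAt (cornerModel d) (cornerModel d) F.symm y
    (mfderiv (cornerModel d) (cornerModel d) F.symm y) :=
  ((h.smooth_symm y).mdifferentiableAt (by simp)).hasMFDerivAt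

lemma hasMFDerivWithinAt (h : IsDiffeoOnto (d := d) F) {x : X} (hx : x ∈ F.source) :
    HasMFDerivWithinAt (cornerModel d) (cornerModel d) F F.source x
      (mfderivWithin (cornerModel d) (cornerModel d) F F.source x) :=
  ((h.smooth x hx).mdifferentiableWithinAt (by simp)).hasMFDerivWithinAt

lemma mfderivWithin_mfderiv_symm (h : IsDiffeoOnto (d := d) F) (y : Y) (w : EuclideanSpace ℝ (Fin d)) :
    (mfderivWithin (cornerModel d) (cornerModel d) F F.source (F.symm y)
      (mfderiv (cornerModel d) (cornerModel d) F.symm y w) : EuclideanSpace ℝ (Fin d)) = w := by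
  have h1 := (h.hasMFDerivWithinAt (h.symm_mem y)).comp y
    (h.hasMFDerivAt_symm y).hasMFDerivWithinAt (s := univ) (fun y _ ↦ h.symm_mem y)
  have h2 : (F ∘ F.symm : Y → Y) = id := funext h.apply_symm
  have h3 : HasMFDerivAt (cornerModel d) (cornerModel d) (F ∘ F.symm) y
      ((mfderivWithin (cornerModel d) (cornerModel d) F F.source (F.symm y)).comp
        (mfderiv (cornerModel d) (cornerModel d) F.symm y)) :=
    hasMFDerivWithinAt_univ.1 h1
  have h4 : mfderiv (cornerModel d) (cornerModel d) (F ∘ F.symm) y w = w := by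
    rw [h2, mfderiv_id]; rfl
  rw [h3.mfderiv] at h4
  exact h4

/-- A one-sided inverse between spaces of the same finite dimension is two-sided. Differentiating
`F.symm ∘ F` instead would need unique derivatives within the source, which are themselves deduced
from this. -/
lemma mfderiv_symm_mfderivWithin (h : IsDiffeoOnto (d := d) F) (y : Y) (v : EuclideanSpace ℝ (Fin d)) :
    (mfderiv (cornerModel d) (cornerModel d) F.symm y
      (mfderivWithin (cornerModel d) (cornerModel d) F F.source (F.symm y) v) :
        EuclideanSpace ℝ (Fin d)) = v := by
  let A : EuclideanSpace ℝ (Fin d) →ₗ[ℝ] EuclideanSpace ℝ (Fin d) :=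
    (mfderiv (cornerModel d) (cornerModel d) F.symm y).toLinearMap
  let B : EuclideanSpace ℝ (Fin d) →ₗ[ℝ] EuclideanSpace ℝ (Fin d) :=
    (mfderivWithin (cornerModel d) (cornerModel d) F F.source (F.symm y)).toLinearMap
  have hBA : B ∘ₗ A = LinearMap.id := LinearMap.ext fun w ↦ h.mfderivWithin_mfderiv_symm y w
  exact LinearMap.congr_fun ((LinearMap.comp_eq_id_comm _ _).1 hBA) v

/-- The source is the image of all of `Y` under a map with surjective differentials, and unique
differentiability passes to such images. -/
lemma uniqueMDiffOn_source (h : IsDiffeoOnto (d := d) F) : UniqueMDiffOn (cornerModel d) F.source := by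
  intro x hx
  have h1 := ((uniqueMDiffOn_univ (I := cornerModel d) (M := Y)) (F x) (mem_univ _)).image_denseRange
    (h.hasMFDerivAt_symm (F x)).hasMFDerivWithinAt ?_
  · rwa [image_univ, h.range_symm, F.left_inv hx] at h1
  · refine Function.Surjective.denseRange fun v ↦ ⟨_, h.mfderiv_symm_mfderivWithin (F x) v⟩

lemma isInvertible_mfderivWithin (h : IsDiffeoOnto (d := d) F) (y : Y) :
    (mfderivWithin (cornerModel d) (cornerModel d) F F.source (F.symm y)).IsInvertible := by
  refine ContinuousLinearMap.IsInvertible.of_inverse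
    (g := mfderiv (cornerModel d) (cornerModel d) F.symm y) ?_ ?_
  · ext1 w; exact h.mfderivWithin_mfderiv_symm y w
  · ext1 w; exact h.mfderiv_symm_mfderivWithin y w

lemma mpullbackWithin_symm_apply (h : IsDiffeoOnto (d := d) F) (E' : FrameField d Y) (i : Fin d) (y : Y) :
    VectorField.mpullbackWithin (cornerModel d) (cornerModel d) F
      (fun y ↦ E'.frame y i) F.source (F.symm y) =
        mfderiv (cornerModel d) (cornerModel d) F.symm y (E'.frame y i) := by
  have hb : ∀ y', y' = y → (E'.frame y' i : EuclideanSpace ℝ (Fin d)) = E'.frame y i := by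
    rintro y' rfl; rfl
  rw [VectorField.mpullbackWithin_apply]
  have h1 : (mfderivWithin (cornerModel d) (cornerModel d) F F.source (F.symm y)).inverse
      (mfderivWithin (cornerModel d) (cornerModel d) F F.source (F.symm y)
      (mfderiv (cornerModel d) (cornerModel d) F.symm y (E'.frame y i))) =
      mfderiv (cornerModel d) (cornerModel d) F.symm y (E'.frame y i) :=
    (h.isInvertible_mfderivWithin y).inverse_apply_eq.2 rfl
  rw [← h1]
  congr 1
  exact (hb _ (h.apply_symm y)).trans (h.mfderivWithin_mfderiv_symm y _).symm

lemma mfderivWithin_mpullbackWithin (h : IsDiffeoOnto (d := d) F) (E' : FrameField d Y) (i : Fin d) {x : X}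
    (hx : x ∈ F.source) :
    mfderivWithin (cornerModel d) (cornerModel d) F F.source x
      (VectorField.mpullbackWithin (cornerModel d) (cornerModel d) F
      (fun y ↦ E'.frame y i) F.source x) = E'.frame (F x) i := by
  have h1 := h.isInvertible_mfderivWithin (F x)
  rw [F.left_inv hx] at h1
  rw [VectorField.mpullbackWithin_apply]
  exact (h1.inverse_apply_eq.1 rfl).symm

end IsDiffeoOnto

end SingleMap

/-! ### Measurability and bounds for norms of differentials -/

section Measurability

variable {d : ℕ}
  {X : Type*} [EMetricSpace X] [ChartedSpace (EuclideanQuadrant d) X]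
  [IsManifold (cornerModel d) ∞ X]
  [RiemannianBundle (fun x : X ↦ TangentSpace (cornerModel d) x)]
  [IsContMDiffRiemannianBundle (cornerModel d) ∞ (EuclideanSpace ℝ (Fin d))
      (fun x : X ↦ TangentSpace (cornerModel d) x)]

/-- The norm varies with the base point. Its square expands into inner products of continuous
sections, which the bundle metric makes continuous. -/
lemma continuousOn_norm_sum_smul {B ι : Type*} [TopologicalSpace B] [Fintype ι] {b : B → X}
    {s : Set B} {v : ι → ∀ y, TangentSpace (cornerModel d) (b y)} {t : B → ι → ℝ}
    (ht : ContinuousOn t s)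
    (hv : ∀ i, ContinuousOn (fun y ↦ (⟨b y, v i y⟩ : TangentBundle (cornerModel d) X)) s) :
    ContinuousOn (fun y ↦ ‖∑ i, t y i • v i y‖) s := by
  have e : ∀ y, ‖∑ i, t y i • v i y‖ =
      √(∑ i, ∑ j, t y i * (t y j * inner ℝ (v i y) (v j y))) := by
    intro y
    rw [norm_eq_sqrt_real_inner (F := TangentSpace (cornerModel d) (b y)), sum_inner]
    simp only [inner_sum, real_inner_smul_left, real_inner_smul_right]
    refine congrArg _ (Finset.sum_congr rfl fun i _ ↦ Finset.sum_congr rfl fun j _ ↦ ?_)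
    ring
  simp only [e]
  refine Real.continuous_sqrt.comp_continuousOn ?_
  refine continuousOn_finsetSum _ fun i _ ↦ continuousOn_finsetSum _ fun j _ ↦ ?_
  refine ((continuous_apply i).comp_continuousOn ht).mul
    (((continuous_apply j).comp_continuousOn ht).mul ?_)
  exact ContinuousOn.inner_bundle (F := EuclideanSpace ℝ (Fin d)) (hv i) (hv j)

lemma continuous_norm_sum_smul {B ι : Type*} [TopologicalSpace B] [Fintype ι] {b : B → X}
    {v : ι → ∀ y, TangentSpace (cornerModel d) (b y)} (t : ι → ℝ)
    (hv : ∀ i, Continuous (fun y ↦ (⟨b y, v i y⟩ : TangentBundle (cornerModel d) X))) :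
    Continuous (fun y ↦ ‖∑ i, t i • v i y‖) := by
  rw [← continuousOn_univ]
  exact continuousOn_norm_sum_smul continuousOn_const fun i ↦ (hv i).continuousOn

lemma sum_repr_smul_apply {V W ι : Type*} [AddCommGroup V] [Module ℝ V] [AddCommGroup W]
    [Module ℝ W] [TopologicalSpace V] [TopologicalSpace W] [Fintype ι] (b : Module.Basis ι ℝ V)
    (L : V →L[ℝ] W) (v : V) : ∑ i, b.repr v i • L (b i) = L v := by
  conv_rhs => rw [← b.sum_repr v]
  simp only [map_sum, map_smul]

lemma exists_lt_enorm_of_lt_opENorm {V W : Type*} [SeminormedAddCommGroup V] [NormedSpace ℝ V]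
    [SeminormedAddCommGroup W] [NormedSpace ℝ W] {L : V →L[ℝ] W} {c : ℝ≥0} (hc : (c : ℝ≥0∞) < ‖L‖ₑ) :
    ∃ v, c * ‖v‖ < ‖L v‖ := by
  by_contra! H
  have h1 : ‖L‖ ≤ c := L.opNorm_le_bound c.2 H
  refine hc.not_ge ?_
  rw [← ofReal_norm, ← ENNReal.ofReal_coe_nnreal]
  exact ENNReal.ofReal_le_ofReal h1

lemma lt_opENorm_of_lt_norm {V W : Type*} [SeminormedAddCommGroup V] [NormedSpace ℝ V]
    [SeminormedAddCommGroup W] [NormedSpace ℝ W] {L : V →L[ℝ] W} {c : ℝ≥0} {v : V}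
    (hv : c * ‖v‖ < ‖L v‖) : (c : ℝ≥0∞) < ‖L‖ₑ := by
  by_contra! H
  refine hv.not_ge ((L.le_opNorm v).trans ?_)
  gcongr
  rw [← ofReal_norm, ← ENNReal.ofReal_coe_nnreal] at H
  exact (ENNReal.ofReal_le_ofReal_iff c.2).1 H

variable {Y : Type*} [EMetricSpace Y] [ChartedSpace (EuclideanQuadrant d) Y]
  [IsManifold (cornerModel d) ∞ Y]
  [RiemannianBundle (fun x : Y ↦ TangentSpace (cornerModel d) x)]
  [IsContMDiffRiemannianBundle (cornerModel d) ∞ (EuclideanSpace ℝ (Fin d))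
      (fun x : Y ↦ TangentSpace (cornerModel d) x)]

lemma FrameField.continuous_section (E : FrameField d X) (i : Fin d) :
    Continuous (fun x : X ↦ (⟨x, E.frame x i⟩ : TangentBundle (cornerModel d) X)) :=
  (E.smooth i).continuous

lemma FrameField.continuous_mfderiv (E : FrameField d Y) {f : Y → X}
    (hf : ContMDiff (cornerModel d) (cornerModel d) ∞ f) (i : Fin d) :
    Continuous (fun y : Y ↦ (⟨f y, mfderiv (cornerModel d) (cornerModel d) f y (E.frame y i)⟩ :
      TangentBundle (cornerModel d) X)) :=
  (hf.continuous_tangentMap (by simp)).comp (E.continuous_section i)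

/-- The superlevel sets of `‖df‖` are open. -/
lemma isOpen_lt_enorm_mfderiv (E : FrameField d Y) {f : Y → X}
    (hf : ContMDiff (cornerModel d) (cornerModel d) ∞ f) (c : ℝ≥0) :
    IsOpen {y | (c : ℝ≥0∞) < ‖mfderiv (cornerModel d) (cornerModel d) f y‖ₑ} := by
  -- An operator norm exceeds `c` exactly when one vector witnesses it. For a vector with fixed
  -- coefficients in the frame this is an open condition on `y`.
  have e : {y | (c : ℝ≥0∞) < ‖mfderiv (cornerModel d) (cornerModel d) f y‖ₑ} =
      ⋃ t : Fin d → ℝ, {y | c * ‖∑ i, t i • E.frame y i‖ <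
        ‖∑ i, t i • mfderiv (cornerModel d) (cornerModel d) f y (E.frame y i)‖} := by
    ext y
    simp only [mem_ofPred_eq, mem_iUnion]
    constructor
    · intro hy
      obtain ⟨v, hv⟩ := exists_lt_enorm_of_lt_opENorm hy
      refine ⟨(E.frame y).repr v, ?_⟩
      rw [(E.frame y).sum_repr v, sum_repr_smul_apply]
      exact hv
    · rintro ⟨t, ht⟩
      refine lt_opENorm_of_lt_norm (v := ∑ i, t i • E.frame y i) ?_
      simpa using ht
  rw [e]
  refine isOpen_iUnion fun t ↦ isOpen_lt ?_ ?_
  · exact continuous_const.mul (continuous_norm_sum_smul t E.continuous_section)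
  · exact continuous_norm_sum_smul t (E.continuous_mfderiv hf)

/-- The superlevel sets of the norm of the inverse of `df` are open. -/
lemma IsDiffeoOnto.isOpen_lt_enorm_mfderivWithin (E : FrameField d Y) {F : PartialEquiv X Y}
    (h : IsDiffeoOnto (d := d) F) (c : ℝ≥0) :
    IsOpen {y | (c : ℝ≥0∞) <
      ‖mfderivWithin (cornerModel d) (cornerModel d) F F.source (F.symm y)‖ₑ} := by
  have hnorm : ∀ (y : Y) (v : TangentSpace (cornerModel d) y),
      ‖mfderivWithin (cornerModel d) (cornerModel d) F F.source (F.symm y)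
        (mfderiv (cornerModel d) (cornerModel d) F.symm y v)‖ =
      ‖v‖ := by
    intro y v
    have key : ∀ (y' : Y) (w : TangentSpace (cornerModel d) y')
        (w' : TangentSpace (cornerModel d) y), y' = y → (w : EuclideanSpace ℝ (Fin d)) = w' →
        ‖w‖ = ‖w'‖ := by
      rintro y' w w' rfl rfl
      rfl
    exact key _ _ _ (h.apply_symm y) (h.mfderivWithin_mfderiv_symm y v)
  -- Test vectors at `F.symm y` are written as images under the differential of `F.symm`. The
  -- differential of `F` returns the original vector, so both sides of the inequality are continuous
  -- in `y`.
  have e : {y | (c : ℝ≥0∞) <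
      ‖mfderivWithin (cornerModel d) (cornerModel d) F F.source (F.symm y)‖ₑ} =
      ⋃ t : Fin d → ℝ, {y |
        c * ‖∑ i, t i • mfderiv (cornerModel d) (cornerModel d) F.symm y (E.frame y i)‖ <
        ‖∑ i, t i • E.frame y i‖} := by
    ext y
    simp only [mem_ofPred_eq, mem_iUnion]
    constructor
    · intro hy
      obtain ⟨v, hv⟩ := exists_lt_enorm_of_lt_opENorm hy
      let w : TangentSpace (cornerModel d) y :=
        mfderivWithin (cornerModel d) (cornerModel d) F F.source (F.symm y) v
      have hw : mfderiv (cornerModel d) (cornerModel d) F.symm y w = v :=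
        h.mfderiv_symm_mfderivWithin y v
      refine ⟨(E.frame y).repr w, ?_⟩
      rw [(E.frame y).sum_repr w, sum_repr_smul_apply, ← hnorm y w, hw]
      exact hv
    · rintro ⟨t, ht⟩
      refine lt_opENorm_of_lt_norm
        (v := mfderiv (cornerModel d) (cornerModel d) F.symm y (∑ i, t i • E.frame y i)) ?_
      rw [hnorm y]
      simpa using ht
  rw [e]
  refine isOpen_iUnion fun t ↦ isOpen_lt ?_ ?_
  · exact continuous_const.mul (continuous_norm_sum_smul t (E.continuous_mfderiv h.smooth_symm))
  · exact continuous_norm_sum_smul t E.continuous_section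

lemma measurable_of_isOpen_lt [MeasurableSpace Y] [BorelSpace Y] {f : Y → ℝ≥0∞}
    (hf : ∀ c : ℝ≥0, IsOpen {y | (c : ℝ≥0∞) < f y}) : Measurable f := by
  refine measurable_of_Ioi fun c ↦ ?_
  induction c with
  | top => simp
  | coe c => exact (hf c).measurableSet

/-- On a compact manifold, the coefficients of a vector in a frame are bounded by its norm. -/
lemma FrameField.exists_abs_repr_le [CompactSpace Y] (E : FrameField d Y) :
    ∃ C > 0, ∀ (y : Y) (v : TangentSpace (cornerModel d) y), ‖⇑((E.frame y).repr v)‖ ≤ C * ‖v‖ := by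
  -- On this compact set of normalized coefficient vectors the norm of the combination is continuous
  -- and, by linear independence, non-zero, so its inverse is bounded. The general case follows by
  -- scaling.
  let K : Set (Y × (Fin d → ℝ)) := univ ×ˢ Metric.sphere 0 1
  have hK : IsCompact K := isCompact_univ.prod (isCompact_sphere _ _)
  have h2 : ContinuousOn (fun q : Y × (Fin d → ℝ) ↦ ‖∑ i, q.2 i • E.frame q.1 i‖) K :=
    continuousOn_norm_sum_smul (t := fun q : Y × (Fin d → ℝ) ↦ q.2) continuous_snd.continuousOn
      fun i ↦ ((E.continuous_section i).comp continuous_fst).continuousOn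
  have hpos : ∀ q ∈ K, ‖∑ i, q.2 i • E.frame q.1 i‖ ≠ 0 := by
    intro q hq h0
    have h3 := Fintype.linearIndependent_iff.1 (E.frame q.1).linearIndependent _
      (norm_eq_zero.1 h0)
    have h4 : q.2 = 0 := funext h3
    have h5 : ‖q.2‖ = 1 := mem_sphere_zero_iff_norm.1 hq.2
    rw [h4, norm_zero] at h5
    exact zero_ne_one h5
  obtain ⟨C, hC⟩ := hK.exists_bound_of_continuousOn (h2.inv₀ hpos)
  refine ⟨max C 1, by positivity, fun y v ↦ ?_⟩
  rcases eq_or_ne (⇑((E.frame y).repr v)) 0 with h0 | h0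
  · rw [h0, norm_zero]
    positivity
  have hn : 0 < ‖⇑((E.frame y).repr v)‖ := norm_pos_iff.2 h0
  have hmem : (y, ‖⇑((E.frame y).repr v)‖⁻¹ • ⇑((E.frame y).repr v)) ∈ K := by
    refine ⟨mem_univ _, mem_sphere_zero_iff_norm.2 ?_⟩
    simp only [norm_smul, norm_inv, norm_norm]
    exact inv_mul_cancel₀ hn.ne'
  have h6 := hC _ hmem
  have h7 := hpos _ hmem
  have e : ∑ i, (‖⇑((E.frame y).repr v)‖⁻¹ • ⇑((E.frame y).repr v)) i • E.frame y i =
      ‖⇑((E.frame y).repr v)‖⁻¹ • v := by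
    simp only [Pi.smul_apply, smul_eq_mul, mul_smul, ← Finset.smul_sum, (E.frame y).sum_repr]
  simp only [Pi.inv_apply, e, norm_smul, norm_inv, norm_norm, norm_mul] at h6 h7
  have hv : 0 < ‖v‖ := (norm_nonneg v).lt_of_ne fun h ↦ h7 (by rw [← h, mul_zero])
  rw [mul_inv, inv_inv, ← div_eq_mul_inv, div_le_iff₀ hv] at h6
  exact h6.trans (by gcongr; exact le_max_left _ _)

/-- A smooth map from a compact manifold has bounded differential. -/
lemma exists_enorm_mfderiv_le [CompactSpace Y] (E : FrameField d Y) {f : Y → X}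
    (hf : ContMDiff (cornerModel d) (cornerModel d) ∞ f) :
    ∃ C : ℝ≥0, C ≠ 0 ∧ ∀ y, ‖mfderiv (cornerModel d) (cornerModel d) f y‖ₑ ≤ C := by
  obtain ⟨C, hC0, hC⟩ := E.exists_abs_repr_le
  have hB : ∀ i, ∃ B, ∀ y, ‖mfderiv (cornerModel d) (cornerModel d) f y (E.frame y i)‖ ≤ B := by
    intro i
    have hc : Continuous fun y ↦ ‖mfderiv (cornerModel d) (cornerModel d) f y (E.frame y i)‖ := by
      simpa using continuous_norm_sum_smul (ι := Unit) (fun _ ↦ (1 : ℝ))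
        (fun _ ↦ E.continuous_mfderiv hf i)
    obtain ⟨B, hB⟩ := isCompact_univ.exists_bound_of_continuousOn hc.continuousOn
    exact ⟨B, fun y ↦ by simpa using hB y (mem_univ y)⟩
  choose B hB using hB
  have hB0 : 0 ≤ ∑ i, C * |B i| := by positivity
  refine ⟨(max (∑ i, C * |B i|) 1).toNNReal, by simp, fun y ↦ ?_⟩
  rw [← ofReal_norm]
  refine ENNReal.ofReal_le_ofReal (ContinuousLinearMap.opNorm_le_bound _ (by positivity) fun v ↦ ?_)
  rw [← sum_repr_smul_apply (E.frame y)]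
  calc ‖∑ i, (E.frame y).repr v i • mfderiv (cornerModel d) (cornerModel d) f y (E.frame y i)‖
      ≤ ∑ i, ‖(E.frame y).repr v i • mfderiv (cornerModel d) (cornerModel d) f y (E.frame y i)‖ :=
        norm_sum_le _ _
    _ ≤ ∑ i, (C * ‖v‖) * |B i| := by
        refine Finset.sum_le_sum fun i _ ↦ ?_
        rw [norm_smul]
        refine mul_le_mul ((norm_le_pi_norm (⇑((E.frame y).repr v)) i).trans (hC y v))
          ((hB i y).trans (le_abs_self _)) (norm_nonneg _) (by positivity)
    _ = (∑ i, C * |B i|) * ‖v‖ := by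
        rw [Finset.sum_mul]; exact Finset.sum_congr rfl fun i _ ↦ by ring
    _ ≤ _ := by gcongr; exact le_max_left _ _

end Measurability

/-! ### Integral estimates for differentials in terms of their rigidity defects -/

section IntegralEstimates

lemma setLIntegral_rpow_le_of_le_one_add {α : Type*} [MeasurableSpace α] (μ : Measure α)
    {S : Set α} (hS : MeasurableSet S) {a ρ : α → ℝ≥0∞} {p : ℝ} (hp : 1 ≤ p)
    (h : ∀ x ∈ S, a x ≤ 1 + ρ x) :
    ∫⁻ x in S, a x ^ p ∂μ ≤ 2 ^ (p - 1) * (μ S + ∫⁻ x in S, ρ x ^ p ∂μ) := by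
  have h2 : (2 : ℝ≥0∞) ^ (p - 1) ≠ ⊤ := ENNReal.rpow_ne_top_of_nonneg (by linarith) (by simp)
  calc ∫⁻ x in S, a x ^ p ∂μ ≤ ∫⁻ x in S, 2 ^ (p - 1) * (1 + ρ x ^ p) ∂μ := by
        refine setLIntegral_mono' hS fun x hx ↦ ?_
        refine (ENNReal.rpow_le_rpow (h x hx) (by linarith)).trans ?_
        simpa using ENNReal.rpow_add_le_mul_rpow_add_rpow 1 (ρ x) hp
    _ = _ := by
        rw [lintegral_const_mul' _ _ h2, lintegral_add_left measurable_const]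
        simp

lemma pow_le_max_one_rpow {x : ℝ≥0∞} {d : ℕ} {p : ℝ} (hp : d ≤ p) : x ^ d ≤ max 1 x ^ p := by
  calc x ^ d ≤ max 1 x ^ d := by gcongr; exact le_max_right _ _
    _ = max 1 x ^ (d : ℝ) := (ENNReal.rpow_natCast _ _).symm
    _ ≤ _ := ENNReal.rpow_le_rpow_of_exponent_le (le_max_left _ _) hp

/-- Young's inequality under `1/p + 1/q ≤ 1` instead of equality, which is why both factors must be
at least `1`. The larger of `a ^ p` and `b ^ q` already dominates the product. -/
lemma mul_le_rpow_add_rpow {a b : ℝ≥0∞} (ha : 1 ≤ a) (hb : 1 ≤ b) {p q : ℝ} (hp : 0 < p)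
    (hq : 0 < q) (hpq : p + q ≤ p * q) : a * b ≤ a ^ p + b ^ q := by
  have key : ∀ {a b : ℝ≥0∞} {p q : ℝ}, 1 ≤ a → 0 < p → 0 < q → p + q ≤ p * q → b ^ q ≤ a ^ p →
      a * b ≤ a ^ p := by
    intro a b p q ha hp hq hpq h
    have h1 : b ≤ a ^ (p / q) := by
      rw [div_eq_mul_inv, ENNReal.rpow_mul]
      calc b = (b ^ q) ^ q⁻¹ := by rw [← ENNReal.rpow_mul, mul_inv_cancel₀ hq.ne', ENNReal.rpow_one]
        _ ≤ _ := ENNReal.rpow_le_rpow h (by positivity)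
    calc a * b ≤ a ^ (1 : ℝ) * a ^ (p / q) := by rw [ENNReal.rpow_one]; gcongr
      _ = a ^ (1 + p / q) := (ENNReal.rpow_add_of_nonneg _ _ zero_le_one (by positivity)).symm
      _ ≤ a ^ p := by
        refine ENNReal.rpow_le_rpow_of_exponent_le ha ?_
        rw [← sub_nonneg]
        have : p - (1 + p / q) = (p * q - (p + q)) / q := by field_simp; ring
        rw [this]
        exact div_nonneg (by linarith) hq.le
  rcases le_total (b ^ q) (a ^ p) with h | h
  · exact (key ha hp hq hpq h).trans le_self_add
  · rw [mul_comm]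
    exact (key hb hq hp (by linarith) h).trans le_add_self

lemma rpow_mul_pow_le {a b : ℝ≥0∞} {q p : ℝ} {d : ℕ} (hq : 0 ≤ q) (hp : q + d = p) :
    a ^ q * b ^ d ≤ a ^ p + b ^ p := by
  have h1 : ∀ c : ℝ≥0∞, c ^ q * c ^ d = c ^ p := fun c ↦ by
    rw [← hp, ENNReal.rpow_add_of_nonneg _ _ hq (by positivity), ENNReal.rpow_natCast]
  rcases le_total a b with h | h
  · calc a ^ q * b ^ d ≤ b ^ q * b ^ d := by gcongr
      _ = b ^ p := h1 b
      _ ≤ _ := le_add_self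
  · calc a ^ q * b ^ d ≤ a ^ q * a ^ d := by gcongr
      _ = a ^ p := h1 a
      _ ≤ _ := le_self_add

variable {d : ℕ} {X : Type*} [EMetricSpace X] [ChartedSpace (EuclideanQuadrant d) X]
  [IsManifold (cornerModel d) ∞ X]
  [RiemannianBundle (fun x : X ↦ TangentSpace (cornerModel d) x)]
  [IsContMDiffRiemannianBundle (cornerModel d) ∞ (EuclideanSpace ℝ (Fin d))
      (fun x : X ↦ TangentSpace (cornerModel d) x)]
  [CompactSpace X] [MeasurableSpace X] [BorelSpace X]
  {Y : Type*} [EMetricSpace Y] [ChartedSpace (EuclideanQuadrant d) Y]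
  [IsManifold (cornerModel d) ∞ Y]
  [RiemannianBundle (fun x : Y ↦ TangentSpace (cornerModel d) x)]
  [IsContMDiffRiemannianBundle (cornerModel d) ∞ (EuclideanSpace ℝ (Fin d))
      (fun x : Y ↦ TangentSpace (cornerModel d) x)]
  [CompactSpace Y] [MeasurableSpace Y] [BorelSpace Y]
  {F : PartialEquiv X Y}

lemma IsDiffeoOnto.measurable_enorm_mfderiv_symm (h : IsDiffeoOnto (d := d) F)
    (E : FrameField d Y) :
    Measurable fun y ↦ ‖mfderiv (cornerModel d) (cornerModel d) F.symm y‖ₑ :=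
  measurable_of_isOpen_lt (isOpen_lt_enorm_mfderiv E h.smooth_symm)

lemma IsDiffeoOnto.measurable_enorm_mfderivWithin (h : IsDiffeoOnto (d := d) F)
    (E : FrameField d Y) :
    Measurable fun y ↦ ‖mfderivWithin (cornerModel d) (cornerModel d) F F.source (F.symm y)‖ₑ :=
  measurable_of_isOpen_lt (h.isOpen_lt_enorm_mfderivWithin E)

/-- Change of variables along `F.symm`. As `φ ∘ F` is meaningful only on the source, `φ` is carried
to a measurable function on `X` through the embedding `F.symm`. -/
lemma IsDiffeoOnto.setLIntegral_image_symm_le (h : IsDiffeoOnto (d := d) F) (E : FrameField d Y)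
    {S : Set Y} (hS : MeasurableSet S) {φ : Y → ℝ≥0∞} (hφ : Measurable φ) :
    ∫⁻ x in F.symm '' S, φ (F x) ∂(riemVolume d X) ≤
      ∫⁻ y in S, φ y * ‖mfderiv (cornerModel d) (cornerModel d) F.symm y‖ₑ ^ d
        ∂(riemVolume d Y) := by
  have hemb := h.measurableEmbedding_symm
  have : SecondCountableTopology Y := EMetric.secondCountable_of_sigmaCompact Y
  obtain ⟨f, hf, hfφ⟩ := hemb.exists_measurable_extend hφ fun _ ↦ ⟨0⟩
  have e : ∫⁻ x in F.symm '' S, φ (F x) ∂(riemVolume d X) =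
      ∫⁻ x in F.symm '' S, f x ∂(riemVolume d X) := by
    refine setLIntegral_congr_fun (hemb.measurableSet_image.2 hS) ?_
    rintro _ ⟨y, -, rfl⟩
    simp only [h.apply_symm]
    exact (congrFun hfφ y).symm
  rw [e]
  refine setLIntegral_riemVolume_image_le hS h.injective_symm.injOn
    (fun T _ hT ↦ hemb.measurableSet_image.2 hT)
    (fun y _ ↦ (h.hasMFDerivAt_symm y).hasMFDerivWithinAt) hf
    (hφ.mul ((h.measurable_enorm_mfderiv_symm E).pow_const d)) fun y _ ↦ ?_
  rw [← congrFun hfφ y]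
  rfl

lemma IsDiffeoOnto.measure_le_setLIntegral (h : IsDiffeoOnto (d := d) F) (E : FrameField d Y)
    {S : Set Y} (hS : MeasurableSet S) :
    riemVolume d Y S ≤ ∫⁻ x in F.symm '' S,
      ‖mfderivWithin (cornerModel d) (cornerModel d) F F.source x‖ₑ ^ d ∂(riemVolume d X) := by
  have hemb := h.measurableEmbedding_symm
  have : SecondCountableTopology X := EMetric.secondCountable_of_sigmaCompact X
  have hsub : F.symm '' S ⊆ F.source := by
    rintro _ ⟨y, -, rfl⟩
    exact h.symm_mem y
  have himage : ∀ T : Set Y, F '' (F.symm '' T) = T := fun T ↦ by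
    rw [image_image]; simp [h.apply_symm]
  obtain ⟨g, hg, hgφ⟩ := hemb.exists_measurable_extend
    ((h.measurable_enorm_mfderivWithin E).pow_const d) fun _ ↦ ⟨0⟩
  have e : ∫⁻ x in F.symm '' S,
      ‖mfderivWithin (cornerModel d) (cornerModel d) F F.source x‖ₑ ^ d ∂(riemVolume d X) =
      ∫⁻ x in F.symm '' S, g x ∂(riemVolume d X) := by
    refine setLIntegral_congr_fun (hemb.measurableSet_image.2 hS) ?_
    rintro _ ⟨y, -, rfl⟩
    exact (congrFun hgφ y).symm
  rw [e]
  have key := setLIntegral_riemVolume_image_le (d := d) (hemb.measurableSet_image.2 hS)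
    (F.injOn.mono hsub) (Φ' := fun x ↦ mfderivWithin (cornerModel d) (cornerModel d) F F.source x)
    (f := fun _ ↦ 1) (g := g) (fun T hT hTm ↦ ?_)
    (fun x hx ↦ (h.hasMFDerivWithinAt (hsub hx)).mono hsub) measurable_const hg ?_
  · rw [himage] at key
    simpa using key
  · rw [← h.image_symm_preimage (hT.trans hsub), himage]
    exact h.smooth_symm.continuous.measurable hTm
  · rintro _ ⟨y, -, rfl⟩
    rw [one_mul]
    exact (congrFun hgφ y).ge

variable {p : ℝ}

/-- The Jacobian is bounded by the `p`-th power of `1 + ρ`, so `F.symm` distorts volume by a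
constant factor up to the total `L^p` defect, without a pointwise bound on its differential. -/
lemma IsDiffeoOnto.volume_image_symm_le (h : IsDiffeoOnto (d := d) F) (E : FrameField d Y)
    (hp : 1 ≤ p) (hdp : d ≤ p) {ρ : Y → ℝ≥0∞}
    (hρ : ∀ y, ‖mfderiv (cornerModel d) (cornerModel d) F.symm y‖ₑ ≤ 1 + ρ y)
    {S : Set Y} (hS : MeasurableSet S) :
    riemVolume d X (F.symm '' S) ≤
      2 ^ (p - 1) * (riemVolume d Y S + ∫⁻ y, ρ y ^ p ∂(riemVolume d Y)) := by
  have h1 := h.setLIntegral_image_symm_le E hS (φ := fun _ ↦ 1) measurable_const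
  simp only [lintegral_const, Measure.restrict_apply_univ, one_mul] at h1
  refine h1.trans ((lintegral_mono fun y ↦ pow_le_max_one_rpow hdp).trans
    ((setLIntegral_rpow_le_of_le_one_add _ hS hp (ρ := ρ)
      fun y _ ↦ max_le le_self_add (hρ y)).trans ?_))
  gcongr
  exact Measure.restrict_le_self

lemma IsDiffeoOnto.volume_le (h : IsDiffeoOnto (d := d) F) (E : FrameField d Y)
    (hp : 1 ≤ p) (hdp : d ≤ p) {ρ : X → ℝ≥0∞}
    (hρ : ∀ x ∈ F.source, ‖mfderivWithin (cornerModel d) (cornerModel d) F F.source x‖ₑ ≤ 1 + ρ x)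
    {S : Set Y} (hS : MeasurableSet S) :
    riemVolume d Y S ≤
      2 ^ (p - 1) * (riemVolume d X (F.symm '' S) +
        ∫⁻ x in F.source, ρ x ^ p ∂(riemVolume d X)) := by
  have hsub : F.symm '' S ⊆ F.source := by
    rintro _ ⟨y, -, rfl⟩
    exact h.symm_mem y
  refine (h.measure_le_setLIntegral E hS).trans
    ((lintegral_mono fun y ↦ pow_le_max_one_rpow hdp).trans
    ((setLIntegral_rpow_le_of_le_one_add _ (h.measurableEmbedding_symm.measurableSet_image.2 hS) hp
      (ρ := ρ) fun x hx ↦ max_le le_self_add (hρ x (hsub hx))).trans ?_))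
  gcongr

variable {Z : Type*} [EMetricSpace Z] [ChartedSpace (EuclideanQuadrant d) Z]
  [IsManifold (cornerModel d) ∞ Z]
  [RiemannianBundle (fun x : Z ↦ TangentSpace (cornerModel d) x)]
  [IsContMDiffRiemannianBundle (cornerModel d) ∞ (EuclideanSpace ℝ (Fin d))
      (fun x : Z ↦ TangentSpace (cornerModel d) x)]
  [CompactSpace Z] [MeasurableSpace Z] [BorelSpace Z]
  {G : PartialEquiv Z Y}

/-- The integral of `‖dF‖ ‖dG⁻¹‖` over a set is controlled by the measure of the set and the
`L^p` defects of the differentials. -/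
lemma IsDiffeoOnto.setLIntegral_mul_le (hF : IsDiffeoOnto (d := d) F)
    (hG : IsDiffeoOnto (d := d) G) (E : FrameField d Y) (hp : 1 ≤ p) (hdp : d < p)
    (hpd : p + (p - d) ≤ p * (p - d)) {ρ : X → ℝ≥0∞}
    (hρ : ∀ x ∈ F.source, ‖mfderivWithin (cornerModel d) (cornerModel d) F F.source x‖ₑ ≤ 1 + ρ x)
    {ρ' σ' : Y → ℝ≥0∞} (hρ' : ∀ y, ‖mfderiv (cornerModel d) (cornerModel d) F.symm y‖ₑ ≤ 1 + ρ' y)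
    (hσ' : ∀ y, ‖mfderiv (cornerModel d) (cornerModel d) G.symm y‖ₑ ≤ 1 + σ' y)
    {S : Set Y} (hS : MeasurableSet S) :
    ∫⁻ x in F.symm '' S, max 1 ‖mfderiv (cornerModel d) (cornerModel d) G.symm (F x)‖ₑ *
        max 1 ‖mfderivWithin (cornerModel d) (cornerModel d) F F.source x‖ₑ ∂(riemVolume d X) ≤
      2 ^ (p - 1) * (riemVolume d X (F.symm '' S) +
        ∫⁻ x in F.source, ρ x ^ p ∂(riemVolume d X)) +
      (2 ^ (p - 1) * (riemVolume d Y S + ∫⁻ y, σ' y ^ p ∂(riemVolume d Y)) +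
      2 ^ (p - 1) * (riemVolume d Y S + ∫⁻ y, ρ' y ^ p ∂(riemVolume d Y))) := by
  have hsub : F.symm '' S ⊆ F.source := by
    rintro _ ⟨y, -, rfl⟩
    exact hF.symm_mem y
  have hSi := hF.measurableEmbedding_symm.measurableSet_image.2 hS
  have hmG := (measurable_const (a := (1 : ℝ≥0∞))).max (hG.measurable_enorm_mfderiv_symm E)
  have hmF := (measurable_const (a := (1 : ℝ≥0∞))).max (hF.measurable_enorm_mfderiv_symm E)
  set γ : Y → ℝ≥0∞ := fun y ↦ max 1 ‖mfderiv (cornerModel d) (cornerModel d) G.symm y‖ₑ with hγ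
  set α : Y → ℝ≥0∞ := fun y ↦ max 1 ‖mfderiv (cornerModel d) (cornerModel d) F.symm y‖ₑ with hα
  set β : X → ℝ≥0∞ :=
    fun x ↦ max 1 ‖mfderivWithin (cornerModel d) (cornerModel d) F F.source x‖ₑ with hβ
  obtain ⟨f, hf, hfγ⟩ := hF.measurableEmbedding_symm.exists_measurable_extend
    (hmG.pow_const (p - d)) fun _ ↦ ⟨0⟩
  have hfγ' : ∀ x ∈ F.source, f x = γ (F x) ^ (p - d) := fun x hx ↦ by
    have := congrFun hfγ (F x)
    simp only [Function.comp_apply, F.left_inv hx] at this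
    exact this
  -- Young's inequality with exponent `p - d` on the factor from `G`. Its admissibility is the
  -- hypothesis `hpd`.
  have h1 : ∫⁻ x in F.symm '' S, γ (F x) * β x ∂(riemVolume d X) ≤
      ∫⁻ x in F.symm '' S, f x + β x ^ p ∂(riemVolume d X) := by
    refine setLIntegral_mono' hSi fun x hx ↦ ?_
    rw [hfγ' x (hsub hx)]
    exact mul_le_rpow_add_rpow (le_max_left _ _) (le_max_left _ _) (by linarith) (by linarith)
      (by linarith)
  -- Passing to `Y` multiplies `γ ^ (p - d)` by a Jacobian of order `α ^ d`. The exponents add up to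
  -- `p`, which is why `p - d` was chosen.
  have h2 : ∫⁻ x in F.symm '' S, f x ∂(riemVolume d X) ≤
      ∫⁻ y in S, (γ y ^ p + α y ^ p) ∂(riemVolume d Y) := by
    rw [setLIntegral_congr_fun hSi (fun x hx ↦ hfγ' x (hsub hx))]
    refine (hF.setLIntegral_image_symm_le E hS (hmG.pow_const (p - d))).trans
      (lintegral_mono fun y ↦ ?_)
    refine le_trans ?_ (rpow_mul_pow_le (q := p - d) (d := d) (by linarith) (by ring))
    gcongr
    exact le_max_right _ _
  rw [lintegral_add_left hf] at h1
  rw [lintegral_add_left (hmG.pow_const p)] at h2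
  refine h1.trans ?_
  rw [add_comm]
  refine add_le_add ?_ (h2.trans (add_le_add ?_ ?_))
  · refine (setLIntegral_rpow_le_of_le_one_add _ hSi hp (ρ := ρ)
      fun x hx ↦ max_le le_self_add (hρ x (hsub hx))).trans ?_
    gcongr
  · refine (setLIntegral_rpow_le_of_le_one_add _ hS hp (ρ := σ')
      fun x hx ↦ max_le le_self_add (hσ' x)).trans ?_
    gcongr
    exact Measure.restrict_le_self
  · refine (setLIntegral_rpow_le_of_le_one_add _ hS hp (ρ := ρ')
      fun x hx ↦ max_le le_self_add (hρ' x)).trans ?_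
    gcongr
    exact Measure.restrict_le_self

end IntegralEstimates

/-! ### The critical exponent, Chebyshev's inequality and Lipschitz constants -/

section SequenceEstimates

/-- `pMin d = (d + 2 + √(d² + 4)) / 2` is the larger root of `p + (p - d) = p (p - d)`. -/
lemma one_le_and_lt_and_le_of_pMin_le {d : ℕ} (hd : 1 ≤ d) {p : ℝ} (hp : pMin d ≤ p) :
    1 ≤ p ∧ d < p ∧ p + (p - d) ≤ p * (p - d) := by
  have hd' : (1 : ℝ) ≤ d := by exact_mod_cast hd
  have hs : 0 ≤ √(1 + 4 / (d : ℝ) ^ 2) := Real.sqrt_nonneg _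
  have hs2 : √(1 + 4 / (d : ℝ) ^ 2) ^ 2 = 1 + 4 / (d : ℝ) ^ 2 := Real.sq_sqrt (by positivity)
  set s := √(1 + 4 / (d : ℝ) ^ 2) with hsdef
  have hds : ((d : ℝ) * s) ^ 2 = d ^ 2 + 4 := by
    rw [mul_pow, hs2]; field_simp
  have hds0 : 0 ≤ (d : ℝ) * s := by positivity
  have hdsd : (d : ℝ) ≤ d * s := by nlinarith
  have hp' : (d + 2 + d * s) / 2 ≤ p := by
    refine le_trans (le_of_eq ?_) hp
    rw [pMin, ← hsdef]; ring
  refine ⟨by linarith, by linarith, ?_⟩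
  nlinarith

/-- Chebyshev's inequality, for a sequence of different measure spaces. -/
lemma tendsto_measure_of_le_of_lintegral_rpow {α : ℕ → Type*} [∀ n, MeasurableSpace (α n)]
    {μ : ∀ n, Measure (α n)} {B S : ∀ n, Set (α n)} {h : ∀ n, α n → ℝ≥0∞} {p : ℝ} (hp : 0 ≤ p)
    (hlim : Tendsto (fun n ↦ ∫⁻ x in B n, h n x ^ p ∂(μ n)) atTop (𝓝 0))
    (hS : ∀ n, MeasurableSet (S n)) (hSB : ∀ n, S n ⊆ B n) {c : ℝ≥0} (hc : 0 < c)
    (hcS : ∀ n, ∀ x ∈ S n, c ≤ h n x) : Tendsto (fun n ↦ μ n (S n)) atTop (𝓝 0) := by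
  have hcp : (c : ℝ≥0∞) ^ p ≠ 0 := by
    rw [← ENNReal.coe_rpow_of_nonneg _ hp]
    simpa using (NNReal.rpow_pos hc).ne'
  have hcp' : (c : ℝ≥0∞) ^ p ≠ ⊤ := ENNReal.rpow_ne_top_of_nonneg hp ENNReal.coe_ne_top
  have h1 : Tendsto (fun n ↦ (∫⁻ x in B n, h n x ^ p ∂(μ n)) / (c : ℝ≥0∞) ^ p) atTop (𝓝 0) := by
    simpa using ENNReal.Tendsto.div_const hlim (Or.inr hcp)
  refine tendsto_of_tendsto_of_tendsto_of_le_of_le tendsto_const_nhds h1 (fun _ ↦ zero_le)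
    fun n ↦ ?_
  rw [ENNReal.le_div_iff_mul_le (Or.inl hcp) (Or.inl hcp')]
  calc μ n (S n) * (c : ℝ≥0∞) ^ p = ∫⁻ _ in S n, (c : ℝ≥0∞) ^ p ∂(μ n) := by simp [mul_comm]
    _ ≤ ∫⁻ x in S n, h n x ^ p ∂(μ n) :=
        setLIntegral_mono' (hS n) fun x hx ↦ ENNReal.rpow_le_rpow (hcS n x hx) hp
    _ ≤ _ := lintegral_mono_set (hSB n)

lemma enorm_le_one_add_edist {V : Type*} [SeminormedAddCommGroup V] {L A : V} (hA : ‖A‖ ≤ 1) :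
    ‖L‖ₑ ≤ 1 + edist L A := by
  have hA2 : ‖A‖ₑ ≤ 1 := by
    rw [← ofReal_norm, ← ENNReal.ofReal_one]; exact ENNReal.ofReal_le_ofReal hA
  calc ‖L‖ₑ = edist L 0 := by rw [edist_eq_enorm_sub, sub_zero]
    _ ≤ edist A 0 + edist L A := (edist_triangle L A 0).trans_eq (add_comm _ _)
    _ ≤ 1 + edist L A := by gcongr; rwa [edist_eq_enorm_sub, sub_zero]

lemma range_cornerModel (d : ℕ) :
    range (cornerModel d) = {z : EuclideanSpace ℝ (Fin d) | ∀ i, 0 ≤ z i} :=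
  range_euclideanQuadrant d

variable {d : ℕ} {X : Type*} [EMetricSpace X] [ChartedSpace (EuclideanQuadrant d) X]
  [IsManifold (cornerModel d) ∞ X]
  [RiemannianBundle (fun x : X ↦ TangentSpace (cornerModel d) x)]
  {Y : Type*} [EMetricSpace Y] [ChartedSpace (EuclideanQuadrant d) Y]
  [IsManifold (cornerModel d) ∞ Y]
  [RiemannianBundle (fun x : Y ↦ TangentSpace (cornerModel d) x)]

/-- Linear isometries have norm at most one. This gives the defects `ρ` of the integral estimates.
-/
lemma enorm_le_one_add_infEDist_SOset (oX : ManifoldOrientation d X)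
    (oY : ManifoldOrientation d Y) (x : X) (y : Y)
    (L : TangentSpace (cornerModel d) x →L[ℝ] TangentSpace (cornerModel d) y) :
    ‖L‖ₑ ≤ 1 + Metric.infEDist L (SOset oX oY x y) := by
  rw [← tsub_le_iff_left, Metric.infEDist]
  refine le_iInf₂ fun A hA ↦ ?_
  obtain ⟨Q, -, hQ⟩ := hA
  have hA1 : ‖A‖ ≤ 1 := A.opNorm_le_bound zero_le_one fun v ↦ by rw [hQ, Q.norm_map, one_mul]
  rw [tsub_le_iff_left]
  exact enorm_le_one_add_edist hA1

variable [IsContMDiffRiemannianBundle (cornerModel d) ∞ (EuclideanSpace ℝ (Fin d))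
      (fun x : X ↦ TangentSpace (cornerModel d) x)]
  [IsContMDiffRiemannianBundle (cornerModel d) ∞ (EuclideanSpace ℝ (Fin d))
      (fun x : Y ↦ TangentSpace (cornerModel d) x)]

lemma exists_ne_edist_ne_top [IsRiemannianManifold (cornerModel d) X] (hd : 1 ≤ d) (x₀ : X) :
    ∃ x y : X, x ≠ y ∧ edist x y ≠ ⊤ := by
  obtain ⟨C, r, hr, hsub, hC⟩ := exists_ball_edist_symm_le (d := d) x₀
  set z := extChartAt (cornerModel d) x₀ x₀ with hz
  have hzr : z ∈ range (cornerModel d) := by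
    rw [hz, extChartAt_coe]; exact mem_range_self _
  have hz1 : z ∈ Metric.ball z r ∩ range (cornerModel d) := ⟨Metric.mem_ball_self hr, hzr⟩
  -- Moving in the positive direction of a coordinate, which exists as `d ≥ 1`, stays in the
  -- quadrant.
  set e : EuclideanSpace ℝ (Fin d) := EuclideanSpace.single ⟨0, hd⟩ (r / 2) with he
  have hen : ‖e‖ = r / 2 := by
    rw [he, PiLp.norm_single, Real.norm_eq_abs, abs_of_pos (by positivity)]
  have hz2 : z + e ∈ Metric.ball z r ∩ range (cornerModel d) := by
    refine ⟨?_, ?_⟩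
    · rw [mem_ball_iff_norm, add_sub_cancel_left, hen]; linarith
    · rw [range_cornerModel] at hzr ⊢
      intro i
      have h1 : 0 ≤ e i := by
        rw [he, PiLp.single_apply]
        split_ifs <;> positivity
      exact add_nonneg (hzr i) h1
  refine ⟨_, _, fun h ↦ ?_, ne_top_of_le_ne_top ?_ (hC z hz1 (z + e) hz2)⟩
  · have := (extChartAt (cornerModel d) x₀).symm.injOn (hsub hz1) (hsub hz2) h
    have h0 : e = 0 := by simpa using this
    rw [h0, norm_zero] at hen
    linarith
  · exact ENNReal.mul_ne_top ENNReal.coe_ne_top (edist_ne_top _ _)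

/-- For two distinct points of `Y` at finite distance, either `F` or its inverse does not shrink
their distance. Thus adding the two parts of condition 1 forces the uncovered volume to tend to
zero. -/
lemma one_le_lipConst_sq_add_sq [IsRiemannianManifold (cornerModel d) Y] [Nonempty Y] (hd : 1 ≤ d)
    {F : PartialEquiv X Y} (h : IsDiffeoOnto (d := d) F) :
    1 ≤ lipConst F F.source ^ 2 + lipConst F.symm univ ^ 2 := by
  obtain ⟨x, y, hxy, hfin⟩ := exists_ne_edist_ne_top (d := d) hd (Classical.arbitrary Y)
  have h0 : edist x y ≠ 0 := by simpa using hxy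
  have h0' : edist (F.symm x) (F.symm y) ≠ 0 := by simpa using h.injective_symm.ne hxy
  have h1 : edist x y / edist (F.symm x) (F.symm y) ≤ lipConst F F.source := by
    have := le_iSup₂_of_le (f := fun x' (_ : x' ∈ F.source) ↦ ⨆ y' ∈ F.source,
      edist (F x') (F y') / edist x' y') (F.symm x) (h.symm_mem x)
      (le_iSup₂_of_le (F.symm y) (h.symm_mem y) le_rfl)
    rwa [h.apply_symm, h.apply_symm] at this
  have h2 : edist (F.symm x) (F.symm y) / edist x y ≤ lipConst F.symm univ :=
    le_iSup₂_of_le (f := fun x' (_ : x' ∈ univ) ↦ ⨆ y' ∈ univ,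
      edist (F.symm x') (F.symm y') / edist x' y') x (mem_univ x)
      (le_iSup₂_of_le y (mem_univ y) le_rfl)
  rcases le_total (edist x y) (edist (F.symm x) (F.symm y)) with h3 | h3
  · have h4 : 1 ≤ lipConst F.symm univ := by
      refine le_trans ?_ h2
      rwa [ENNReal.le_div_iff_mul_le (Or.inl h0) (Or.inl hfin), one_mul]
    exact (one_le_pow₀ h4).trans le_add_self
  · have h4 : 1 ≤ lipConst F F.source := by
      refine le_trans ?_ h1
      rwa [ENNReal.le_div_iff_mul_le (Or.inl h0') (Or.inl (ne_top_of_le_ne_top hfin h3)), one_mul]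
    exact (one_le_pow₀ h4).trans le_self_add

/-- Finitely many balls of radius `ε / 2` cover `X`, each of positive volume. Once the complement of
`W n` has smaller volume than each of them, `W n` meets them all. -/
lemma eventually_forall_infEDist_le [CompactSpace X] [MeasurableSpace X] [BorelSpace X]
    {W : ℕ → Set X} (hW : Tendsto (fun n ↦ riemVolume d X (W n)ᶜ) atTop (𝓝 0)) {ε : ℝ≥0∞}
    (hε : 0 < ε) : ∀ᶠ n in atTop, ∀ x, Metric.infEDist x (W n) ≤ ε := by
  obtain ⟨t, -, ht⟩ := isCompact_univ.elim_nhds_subcover (fun x : X ↦ Metric.eball x (ε / 2))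
    (fun x _ ↦ Metric.eball_mem_nhds x (ENNReal.half_pos hε.ne'))
  have h1 : ∀ x ∈ t, ∀ᶠ n in atTop, riemVolume d X (W n)ᶜ < riemVolume d X (Metric.eball x (ε / 2)) :=
    fun x _ ↦ hW.eventually_lt_const (Metric.isOpen_eball.measure_pos _
      ⟨x, Metric.mem_eball_self (ENNReal.half_pos hε.ne')⟩)
  filter_upwards [(eventually_all_finset t).2 h1] with n hn x
  obtain ⟨c, hc, hxc⟩ := mem_iUnion₂.1 (ht (mem_univ x))
  have h2 : ∃ w ∈ Metric.eball c (ε / 2), w ∈ W n := by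
    by_contra! H
    exact (hn c hc).not_ge (measure_mono fun w hw ↦ H w hw)
  obtain ⟨w, hw, hwW⟩ := h2
  calc Metric.infEDist x (W n) ≤ edist x w := Metric.infEDist_le_edist_of_mem hwW
    _ ≤ edist x c + edist w c := edist_triangle_right _ _ _
    _ ≤ ε / 2 + ε / 2 := add_le_add hxc.le hw.le
    _ = ε := ENNReal.add_halves ε

lemma lipConst_le {f : X → Y} {s : Set X} {C : ℝ≥0∞} 
    (h : ∀ x ∈ s, ∀ y ∈ s, edist (f x) (f y) ≤ C * edist x y) : lipConst f s ≤ C :=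
  iSup₂_le fun x hx ↦ iSup₂_le fun y hy ↦ ENNReal.div_le_of_le_mul (h x hx y hy)

/-- The distance has to be finite: division by `∞` gives `0`, so points in different components
leave no trace in `lipConst`. -/
lemma edist_le_lipConst_mul {f : X → Y} {s : Set X} {x y : X} (hx : x ∈ s)
    (hy : y ∈ s) (hxy : edist x y ≠ ⊤) : edist (f x) (f y) ≤ lipConst f s * edist x y := by
  rcases eq_or_ne x y with rfl | hne
  · simp
  have h1 : edist (f x) (f y) / edist x y ≤ lipConst f s :=
    le_iSup₂_of_le (f := fun x' (_ : x' ∈ s) ↦ ⨆ y' ∈ s, edist (f x') (f y') / edist x' y') x hx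
      (le_iSup₂_of_le y hy le_rfl)
  rwa [ENNReal.div_le_iff (by simpa using hne) hxy] at h1

lemma lipConst_ne_top [CompactSpace X] [IsRiemannianManifold (cornerModel d) X]
    [IsRiemannianManifold (cornerModel d) Y] (E : FrameField d X) {f : X → Y}
    (hf : ContMDiff (cornerModel d) (cornerModel d) ∞ f) (s : Set X) : lipConst f s ≠ ⊤ := by
  obtain ⟨C, hC0, hC⟩ := exists_enorm_mfderiv_le E hf
  exact ne_top_of_le_ne_top (ENNReal.coe_ne_top (r := C)) (lipConst_le fun x _ y _ ↦
    edist_map_le_of_enorm_mfderiv_le (hf.of_le (by simp)) hC0 hC x y)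

end SequenceEstimates

/-! ### Consequences of convergence for a single sequence of maps -/

section Convergence

variable {d : ℕ} {p : ℝ}
  {Ms : ℕ → Type*} [∀ n, EMetricSpace (Ms n)] [∀ n, CompactSpace (Ms n)] [∀ n, Nonempty (Ms n)]
  [∀ n, ChartedSpace (EuclideanQuadrant d) (Ms n)]
  [∀ n, IsManifold (cornerModel d) ∞ (Ms n)]
  [∀ n, RiemannianBundle (fun x : Ms n ↦ TangentSpace (cornerModel d) x)]
  [∀ n, IsContMDiffRiemannianBundle (cornerModel d) ∞ (EuclideanSpace ℝ (Fin d))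
    (fun x : Ms n ↦ TangentSpace (cornerModel d) x)]
  [∀ n, IsRiemannianManifold (cornerModel d) (Ms n)]
  [∀ n, MeasurableSpace (Ms n)] [∀ n, BorelSpace (Ms n)]
  {M : Type*} [EMetricSpace M] [CompactSpace M]
  [ChartedSpace (EuclideanQuadrant d) M] [IsManifold (cornerModel d) ∞ M]
  [RiemannianBundle (fun x : M ↦ TangentSpace (cornerModel d) x)]
  [IsContMDiffRiemannianBundle (cornerModel d) ∞ (EuclideanSpace ℝ (Fin d))
    (fun x : M ↦ TangentSpace (cornerModel d) x)]
  [IsRiemannianManifold (cornerModel d) M]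
  [MeasurableSpace M] [BorelSpace M]
  {os : ∀ n, ManifoldOrientation d (Ms n)} {Es : ∀ n, FrameField d (Ms n)}
  {oM : ManifoldOrientation d M} {EM : FrameField d M} {F : ∀ n, PartialEquiv M (Ms n)}

namespace ConvergesVia

lemma isDiffeoOnto (hF : ConvergesVia p os Es oM EM F) (n : ℕ) : IsDiffeoOnto (d := d) (F n) :=
  ⟨hF.target_eq n, hF.smooth n, hF.smooth_symm n⟩

lemma comp (hF : ConvergesVia p os Es oM EM F) {φ : ℕ → ℕ} (hφ : StrictMono φ) :
    ConvergesVia p (fun n ↦ os (φ n)) (fun n ↦ Es (φ n)) oM EM (fun n ↦ F (φ n)) where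
  le_exponent := hF.le_exponent
  target_eq _ := hF.target_eq _
  smooth _ := hF.smooth _
  smooth_symm _ := hF.smooth_symm _
  covers := hF.covers.comp hφ.tendsto_atTop
  covers_symm := hF.covers_symm.comp hφ.tendsto_atTop
  distortion_tendsto := hF.distortion_tendsto.comp hφ.tendsto_atTop
  rigid := hF.rigid.comp hφ.tendsto_atTop
  rigid_symm := hF.rigid_symm.comp hφ.tendsto_atTop
  frames := hF.frames.comp hφ.tendsto_atTop

lemma tendsto_volume_compl (hF : ConvergesVia p os Es oM EM F) (hd : 1 ≤ d) :
    Tendsto (fun n ↦ riemVolume d M (F n).sourceᶜ) atTop (𝓝 0) := by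
  have h := hF.covers.add hF.covers_symm
  rw [add_zero] at h
  refine tendsto_of_tendsto_of_tendsto_of_le_of_le tendsto_const_nhds h (fun _ ↦ zero_le)
    fun n ↦ ?_
  calc riemVolume d M (F n).sourceᶜ = riemVolume d M (F n).sourceᶜ * 1 := (mul_one _).symm
    _ ≤ riemVolume d M (F n).sourceᶜ *
        (lipConst (F n) (F n).source ^ 2 + lipConst (F n).symm univ ^ 2) := by
        gcongr
        exact one_le_lipConst_sq_add_sq hd (hF.isDiffeoOnto n)
    _ = _ := mul_add _ _ _

lemma isApproxIsometry (hF : ConvergesVia p os Es oM EM F) (hd : 1 ≤ d) : IsApproxIsometry F where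
  target_eq := hF.target_eq
  compact n := (hF.isDiffeoOnto n).isCompact_source
  nonempty n := ⟨_, (hF.isDiffeoOnto n).symm_mem (Classical.arbitrary (Ms n))⟩
  dense _ hε := eventually_forall_infEDist_le (hF.tendsto_volume_compl hd) hε
  distortion := hF.distortion_tendsto

/-- If the uncovered set has positive volume, an infinite Lipschitz constant makes the product in
`covers` infinite. Since `0 * ∞ = 0`, null sets need another argument: the uncovered set is open,
hence empty, and `F n` is smooth on the whole compact manifold. -/
lemma eventually_lipConst_ne_top (hF : ConvergesVia p os Es oM EM F) :
    ∀ᶠ n in atTop, lipConst (F n) (F n).source ≠ ⊤ := by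
  filter_upwards [hF.covers.eventually_lt_const zero_lt_one] with n hn htop
  have hcpt := (hF.isDiffeoOnto n).isCompact_source
  rcases eq_or_ne (riemVolume d M (F n).sourceᶜ) 0 with h0 | h0
  · have hempty := (hcpt.isClosed.isOpen_compl.measure_eq_zero_iff _).1 h0
    have huniv : (F n).source = univ := by rwa [compl_empty_iff] at hempty
    have hsm := hF.smooth n
    rw [huniv, contMDiffOn_univ] at hsm
    exact lipConst_ne_top EM hsm _ htop
  · rw [htop, ENNReal.top_pow two_ne_zero, ENNReal.mul_top h0] at hn
    exact absurd hn (by simp)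

/-- Together with its converse below, this lets exceptional sets be measured on `Ms n` or on `M`, as
needed. The sets coming from `F` and from `G` are compared on `Ms n`. -/
lemma tendsto_volume_image_symm (hF : ConvergesVia p os Es oM EM F) (hd : 1 ≤ d)
    {S : ∀ n, Set (Ms n)} (hS : ∀ n, MeasurableSet (S n))
    (h : Tendsto (fun n ↦ riemVolume d (Ms n) (S n)) atTop (𝓝 0)) :
    Tendsto (fun n ↦ riemVolume d M ((F n).symm '' S n)) atTop (𝓝 0) := by
  obtain ⟨hp1, hdp, -⟩ := one_le_and_lt_and_le_of_pMin_le hd hF.le_exponent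
  have h2 : (2 : ℝ≥0∞) ^ (p - 1) ≠ ⊤ := ENNReal.rpow_ne_top_of_nonneg (by linarith) (by simp)
  have h3 := ENNReal.Tendsto.const_mul (h.add hF.rigid_symm) (Or.inr h2)
  rw [add_zero, mul_zero] at h3
  exact tendsto_of_tendsto_of_tendsto_of_le_of_le tendsto_const_nhds h3 (fun _ ↦ zero_le)
    fun n ↦ (hF.isDiffeoOnto n).volume_image_symm_le (Es n) hp1 hdp.le
      (fun y ↦ enorm_le_one_add_infEDist_SOset (os n) oM _ _ _) (hS n)

lemma tendsto_volume_of_image_symm (hF : ConvergesVia p os Es oM EM F) (hd : 1 ≤ d)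
    {S : ∀ n, Set (Ms n)} (hS : ∀ n, MeasurableSet (S n))
    (h : Tendsto (fun n ↦ riemVolume d M ((F n).symm '' S n)) atTop (𝓝 0)) :
    Tendsto (fun n ↦ riemVolume d (Ms n) (S n)) atTop (𝓝 0) := by
  obtain ⟨hp1, hdp, -⟩ := one_le_and_lt_and_le_of_pMin_le hd hF.le_exponent
  have h2 : (2 : ℝ≥0∞) ^ (p - 1) ≠ ⊤ := ENNReal.rpow_ne_top_of_nonneg (by linarith) (by simp)
  have h3 := ENNReal.Tendsto.const_mul (h.add hF.rigid) (Or.inr h2)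
  rw [add_zero, mul_zero] at h3
  exact tendsto_of_tendsto_of_tendsto_of_le_of_le tendsto_const_nhds h3 (fun _ ↦ zero_le)
    fun n ↦ (hF.isDiffeoOnto n).volume_le (Es n) hp1 hdp.le
      (fun x _ ↦ enorm_le_one_add_infEDist_SOset oM (os n) _ _ _) (hS n)

/-- The set where the differential of `Fₙ` is large has small measure. -/
lemma tendsto_volume_lt_enorm_mfderivWithin (hF : ConvergesVia p os Es oM EM F) (hd : 1 ≤ d)
    {ε : ℝ≥0} (hε : 0 < ε) :
    Tendsto (fun n ↦ riemVolume d (Ms n) {y | ((1 + ε : ℝ≥0) : ℝ≥0∞) <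
      ‖mfderivWithin (cornerModel d) (cornerModel d) (F n) (F n).source ((F n).symm y)‖ₑ})
      atTop (𝓝 0) := by
  obtain ⟨hp1, hdp, -⟩ := one_le_and_lt_and_le_of_pMin_le hd hF.le_exponent
  have hop := fun n ↦ (hF.isDiffeoOnto n).isOpen_lt_enorm_mfderivWithin (Es n) (1 + ε)
  refine hF.tendsto_volume_of_image_symm hd (fun n ↦ (hop n).measurableSet) ?_
  refine tendsto_measure_of_le_of_lintegral_rpow (by linarith) hF.rigid (fun n ↦
    (hF.isDiffeoOnto n).measurableEmbedding_symm.measurableSet_image.2 (hop n).measurableSet)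
    ?_ hε ?_
  · rintro n _ ⟨y, -, rfl⟩
    exact (hF.isDiffeoOnto n).symm_mem y
  · rintro n _ ⟨y, hy, rfl⟩
    have h1 := enorm_le_one_add_infEDist_SOset oM (os n) _ _
      (mfderivWithin (cornerModel d) (cornerModel d) (F n) (F n).source ((F n).symm y))
    have h2 := (lt_of_lt_of_le hy h1).le
    rw [ENNReal.coe_add, ENNReal.coe_one] at h2
    exact (ENNReal.add_le_add_iff_left ENNReal.one_ne_top).1 h2

/-- The set where the differential of `Fₙ⁻¹` is large has small measure. -/
lemma tendsto_volume_lt_enorm_mfderiv_symm (hF : ConvergesVia p os Es oM EM F) (hd : 1 ≤ d)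
    {ε : ℝ≥0} (hε : 0 < ε) :
    Tendsto (fun n ↦ riemVolume d (Ms n) {y | ((1 + ε : ℝ≥0) : ℝ≥0∞) <
      ‖mfderiv (cornerModel d) (cornerModel d) (F n).symm y‖ₑ}) atTop (𝓝 0) := by
  obtain ⟨hp1, hdp, -⟩ := one_le_and_lt_and_le_of_pMin_le hd hF.le_exponent
  have hop := fun n ↦ isOpen_lt_enorm_mfderiv (Es n) (hF.smooth_symm n) (1 + ε)
  have hr : Tendsto (fun n ↦ ∫⁻ y in univ,
      Metric.infEDist (mfderiv (cornerModel d) (cornerModel d) (F n).symm y)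
        (SOset (os n) oM y ((F n).symm y)) ^ p ∂(riemVolume d (Ms n))) atTop (𝓝 0) := by
    simpa only [setLIntegral_univ] using hF.rigid_symm
  refine tendsto_measure_of_le_of_lintegral_rpow (by linarith) hr (fun n ↦
    (hop n).measurableSet) (fun n ↦ subset_univ _) hε fun n y hy ↦ ?_
  have h1 := enorm_le_one_add_infEDist_SOset (os n) oM _ _
    (mfderiv (cornerModel d) (cornerModel d) (F n).symm y)
  have h2 := (lt_of_lt_of_le hy h1).le
  rw [ENNReal.coe_add, ENNReal.coe_one] at h2
  exact (ENNReal.add_le_add_iff_left ENNReal.one_ne_top).1 h2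

end ConvergesVia

lemma framePullbackDist_symm {X Y : Type*} [EMetricSpace X] [ChartedSpace (EuclideanQuadrant d) X]
    [IsManifold (cornerModel d) ∞ X] [RiemannianBundle (fun x : X ↦ TangentSpace (cornerModel d) x)]
    [EMetricSpace Y] [ChartedSpace (EuclideanQuadrant d) Y]
    [IsManifold (cornerModel d) ∞ Y] [RiemannianBundle (fun x : Y ↦ TangentSpace (cornerModel d) x)]
    {F : PartialEquiv X Y} (h : IsDiffeoOnto (d := d) F) (E' : FrameField d Y) (E : FrameField d X)
    (y : Y) : framePullbackDist F F.source E' E (F.symm y) =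
      (∑ i : Fin d, ‖mfderiv (cornerModel d) (cornerModel d) F.symm y (E'.frame y i) -
        E.frame (F.symm y) i‖ₑ ^ 2) ^ (1 / 2 : ℝ) := by
  simp only [framePullbackDist, h.mpullbackWithin_symm_apply]

lemma le_rpow_half_sum_sq {ι : Type*} [Fintype ι] (a : ι → ℝ≥0∞) (i : ι) :
    a i ≤ (∑ j, a j ^ 2) ^ (1 / 2 : ℝ) := by
  calc a i = (a i ^ 2) ^ (1 / 2 : ℝ) := by
        rw [← ENNReal.rpow_natCast, ← ENNReal.rpow_mul]; norm_num
    _ ≤ _ := by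
        refine ENNReal.rpow_le_rpow ?_ (by norm_num)
        exact Finset.single_le_sum (f := fun j ↦ a j ^ 2) (fun _ _ ↦ zero_le) (Finset.mem_univ i)

lemma continuous_framePullbackDist_symm {X Y : Type*} [EMetricSpace X]
    [ChartedSpace (EuclideanQuadrant d) X]
    [IsManifold (cornerModel d) ∞ X] [RiemannianBundle (fun x : X ↦ TangentSpace (cornerModel d) x)]
    [IsContMDiffRiemannianBundle (cornerModel d) ∞ (EuclideanSpace ℝ (Fin d))
      (fun x : X ↦ TangentSpace (cornerModel d) x)]
    [EMetricSpace Y] [ChartedSpace (EuclideanQuadrant d) Y]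
    [IsManifold (cornerModel d) ∞ Y] [RiemannianBundle (fun x : Y ↦ TangentSpace (cornerModel d) x)]
    [IsContMDiffRiemannianBundle (cornerModel d) ∞ (EuclideanSpace ℝ (Fin d))
      (fun x : Y ↦ TangentSpace (cornerModel d) x)]
    {F : PartialEquiv X Y} (h : IsDiffeoOnto (d := d) F) (E' : FrameField d Y)
    (E : FrameField d X) :
    Continuous fun y ↦ framePullbackDist F F.source E' E (F.symm y) := by
  simp only [framePullbackDist_symm h]
  refine ENNReal.continuous_rpow_const.comp (continuous_finsetSum _ fun i _ ↦ ?_)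
  refine (ENNReal.continuous_pow 2).comp ?_
  -- The difference is written as a combination with coefficients `1` and `-1`, to which the
  -- continuity of norms of combinations applies.
  let v : Bool → ∀ y, TangentSpace (cornerModel d) (F.symm y) := fun j y ↦ bif j then
    mfderiv (cornerModel d) (cornerModel d) F.symm y (E'.frame y i) else E.frame (F.symm y) i
  have hv : ∀ j, Continuous (fun y ↦ (⟨F.symm y, v j y⟩ : TangentBundle (cornerModel d) X)) := by
    rintro (_ | _)
    · exact (E.continuous_section i).comp h.smooth_symm.continuous
    · exact E'.continuous_mfderiv h.smooth_symm i
  have hc := continuous_norm_sum_smul (d := d) (X := X) (fun j ↦ bif j then 1 else -1) hv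
  simp only [v, Fintype.sum_bool, cond_true, cond_false, one_smul, neg_smul, ← sub_eq_add_neg] at hc
  simp only [← ofReal_norm]
  exact ENNReal.continuous_ofReal.comp hc

/-- The set where the pullback of the frame of `Mₙ` is far from the frame of `M` has small
measure. -/
lemma ConvergesVia.tendsto_volume_lt_framePullbackDist (hF : ConvergesVia p os Es oM EM F)
    (hd : 1 ≤ d) {ε : ℝ≥0} (hε : 0 < ε) :
    Tendsto (fun n ↦ riemVolume d (Ms n) {y | (ε : ℝ≥0∞) <
      framePullbackDist (F n) (F n).source (Es n) EM ((F n).symm y)}) atTop (𝓝 0) := by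
  obtain ⟨hp1, hdp, -⟩ := one_le_and_lt_and_le_of_pMin_le hd hF.le_exponent
  have hop := fun n ↦ isOpen_lt (continuous_const (y := (ε : ℝ≥0∞)))
    (continuous_framePullbackDist_symm (hF.isDiffeoOnto n) (Es n) EM)
  refine hF.tendsto_volume_of_image_symm hd (fun n ↦ (hop n).measurableSet) ?_
  refine tendsto_measure_of_le_of_lintegral_rpow (by linarith) hF.frames (fun n ↦
    (hF.isDiffeoOnto n).measurableEmbedding_symm.measurableSet_image.2 (hop n).measurableSet)
    ?_ hε ?_
  · rintro n _ ⟨y, -, rfl⟩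
    exact (hF.isDiffeoOnto n).symm_mem y
  · rintro n _ ⟨y, hy, rfl⟩
    exact le_of_lt hy

end Convergence

/-! ### Pointwise estimates for the differential of a transition map -/

section Transition

variable {d : ℕ} {X : Type*} [EMetricSpace X] [ChartedSpace (EuclideanQuadrant d) X]
  [IsManifold (cornerModel d) ∞ X]
  [RiemannianBundle (fun x : X ↦ TangentSpace (cornerModel d) x)]
  {Y : Type*} [EMetricSpace Y] [ChartedSpace (EuclideanQuadrant d) Y]
  [IsManifold (cornerModel d) ∞ Y]
  [RiemannianBundle (fun x : Y ↦ TangentSpace (cornerModel d) x)]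
  {Z : Type*} [EMetricSpace Z] [ChartedSpace (EuclideanQuadrant d) Z]
  [IsManifold (cornerModel d) ∞ Z]
  [RiemannianBundle (fun x : Z ↦ TangentSpace (cornerModel d) x)]

/-- The differential of the transition map `G⁻¹ ∘ F`. -/
def transitionDeriv (F : PartialEquiv X Y) (G : PartialEquiv Z Y) (x : X) :
    TangentSpace (cornerModel d) x →L[ℝ] TangentSpace (cornerModel d) (G.symm (F x)) :=
  (mfderiv (cornerModel d) (cornerModel d) G.symm (F x)).comp
    (mfderivWithin (cornerModel d) (cornerModel d) F F.source x)

variable {F : PartialEquiv X Y} {G : PartialEquiv Z Y}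

lemma hasMFDerivWithinAt_transition (hF : IsDiffeoOnto (d := d) F) (hG : IsDiffeoOnto (d := d) G)
    {x : X} (hx : x ∈ F.source) : HasMFDerivWithinAt (cornerModel d) (cornerModel d)
      (fun x ↦ G.symm (F x)) F.source x (transitionDeriv F G x) :=
  (hG.hasMFDerivAt_symm (F x)).comp_hasMFDerivWithinAt x (hF.hasMFDerivWithinAt hx)

lemma enorm_transitionDeriv_le (x : X) : ‖transitionDeriv (d := d) F G x‖ₑ ≤
    ‖mfderiv (cornerModel d) (cornerModel d) G.symm (F x)‖ₑ *
      ‖mfderivWithin (cornerModel d) (cornerModel d) F F.source x‖ₑ := by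
  rw [← ofReal_norm, ← ofReal_norm, ← ofReal_norm, ← ENNReal.ofReal_mul (norm_nonneg _)]
  exact ENNReal.ofReal_le_ofReal (ContinuousLinearMap.opNorm_comp_le _ _)

/-- The transition differential takes the `F`-pullback of the frame of `Y` exactly to its
`G`-pullback. The two errors are the distances of these pullbacks from the frames of `X` and `Z`,
the first amplified by the transition differential. -/
lemma enorm_transitionDeriv_frame_sub_le (hF : IsDiffeoOnto (d := d) F)
    (hG : IsDiffeoOnto (d := d) G) (EY : FrameField d Y) (EX : FrameField d X)
    (EZ : FrameField d Z) {x : X} (hx : x ∈ F.source) (i : Fin d) :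
    ‖transitionDeriv F G x (EX.frame x i) - EZ.frame (G.symm (F x)) i‖ₑ ≤
      ‖mfderiv (cornerModel d) (cornerModel d) G.symm (F x)‖ₑ *
        ‖mfderivWithin (cornerModel d) (cornerModel d) F F.source x‖ₑ *
          framePullbackDist F F.source EY EX x +
      framePullbackDist G G.source EY EZ (G.symm (F x)) := by
  set P := VectorField.mpullbackWithin (cornerModel d) (cornerModel d) F
    (fun y ↦ EY.frame y i) F.source x with hP
  have h1 : ‖P - EX.frame x i‖ₑ ≤ framePullbackDist F F.source EY EX x :=
    le_rpow_half_sum_sq (fun i ↦ ‖VectorField.mpullbackWithin (cornerModel d) (cornerModel d) F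
      (fun y ↦ EY.frame y i) F.source x - EX.frame x i‖ₑ) i
  have h2 : ‖mfderiv (cornerModel d) (cornerModel d) G.symm (F x) (EY.frame (F x) i) -
      EZ.frame (G.symm (F x)) i‖ₑ ≤ framePullbackDist G G.source EY EZ (G.symm (F x)) := by
    rw [framePullbackDist_symm hG]
    exact le_rpow_half_sum_sq (fun i ↦
      ‖mfderiv (cornerModel d) (cornerModel d) G.symm (F x) (EY.frame (F x) i) -
      EZ.frame (G.symm (F x)) i‖ₑ) i
  have h3 : transitionDeriv F G x P =
      mfderiv (cornerModel d) (cornerModel d) G.symm (F x) (EY.frame (F x) i) := by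
    rw [← hF.mfderivWithin_mpullbackWithin EY i hx]
    rfl
  have e : transitionDeriv F G x (EX.frame x i) - EZ.frame (G.symm (F x)) i =
      (mfderiv (cornerModel d) (cornerModel d) G.symm (F x) (EY.frame (F x) i) -
      EZ.frame (G.symm (F x)) i) - transitionDeriv F G x (P - EX.frame x i) := by
    rw [← h3, map_sub]
    abel
  rw [e, add_comm]
  refine (enorm_sub_le (E := TangentSpace (cornerModel d) (G.symm (F x)))).trans
    (add_le_add h2 ?_)
  refine (ContinuousLinearMap.le_opENorm _ _).trans ?_
  gcongr
  exact enorm_transitionDeriv_le x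

/-- A crude bound for the exceptional sets, where the frames need not be close. The maxima with `1`
prepare for Young's inequality. -/
lemma enorm_transitionDeriv_frame_sub_le' (EX : FrameField d X)
    (EZ : FrameField d Z) {B : ℝ≥0∞} (hX : ∀ x i, ‖EX.frame x i‖ₑ ≤ B)
    (hZ : ∀ z i, ‖EZ.frame z i‖ₑ ≤ B) (x : X) (i : Fin d) :
    ‖transitionDeriv F G x (EX.frame x i) - EZ.frame (G.symm (F x)) i‖ₑ ≤
      (2 * B) * (max 1 ‖mfderiv (cornerModel d) (cornerModel d) G.symm (F x)‖ₑ *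
        max 1 ‖mfderivWithin (cornerModel d) (cornerModel d) F F.source x‖ₑ) := by
  set a := max 1 ‖mfderiv (cornerModel d) (cornerModel d) G.symm (F x)‖ₑ *
        max 1 ‖mfderivWithin (cornerModel d) (cornerModel d) F F.source x‖ₑ
  have ha : 1 ≤ a := one_le_mul (le_max_left _ _) (le_max_left _ _)
  have h1 : ‖transitionDeriv F G x (EX.frame x i)‖ₑ ≤ a * B := by
    refine (ContinuousLinearMap.le_opENorm _ _).trans (mul_le_mul' ?_ (hX x i))
    exact (enorm_transitionDeriv_le x).trans (mul_le_mul' (le_max_right _ _) (le_max_right _ _))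
  calc _ ≤ ‖transitionDeriv F G x (EX.frame x i)‖ₑ + ‖EZ.frame (G.symm (F x)) i‖ₑ :=
        enorm_sub_le (E := TangentSpace (cornerModel d) (G.symm (F x)))
    _ ≤ a * B + a * B := by
        refine add_le_add h1 ((hZ _ i).trans ?_)
        calc B = 1 * B := (one_mul B).symm
          _ ≤ a * B := by gcongr
    _ = _ := by ring

lemma FrameField.exists_enorm_le [CompactSpace X]
    [IsContMDiffRiemannianBundle (cornerModel d) ∞ (EuclideanSpace ℝ (Fin d))
      (fun x : X ↦ TangentSpace (cornerModel d) x)] (E : FrameField d X) :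
    ∃ B : ℝ≥0, ∀ x i, ‖E.frame x i‖ₑ ≤ B := by
  have h1 : ∀ i, ∃ B, ∀ x, ‖E.frame x i‖ ≤ B := fun i ↦ by
    have hc : Continuous fun x ↦ ‖E.frame x i‖ := by
      simpa using continuous_norm_sum_smul (ι := Unit) (fun _ ↦ (1 : ℝ))
        (fun _ ↦ E.continuous_section i)
    obtain ⟨B, hB⟩ := isCompact_univ.exists_bound_of_continuousOn hc.continuousOn
    exact ⟨B, fun y ↦ by simpa using hB y (mem_univ y)⟩
  choose B hB using h1
  refine ⟨∑ i, (B i).toNNReal, fun x i ↦ ?_⟩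
  have h2 : (B i).toNNReal ≤ ∑ i, (B i).toNNReal :=
    Finset.single_le_sum (f := fun i ↦ (B i).toNNReal) (fun _ _ ↦ zero_le) (Finset.mem_univ i)
  rw [← ofReal_norm]
  exact (ENNReal.ofReal_le_ofReal (hB i x)).trans (ENNReal.coe_le_coe.2 h2)

end Transition

/-! ### Convergence in mean of the transition differentials on frames -/

section TransitionLimit

variable {d : ℕ} {p : ℝ}
  {Ms : ℕ → Type*} [∀ n, EMetricSpace (Ms n)] [∀ n, CompactSpace (Ms n)] [∀ n, Nonempty (Ms n)]
  [∀ n, ChartedSpace (EuclideanQuadrant d) (Ms n)]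
  [∀ n, IsManifold (cornerModel d) ∞ (Ms n)]
  [∀ n, RiemannianBundle (fun x : Ms n ↦ TangentSpace (cornerModel d) x)]
  [∀ n, IsContMDiffRiemannianBundle (cornerModel d) ∞ (EuclideanSpace ℝ (Fin d))
    (fun x : Ms n ↦ TangentSpace (cornerModel d) x)]
  [∀ n, IsRiemannianManifold (cornerModel d) (Ms n)]
  [∀ n, MeasurableSpace (Ms n)] [∀ n, BorelSpace (Ms n)]
  {M : Type*} [EMetricSpace M] [CompactSpace M]
  [ChartedSpace (EuclideanQuadrant d) M] [IsManifold (cornerModel d) ∞ M]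
  [RiemannianBundle (fun x : M ↦ TangentSpace (cornerModel d) x)]
  [IsContMDiffRiemannianBundle (cornerModel d) ∞ (EuclideanSpace ℝ (Fin d))
    (fun x : M ↦ TangentSpace (cornerModel d) x)]
  [IsRiemannianManifold (cornerModel d) M]
  [MeasurableSpace M] [BorelSpace M]
  {N : Type*} [EMetricSpace N] [CompactSpace N]
  [ChartedSpace (EuclideanQuadrant d) N] [IsManifold (cornerModel d) ∞ N]
  [RiemannianBundle (fun x : N ↦ TangentSpace (cornerModel d) x)]
  [IsContMDiffRiemannianBundle (cornerModel d) ∞ (EuclideanSpace ℝ (Fin d))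
    (fun x : N ↦ TangentSpace (cornerModel d) x)]
  [IsRiemannianManifold (cornerModel d) N]
  [MeasurableSpace N] [BorelSpace N]
  {os : ∀ n, ManifoldOrientation d (Ms n)} {Es : ∀ n, FrameField d (Ms n)}
  {oM : ManifoldOrientation d M} {EM : FrameField d M} {F : ∀ n, PartialEquiv M (Ms n)}
  {oN : ManifoldOrientation d N} {EN : FrameField d N} {G : ∀ n, PartialEquiv N (Ms n)}

/-- Outside small sets, the differentials of the transition maps are almost contractions which
almost preserve the frames. -/
lemma exists_goodSets (hd : 1 ≤ d) (hF : ConvergesVia p os Es oM EM F)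
    (hG : ConvergesVia p os Es oN EN G) {ε : ℝ≥0} (hε : 0 < ε) (hε1 : ε ≤ 1) :
    ∃ S : ∀ n, Set (Ms n), (∀ n, MeasurableSet (S n)) ∧
      Tendsto (fun n ↦ riemVolume d (Ms n) (S n)) atTop (𝓝 0) ∧
      ∀ n, ∀ x ∈ (F n).symm '' (S n)ᶜ,
        ‖transitionDeriv (d := d) (F n) (G n) x‖ₑ ≤ (1 + ε) * (1 + ε) ∧
        ∀ i, ‖transitionDeriv (F n) (G n) x (EM.frame x i) -
          EN.frame ((G n).symm (F n x)) i‖ₑ ≤ 5 * ε := by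
  let S1 : ∀ n, Set (Ms n) := fun n ↦ {y | ((1 + ε : ℝ≥0) : ℝ≥0∞) <
      ‖mfderivWithin (cornerModel d) (cornerModel d) (F n) (F n).source ((F n).symm y)‖ₑ}
  let S2 : ∀ n, Set (Ms n) := fun n ↦ {y | ((1 + ε : ℝ≥0) : ℝ≥0∞) <
      ‖mfderiv (cornerModel d) (cornerModel d) (G n).symm y‖ₑ}
  let S3 : ∀ n, Set (Ms n) := fun n ↦ {y | (ε : ℝ≥0∞) <
      framePullbackDist (F n) (F n).source (Es n) EM ((F n).symm y)}
  let S4 : ∀ n, Set (Ms n) := fun n ↦ {y | (ε : ℝ≥0∞) <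
      framePullbackDist (G n) (G n).source (Es n) EN ((G n).symm y)}
  refine ⟨fun n ↦ (S1 n ∪ S2 n) ∪ (S3 n ∪ S4 n), fun n ↦ ?_, ?_, ?_⟩
  · refine (MeasurableSet.union ?_ ?_).union (MeasurableSet.union ?_ ?_)
    · exact ((hF.isDiffeoOnto n).isOpen_lt_enorm_mfderivWithin (Es n) (1 + ε)).measurableSet
    · exact (isOpen_lt_enorm_mfderiv (Es n) (hG.smooth_symm n) (1 + ε)).measurableSet
    · exact (isOpen_lt continuous_const
        (continuous_framePullbackDist_symm (hF.isDiffeoOnto n) (Es n) EM)).measurableSet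
    · exact (isOpen_lt continuous_const
        (continuous_framePullbackDist_symm (hG.isDiffeoOnto n) (Es n) EN)).measurableSet
  · have h := ((hF.tendsto_volume_lt_enorm_mfderivWithin hd hε).add
      (hG.tendsto_volume_lt_enorm_mfderiv_symm hd hε)).add
      ((hF.tendsto_volume_lt_framePullbackDist hd hε).add
      (hG.tendsto_volume_lt_framePullbackDist hd hε))
    simp only [add_zero] at h
    refine tendsto_of_tendsto_of_tendsto_of_le_of_le tendsto_const_nhds h (fun _ ↦ zero_le)
      fun n ↦ ?_
    refine (measure_union_le _ _).trans (add_le_add (measure_union_le _ _) (measure_union_le _ _))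
  · rintro n _ ⟨y, hy, rfl⟩
    simp only [mem_compl_iff, mem_union, not_or, S1, S2, S3, S4, mem_ofPred_eq, not_lt] at hy
    obtain ⟨⟨h1, h2⟩, h3, h4⟩ := hy
    rw [ENNReal.coe_add, ENNReal.coe_one] at h1 h2
    have hy : F n ((F n).symm y) = y := (hF.isDiffeoOnto n).apply_symm y
    rw [← hy] at h2 h4
    refine ⟨(enorm_transitionDeriv_le _).trans (mul_le_mul' h2 h1), fun i ↦ ?_⟩
    refine (enorm_transitionDeriv_frame_sub_le (hF.isDiffeoOnto n) (hG.isDiffeoOnto n) (Es n) EM EN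
      ((hF.isDiffeoOnto n).symm_mem y) i).trans ?_
    have hε2 : (ε : ℝ≥0∞) ≤ 1 := by exact_mod_cast hε1
    calc _ ≤ (1 + ε : ℝ≥0∞) * (1 + ε) * ε + ε :=
          add_le_add (mul_le_mul' (mul_le_mul' h2 h1) h3) h4
      _ ≤ (1 + 1) * (1 + 1) * ε + ε := by gcongr
      _ = 5 * ε := by ring

/-- The differentials of the transition maps preserve the frames in the limit, in `L¹`. -/
lemma tendsto_lintegral_transitionDeriv_frame_sub (hd : 1 ≤ d)
    (hF : ConvergesVia p os Es oM EM F) (hG : ConvergesVia p os Es oN EN G) :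
    Tendsto (fun n ↦ ∫⁻ x in (F n).source, ∑ i, ‖transitionDeriv (F n) (G n) x (EM.frame x i) -
      EN.frame ((G n).symm (F n x)) i‖ₑ ∂(riemVolume d M)) atTop (𝓝 0) := by
  obtain ⟨hp1, hdp, hpd⟩ := one_le_and_lt_and_le_of_pMin_le hd hF.le_exponent
  obtain ⟨B1, hB1⟩ := EM.exists_enorm_le
  obtain ⟨B2, hB2⟩ := EN.exists_enorm_le
  have hB1' : ∀ x i, ‖EM.frame x i‖ₑ ≤ (max B1 B2 : ℝ≥0) := fun x i ↦
    (hB1 x i).trans (ENNReal.coe_le_coe.2 (le_max_left _ _))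
  have hB2' : ∀ x i, ‖EN.frame x i‖ₑ ≤ (max B1 B2 : ℝ≥0) := fun x i ↦
    (hB2 x i).trans (ENNReal.coe_le_coe.2 (le_max_right _ _))
  have key : ∀ ε : ℝ≥0, 0 < ε → ε ≤ 1 → ∀ᶠ n in atTop,
      ∫⁻ x in (F n).source, ∑ i, ‖transitionDeriv (F n) (G n) x (EM.frame x i) -
      EN.frame ((G n).symm (F n x)) i‖ₑ ∂(riemVolume d M) ≤
        ε * (d * 5 * riemVolume d M univ + 1) := by
    intro ε hε hε1
    obtain ⟨S, hS, hSlim, hgood⟩ := exists_goodSets hd hF hG hε hε1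
    have hSlim' := hF.tendsto_volume_image_symm hd hS hSlim
    have h2 : (2 : ℝ≥0∞) ^ (p - 1) ≠ ⊤ := ENNReal.rpow_ne_top_of_nonneg (by linarith) (by simp)
    have t1 := ENNReal.Tendsto.const_mul (hSlim'.add hF.rigid) (Or.inr h2)
    have t2 := ENNReal.Tendsto.const_mul (hSlim.add hG.rigid_symm) (Or.inr h2)
    have t3 := ENNReal.Tendsto.const_mul (hSlim.add hF.rigid_symm) (Or.inr h2)
    have t4 := ENNReal.Tendsto.const_mul (t1.add (t2.add t3))
      (Or.inr (by finiteness : (d : ℝ≥0∞) * (2 * (max B1 B2 : ℝ≥0)) ≠ ⊤))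
    simp only [add_zero, mul_zero] at t4
    filter_upwards [t4.eventually_le_const (show (0 : ℝ≥0∞) < ε by exact_mod_cast hε)] with n hn
    -- On the good part the integrand is at most `5 * d * ε`. On the bad part it is bounded by the
    -- product of norms, whose integral is small because the volumes and the rigidity defects are.
    have hsrc : (F n).source = (F n).symm '' (S n)ᶜ ∪ (F n).symm '' S n := by
      rw [← image_union, compl_union_self, image_univ, (hF.isDiffeoOnto n).range_symm]
    have hemb := (hF.isDiffeoOnto n).measurableEmbedding_symm
    have b1 : ∫⁻ x in (F n).symm '' (S n)ᶜ, ∑ i, ‖transitionDeriv (F n) (G n) x (EM.frame x i) -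
        EN.frame ((G n).symm (F n x)) i‖ₑ ∂(riemVolume d M) ≤
          d * (5 * ε) * riemVolume d M univ := by
      refine (setLIntegral_mono' (g := fun _ ↦ (d : ℝ≥0∞) * (5 * ε)) (hemb.measurableSet_image.2 (hS n).compl)
        fun x hx ↦ (Finset.sum_le_sum fun i _ ↦ (hgood n x hx).2 i).trans_eq (by simp)).trans ?_
      rw [setLIntegral_const]
      gcongr
      exact subset_univ _
    have b2 : ∫⁻ x in (F n).symm '' S n, ∑ i, ‖transitionDeriv (F n) (G n) x (EM.frame x i) -
        EN.frame ((G n).symm (F n x)) i‖ₑ ∂(riemVolume d M) ≤ ε := by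
      refine (lintegral_mono (g := fun x ↦ (d : ℝ≥0∞) * (2 * (max B1 B2 : ℝ≥0)) *
        (max 1 ‖mfderiv (cornerModel d) (cornerModel d) (G n).symm (F n x)‖ₑ *
        max 1 ‖mfderivWithin (cornerModel d) (cornerModel d) (F n) (F n).source x‖ₑ))
        fun x ↦ (Finset.sum_le_sum fun i _ ↦
        enorm_transitionDeriv_frame_sub_le' EM EN hB1' hB2' x i).trans_eq (by
          rw [Finset.sum_const, Finset.card_univ, Fintype.card_fin, nsmul_eq_mul,
            ← mul_assoc])).trans ?_
      rw [lintegral_const_mul' _ _ (by finiteness)]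
      refine le_trans ?_ hn
      gcongr
      exact (hF.isDiffeoOnto n).setLIntegral_mul_le (hG.isDiffeoOnto n) (Es n) hp1 hdp hpd
        (fun x _ ↦ enorm_le_one_add_infEDist_SOset oM (os n) _ _ _)
        (fun y ↦ enorm_le_one_add_infEDist_SOset (os n) oM _ _ _)
        (fun y ↦ enorm_le_one_add_infEDist_SOset (os n) oN _ _ _) (hS n)
    rw [hsrc]
    refine (lintegral_union_le _ _ _).trans ((add_le_add b1 b2).trans_eq ?_)
    ring
  rw [ENNReal.tendsto_nhds_zero]
  intro η hη
  have hfin : d * 5 * riemVolume d M univ + 1 ≠ ⊤ := by finiteness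
  obtain ⟨ε, hε, hεη⟩ := ENNReal.exists_nnreal_pos_mul_lt hfin hη.ne'
  filter_upwards [key (min ε 1) (lt_min hε zero_lt_one) (min_le_right _ _)] with n hn
  refine hn.trans (le_trans ?_ hεη.le)
  gcongr
  exact min_le_left _ _

end TransitionLimit

/-! ### Frames in charts and the linear map from frame to frame -/

section FrameChart

variable {d : ℕ} {X : Type*} [EMetricSpace X] [ChartedSpace (EuclideanQuadrant d) X]
  [IsManifold (cornerModel d) ∞ X]

/-- The frame `E` read in the chart at `x₀`, as a linear map on coefficient vectors. -/
def FrameField.inChart (E : FrameField d X) (x₀ : X) (z : EuclideanSpace ℝ (Fin d)) :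
    EuclideanSpace ℝ (Fin d) →L[ℝ] EuclideanSpace ℝ (Fin d) :=
  ∑ i, (EuclideanSpace.proj i : EuclideanSpace ℝ (Fin d) →L[ℝ] ℝ).smulRight
    (dChart x₀ ((extChartAt (cornerModel d) x₀).symm z)
      (E.frame ((extChartAt (cornerModel d) x₀).symm z) i))

lemma FrameField.inChart_apply (E : FrameField d X) (x₀ : X) (z c : EuclideanSpace ℝ (Fin d)) :
    E.inChart x₀ z c = ∑ i, c i • dChart x₀ ((extChartAt (cornerModel d) x₀).symm z)
      (E.frame ((extChartAt (cornerModel d) x₀).symm z) i) := by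
  simp [FrameField.inChart]

/-- The differential of the chart is the fibre coordinate of the tangent bundle trivialization, in
which a smooth section has smooth coordinates. -/
lemma FrameField.contMDiffOn_dChart (E : FrameField d X) (x₀ : X) (i : Fin d) :
    ContMDiffOn (cornerModel d) 𝓘(ℝ, EuclideanSpace ℝ (Fin d)) ∞
      (fun x ↦ dChart x₀ x (E.frame x i)) (extChartAt (cornerModel d) x₀).source := by
  have h1 : IsOpen (extChartAt (cornerModel d) x₀).source := isOpen_extChartAt_source x₀
  have h2 := (Trivialization.contMDiffOn_section_iff (IB := cornerModel d) (n := ∞)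
    (F := EuclideanSpace ℝ (Fin d)) (E := fun x : X ↦ TangentSpace (cornerModel d) x)
    (s := fun x ↦ E.frame x i) (trivializationAt (EuclideanSpace ℝ (Fin d))
      (TangentSpace (cornerModel d)) x₀) h1 (by simp)).1 (E.smooth i).contMDiffOn
  refine h2.congr fun x hx ↦ ?_
  have hx' : x ∈ (chartAt (EuclideanQuadrant d) x₀).source := by simpa using hx
  have e : dChart (d := d) x₀ x = Trivialization.continuousLinearMapAt ℝ
      (trivializationAt (EuclideanSpace ℝ (Fin d)) (TangentSpace (cornerModel d)) x₀) x :=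
    (TangentBundle.continuousLinearMapAt_trivializationAt hx').symm
  rw [e, Trivialization.continuousLinearMapAt_apply, Trivialization.coe_linearMapAt_of_mem]
  simpa using hx

lemma FrameField.contDiffOn_inChart (E : FrameField d X) (x₀ : X) :
    ContDiffOn ℝ ∞ (E.inChart x₀) (extChartAt (cornerModel d) x₀).target := by
  have h : ∀ i, ContDiffOn ℝ ∞ (fun z ↦ dChart x₀ ((extChartAt (cornerModel d) x₀).symm z)
      (E.frame ((extChartAt (cornerModel d) x₀).symm z) i))
      (extChartAt (cornerModel d) x₀).target := fun i ↦
    contMDiffOn_iff_contDiffOn.1 ((E.contMDiffOn_dChart x₀ i).comp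
      (contMDiffOn_extChartAt_symm x₀) fun z hz ↦ (extChartAt (cornerModel d) x₀).map_target hz)
  refine ContDiffOn.sum fun i _ ↦ ?_
  exact contDiffOn_const.smulRight (h i)

lemma FrameField.isInvertible_inChart (E : FrameField d X) (x₀ : X) {z : EuclideanSpace ℝ (Fin d)}
    (hz : z ∈ (extChartAt (cornerModel d) x₀).target) : (E.inChart x₀ z).IsInvertible := by
  set x := (extChartAt (cornerModel d) x₀).symm z
  have hinj : Function.Injective (E.inChart x₀ z).toLinearMap := by
    rw [← LinearMap.ker_eq_bot, LinearMap.ker_eq_bot']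
    intro c hc
    have h1 : dChart x₀ x (∑ i, c i • E.frame x i) = 0 := by
      rw [map_sum]
      simp only [map_smul]
      rw [← E.inChart_apply x₀ z c]
      exact hc
    have h2 : ∑ i, c i • E.frame x i = 0 := by
      rw [← dChartSymm_dChart hz (∑ i, c i • E.frame x i), h1, map_zero]
    have h3 := Fintype.linearIndependent_iff.1 (E.frame x).linearIndependent _ h2
    ext i
    simpa using h3 i
  refine ⟨(LinearEquiv.ofInjectiveEndo (E.inChart x₀ z).toLinearMap
    hinj).toContinuousLinearEquiv, ?_⟩
  ext1 c
  rfl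

scoped instance instT2SpaceTangentSpace (x : X) : T2Space (TangentSpace (cornerModel d) x) :=
  inferInstanceAs (T2Space (EuclideanSpace ℝ (Fin d)))

/-- The linear map between tangent spaces which takes one frame to the other. -/
def frameMap {Y : Type*} [EMetricSpace Y] [ChartedSpace (EuclideanQuadrant d) Y]
    [IsManifold (cornerModel d) ∞ Y] (EX : FrameField d X) (EY : FrameField d Y) (x : X) (y : Y) :
    TangentSpace (cornerModel d) x →L[ℝ] TangentSpace (cornerModel d) y :=
  LinearMap.toContinuousLinearMap ((EX.frame x).constr ℝ (EY.frame y))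

lemma frameMap_frame {Y : Type*} [EMetricSpace Y] [ChartedSpace (EuclideanQuadrant d) Y]
    [IsManifold (cornerModel d) ∞ Y] (EX : FrameField d X) (EY : FrameField d Y) (x : X) (y : Y)
    (i : Fin d) : frameMap EX EY x y (EX.frame x i) = EY.frame y i :=
  (EX.frame x).constr_basis ℝ _ i

/-- In charts, the map which takes one frame to the other. -/
lemma dChart_comp_frameMap_comp_dChartSymm {Y : Type*} [EMetricSpace Y]
    [ChartedSpace (EuclideanQuadrant d) Y]
    [IsManifold (cornerModel d) ∞ Y] (EX : FrameField d X) (EY : FrameField d Y) {x₀ : X} {y₀ : Y}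
    {z : EuclideanSpace ℝ (Fin d)} (hz : z ∈ (extChartAt (cornerModel d) x₀).target) {y : Y}
    (hy : y ∈ (extChartAt (cornerModel d) y₀).source) :
    (dChart y₀ y).comp ((frameMap EX EY ((extChartAt (cornerModel d) x₀).symm z) y).comp
      (dChartSymm x₀ z)) =
      (EY.inChart y₀ (extChartAt (cornerModel d) y₀ y)).comp (EX.inChart x₀ z).inverse := by
  obtain ⟨A, hA⟩ := EX.isInvertible_inChart x₀ hz
  set x := (extChartAt (cornerModel d) x₀).symm z
  have key : ∀ c, dChart y₀ y (frameMap EX EY x y (dChartSymm x₀ z (EX.inChart x₀ z c))) =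
      EY.inChart y₀ (extChartAt (cornerModel d) y₀ y) c := by
    intro c
    have hcast : ∀ (y' : Y), y' = y → ∀ i, (dChart y₀ y' (EY.frame y' i)) =
        dChart y₀ y (EY.frame y i) := by
      rintro y' rfl i; rfl
    rw [EX.inChart_apply, EY.inChart_apply]
    simp only [map_sum, map_smul]
    refine Finset.sum_congr rfl fun i _ ↦ ?_
    rw [hcast _ ((extChartAt (cornerModel d) y₀).left_inv hy), dChartSymm_dChart hz,
      frameMap_frame]
  ext1 v
  have h1 : v = EX.inChart x₀ z ((EX.inChart x₀ z).inverse v) := by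
    rw [← hA]; simp
  conv_lhs => rw [h1]
  exact key _

end FrameChart

/-! ### Vector-valued limits of derivatives -/

section EuclideanVector

variable {E : Type*} [NormedAddCommGroup E] [NormedSpace ℝ E] [FiniteDimensional ℝ E]
  [MeasurableSpace E] [BorelSpace E] {μ : Measure E} [μ.IsAddHaarMeasure]

/-- Vector-valued version of `hasFDerivAt_of_tendsto`, with hypotheses for large `n` only. -/
lemma hasFDerivAt_of_tendsto_euclidean {m : ℕ} {U : Set E} (hU : IsOpen U) (hUf : μ U ≠ ⊤)
    {u : E → EuclideanSpace ℝ (Fin m)}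
    (hu : ContinuousOn u U) {T : E → E →L[ℝ] EuclideanSpace ℝ (Fin m)} (hT : ContinuousOn T U)
    {B C : ℝ≥0} (huB : ∀ x ∈ U, ‖u x‖ ≤ B) (hTC : ∀ x ∈ U, ‖T x‖ ≤ C)
    {A : ℕ → Set E} (hA : ∀ n, MeasurableSet (A n)) {K : ℕ → ℝ≥0}
    {w : ℕ → E → EuclideanSpace ℝ (Fin m)}
    (hwK : ∀ᶠ n in atTop, LipschitzOnWith (K n) (w n) (A n ∩ U))
    {T' : ℕ → E → E →L[ℝ] EuclideanSpace ℝ (Fin m)}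
    (hwT : ∀ᶠ n in atTop, ∀ x ∈ A n ∩ U, HasFDerivWithinAt (w n) (T' n x) (A n ∩ U) x)
    (huniq : ∀ n, ∀ x ∈ A n ∩ U, UniqueDiffWithinAt ℝ (A n ∩ U) x)
    (hlim : ∀ ε : ℝ≥0, 0 < ε → ∀ᶠ n in atTop, ∀ x ∈ A n ∩ U, ‖w n x - u x‖ ≤ ε)
    (hvol : Tendsto (fun n ↦ μ (U \ A n)) atTop (𝓝 0))
    (hvolK : Tendsto (fun n ↦ μ (U \ A n) * K n) atTop (𝓝 0))
    (hder : ∀ v, Tendsto (fun n ↦ ∫⁻ x in A n ∩ U, ‖T' n x v - T x v‖ₑ ∂μ) atTop (𝓝 0))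
    {x₀ : E} (hx₀ : x₀ ∈ U) : HasFDerivAt u (T x₀) x₀ := by
  -- The scalar theorem asks for its hypotheses at every index, so the sequence is shifted by `n₀`.
  -- Closeness to `u` up to `1` gives the uniform bound `B + 1`.
  obtain ⟨n₀, hn₀⟩ := eventually_atTop.1 (hwK.and (hwT.and (hlim 1 zero_lt_one)))
  rw [← hasFDerivWithinAt_univ, hasFDerivWithinAt_euclidean]
  intro j
  rw [hasFDerivWithinAt_univ]
  let ℓ : EuclideanSpace ℝ (Fin m) →L[ℝ] ℝ := EuclideanSpace.proj j
  have hℓ : ∀ y : EuclideanSpace ℝ (Fin m), ‖ℓ y‖ ≤ ‖y‖ := fun y ↦ PiLp.norm_apply_le y j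
  have hℓ' : LipschitzWith 1 ℓ := AddMonoidHomClass.lipschitz_of_bound_nnnorm ℓ 1 fun y ↦ by
    rw [one_mul]; exact hℓ y
  have hsh : Tendsto (fun n : ℕ ↦ n + n₀) atTop atTop := tendsto_add_atTop_nat n₀
  refine hasFDerivAt_of_tendsto hU hUf (u := fun x ↦ u x j) (T := fun x ↦ ℓ.comp (T x))
    (ℓ.continuous.comp_continuousOn hu) (continuousOn_const.clm_comp hT) (B := B + 1) (C := C)
    (fun x hx ↦ (hℓ _).trans ((huB x hx).trans (by simp))) (fun x hx ↦ ?_)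
    (A := fun n ↦ A (n + n₀)) (fun n ↦ hA _) (K := fun n ↦ K (n + n₀))
    (w := fun n x ↦ ℓ (w (n + n₀) x)) (fun n ↦ ?_) (fun n x hx ↦ ?_)
    (T' := fun n x ↦ ℓ.comp (T' (n + n₀) x)) (fun n x hx ↦ ?_) (fun n ↦ huniq _)
    (fun ε hε ↦ ?_) (hvol.comp hsh) (hvolK.comp hsh) (fun v ↦ ?_) hx₀
  · refine (ContinuousLinearMap.opNorm_le_bound _ C.2 fun v ↦ ?_)
    exact (hℓ _).trans (((T x).le_opNorm v).trans (by gcongr; exact hTC x hx))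
  · have h1 := hℓ'.comp_lipschitzOnWith (hn₀ (n + n₀) (Nat.le_add_left _ _)).1
    rwa [one_mul] at h1
  · have h1 := (hn₀ (n + n₀) (Nat.le_add_left _ _)).2.2 x hx
    refine (hℓ _).trans ?_
    calc ‖w (n + n₀) x‖ ≤ ‖u x‖ + ‖w (n + n₀) x - u x‖ := by
          simpa using norm_add_le (u x) (w (n + n₀) x - u x)
      _ ≤ B + 1 := add_le_add (huB x hx.2) h1
  · exact ℓ.hasFDerivAt.comp_hasFDerivWithinAt x ((hn₀ (n + n₀) (Nat.le_add_left _ _)).2.1 x hx)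
  · filter_upwards [hsh.eventually (hlim ε hε)] with n hn x hx
    exact (hℓ (w (n + n₀) x - u x)).trans (hn x hx)
  · refine tendsto_of_tendsto_of_tendsto_of_le_of_le tendsto_const_nhds ((hder v).comp hsh)
      (fun _ ↦ zero_le) fun n ↦ lintegral_mono fun x ↦ ?_
    have h1 := hℓ (T' (n + n₀) x v - T x v)
    rw [← ofReal_norm, ← ofReal_norm]
    exact ENNReal.ofReal_le_ofReal h1

end EuclideanVector

/-! ### Integrals of arbitrary functions in a chart -/

section ChartIntegral

variable {d : ℕ} {X : Type*} [EMetricSpace X] [ChartedSpace (EuclideanQuadrant d) X]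
  [IsManifold (cornerModel d) ∞ X]
  [RiemannianBundle (fun x : X ↦ TangentSpace (cornerModel d) x)]
  [IsContMDiffRiemannianBundle (cornerModel d) ∞ (EuclideanSpace ℝ (Fin d))
      (fun x : X ↦ TangentSpace (cornerModel d) x)]
  [MeasurableSpace X] [BorelSpace X]

/-- Version of `mul_setLIntegral_chart_le` for arbitrary functions. -/
lemma mul_setLIntegral_chart_le_of_not_measurable {x₀ : X} {U : Set (EuclideanSpace ℝ (Fin d))}
    (hU : MeasurableSet U) (hUt : U ⊆ (extChartAt (cornerModel d) x₀).target) {c : ℝ}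
    (hc : ∀ z ∈ U, c ≤ chartVolumeDensity d X x₀ z) (f : X → ℝ≥0∞) :
    ENNReal.ofReal c * ∫⁻ z in U, f ((extChartAt (cornerModel d) x₀).symm z) ≤
      ∫⁻ x, f x ∂(riemVolume d X) := by
  classical
  -- A measurable minorant with the same integral replaces the function. Transported back to `X`, it
  -- is still a minorant there.
  obtain ⟨g, hg, hgle, hgeq⟩ := exists_measurable_le_lintegral_eq (volume.restrict U)
    fun z ↦ f ((extChartAt (cornerModel d) x₀).symm z)
  set s := (extChartAt (cornerModel d) x₀).source with hs
  have hsm : MeasurableSet s := (isOpen_extChartAt_source x₀).measurableSet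
  have hφ : Measurable (s.piecewise (extChartAt (cornerModel d) x₀) fun _ ↦ 0) :=
    (continuousOn_extChartAt x₀).measurable_piecewise continuousOn_const hsm
  set f' : X → ℝ≥0∞ :=
    s.indicator (g ∘ s.piecewise (extChartAt (cornerModel d) x₀) fun _ ↦ 0) with hf'
  have hf'm : Measurable f' := (hg.comp hφ).indicator hsm
  have hf'x : ∀ x ∈ s, f' x = g (extChartAt (cornerModel d) x₀ x) := fun x hx ↦ by
    rw [hf', indicator_of_mem hx, Function.comp_apply, piecewise_eq_of_mem _ _ _ hx]
  rw [hgeq]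
  calc ENNReal.ofReal c * ∫⁻ z in U, g z
      = ENNReal.ofReal c * ∫⁻ z in U, f' ((extChartAt (cornerModel d) x₀).symm z) := by
        congr 1
        refine setLIntegral_congr_fun hU fun z hz ↦ ?_
        rw [hf'x _ ((extChartAt (cornerModel d) x₀).map_target (hUt hz)),
          (extChartAt (cornerModel d) x₀).right_inv (hUt hz)]
    _ ≤ ∫⁻ x, f' x ∂(riemVolume d X) := mul_setLIntegral_chart_le hU hUt hc hf'm
    _ ≤ _ := by
        refine lintegral_mono fun x ↦ ?_
        by_cases hx : x ∈ s
        · rw [hf'x x hx]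
          have := hgle (extChartAt (cornerModel d) x₀ x)
          simpa only [(extChartAt (cornerModel d) x₀).left_inv hx] using this
        · rw [hf', indicator_of_notMem hx]
          exact zero_le

end ChartIntegral

/-! ### Comparison in charts with the map from frame to frame -/

section PointwiseChart

variable {d : ℕ} {X : Type*} [EMetricSpace X] [ChartedSpace (EuclideanQuadrant d) X]
  [IsManifold (cornerModel d) ∞ X]
  [RiemannianBundle (fun x : X ↦ TangentSpace (cornerModel d) x)]
  {Y : Type*} [EMetricSpace Y] [ChartedSpace (EuclideanQuadrant d) Y]
  [IsManifold (cornerModel d) ∞ Y]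
  [RiemannianBundle (fun x : Y ↦ TangentSpace (cornerModel d) x)]

/-- Expanding `v` in the frame separates two errors: `L` against the map from frame to frame at `y`,
and the change of the target frame from `y` to `y'`. In the application, `y` is the value of a
transition map and `y'` that of the limit. -/
lemma norm_inCharts_sub_le (EX : FrameField d X) (EY : FrameField d Y) {x₀ : X} {y₀ : Y}
    {z : EuclideanSpace ℝ (Fin d)} (hz : z ∈ (extChartAt (cornerModel d) x₀).target) {y : Y} (y' : Y)
    (hy : y ∈ (extChartAt (cornerModel d) y₀).source)
    (L : TangentSpace (cornerModel d) ((extChartAt (cornerModel d) x₀).symm z) →L[ℝ]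
      TangentSpace (cornerModel d) y) (v : EuclideanSpace ℝ (Fin d)) :
    ‖(dChart y₀ y).comp (L.comp (dChartSymm x₀ z)) v -
        (EY.inChart y₀ (extChartAt (cornerModel d) y₀ y')).comp (EX.inChart x₀ z).inverse v‖ ≤
      ‖(EX.inChart x₀ z).inverse v‖ * (‖dChart (d := d) y₀ y‖ *
        ∑ i, ‖L (EX.frame ((extChartAt (cornerModel d) x₀).symm z) i) - EY.frame y i‖ +
        ‖EY.inChart y₀ (extChartAt (cornerModel d) y₀ y) -
          EY.inChart y₀ (extChartAt (cornerModel d) y₀ y')‖) := by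
  let x : X := (extChartAt (cornerModel d) x₀).symm z
  set c := (EX.inChart x₀ z).inverse v with hc
  obtain ⟨A, hA⟩ := EX.isInvertible_inChart x₀ hz
  have hv : dChartSymm x₀ z v = ∑ i, c i • EX.frame x i := by
    have h1 : v = EX.inChart x₀ z c := by rw [hc, ← hA]; simp
    rw [h1, EX.inChart_apply]
    simp only [map_sum, map_smul]
    exact Finset.sum_congr rfl fun i _ ↦ by rw [dChartSymm_dChart hz]
  have h2 : (EY.inChart y₀ (extChartAt (cornerModel d) y₀ y)) c =
      dChart y₀ y (frameMap EX EY x y (dChartSymm x₀ z v)) :=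
    congrArg (fun L ↦ L v) (dChart_comp_frameMap_comp_dChartSymm EX EY hz hy).symm
  have h3 : L (dChartSymm x₀ z v) - frameMap EX EY x y (dChartSymm x₀ z v) =
      ∑ i, c i • (L (EX.frame x i) - EY.frame y i) := by
    rw [hv]
    simp only [map_sum, map_smul, frameMap_frame, smul_sub, Finset.sum_sub_distrib]
  have e : (dChart y₀ y).comp (L.comp (dChartSymm x₀ z)) v -
        (EY.inChart y₀ (extChartAt (cornerModel d) y₀ y')).comp (EX.inChart x₀ z).inverse v =
      dChart y₀ y (∑ i, c i • (L (EX.frame x i) - EY.frame y i)) +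
      (EY.inChart y₀ (extChartAt (cornerModel d) y₀ y) -
          EY.inChart y₀ (extChartAt (cornerModel d) y₀ y')) c := by
    rw [← h3, map_sub, sub_apply, h2]
    simp only [ContinuousLinearMap.comp_apply]
    rw [← hc]
    abel
  rw [e]
  have h4 : ‖∑ i, c i • (L (EX.frame x i) - EY.frame y i)‖ ≤
      ‖c‖ * ∑ i, ‖L (EX.frame x i) - EY.frame y i‖ := by
    rw [Finset.mul_sum]
    refine (norm_sum_le _ _).trans (Finset.sum_le_sum fun i _ ↦ ?_)
    rw [norm_smul]
    gcongr
    exact PiLp.norm_apply_le c i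
  refine (norm_add_le _ _).trans ?_
  rw [mul_add]
  refine add_le_add ?_ ?_
  · refine ((dChart (d := d) y₀ y).le_opNorm _).trans ?_
    calc _ ≤ ‖dChart (d := d) y₀ y‖ * (‖c‖ * ∑ i, ‖L (EX.frame x i) - EY.frame y i‖) := by gcongr
      _ = _ := by ring
  · refine (ContinuousLinearMap.le_opNorm _ _).trans_eq (mul_comm _ _)

lemma enorm_inCharts_sub_le (EX : FrameField d X) (EY : FrameField d Y) {x₀ : X} {y₀ : Y}
    {z : EuclideanSpace ℝ (Fin d)} (hz : z ∈ (extChartAt (cornerModel d) x₀).target) {y : Y} (y' : Y)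
    (hy : y ∈ (extChartAt (cornerModel d) y₀).source)
    (L : TangentSpace (cornerModel d) ((extChartAt (cornerModel d) x₀).symm z) →L[ℝ]
      TangentSpace (cornerModel d) y) (v : EuclideanSpace ℝ (Fin d)) {κ C : ℝ} {η : ℝ≥0∞}
    (hκ : ‖(EX.inChart x₀ z).inverse v‖ ≤ κ) (hC : ‖dChart (d := d) y₀ y‖ ≤ C)
    (hη : edist (EY.inChart y₀ (extChartAt (cornerModel d) y₀ y))
      (EY.inChart y₀ (extChartAt (cornerModel d) y₀ y')) ≤ η) :
    ‖(dChart y₀ y).comp (L.comp (dChartSymm x₀ z)) v -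
        (EY.inChart y₀ (extChartAt (cornerModel d) y₀ y')).comp (EX.inChart x₀ z).inverse v‖ₑ ≤
      ENNReal.ofReal κ * (ENNReal.ofReal C *
        ∑ i, ‖L (EX.frame ((extChartAt (cornerModel d) x₀).symm z) i) - EY.frame y i‖ₑ + η) := by
  have gen : ∀ {x k l t : ℝ} {f : Fin d → ℝ}, x ≤ k * (l * ∑ i, f i + t) → 0 ≤ k → 0 ≤ l →
      (∀ i, 0 ≤ f i) → 0 ≤ t → k ≤ κ → l ≤ C → ENNReal.ofReal t ≤ η → ENNReal.ofReal x ≤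
        ENNReal.ofReal κ * (ENNReal.ofReal C * ∑ i, ENNReal.ofReal (f i) + η) := by
    intro x k l t f hx hk hl hf ht hkκ hlC htη
    refine (ENNReal.ofReal_le_ofReal hx).trans ?_
    rw [ENNReal.ofReal_mul hk, ENNReal.ofReal_add (mul_nonneg hl (Finset.sum_nonneg fun i _ ↦ hf i))
      ht, ENNReal.ofReal_mul hl, ENNReal.ofReal_sum_of_nonneg fun i _ ↦ hf i]
    gcongr
  have hη' : ENNReal.ofReal ‖EY.inChart y₀ (extChartAt (cornerModel d) y₀ y) -
      EY.inChart y₀ (extChartAt (cornerModel d) y₀ y')‖ ≤ η := by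
    rwa [ofReal_norm, ← edist_eq_enorm_sub]
  have h1 := gen (norm_inCharts_sub_le EX EY hz y' hy L v) (norm_nonneg _)
    (ContinuousLinearMap.opNorm_nonneg _)
    (fun i ↦ norm_nonneg _) (norm_nonneg _) hκ hC hη'
  simp only [ofReal_norm] at h1
  exact h1

lemma FrameField.continuousOn_inverse_inChart (E : FrameField d X) (x₀ : X) :
    ContinuousOn (fun z ↦ (E.inChart x₀ z).inverse) (extChartAt (cornerModel d) x₀).target := by
  intro z hz
  obtain ⟨A, hA⟩ := E.isInvertible_inChart x₀ hz
  have h1 : ContinuousAt ContinuousLinearMap.inverse (E.inChart x₀ z) := by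
    rw [← hA]
    exact (contDiffAt_map_inverse (n := 0) A).continuousAt
  exact h1.comp_continuousWithinAt ((E.contDiffOn_inChart x₀).continuousOn z hz)

end PointwiseChart

/-! ### Differentiability of the limit under a volume condition -/

section LimitDerivative

variable {d : ℕ} {p : ℝ}
  {Ms : ℕ → Type*} [∀ n, EMetricSpace (Ms n)] [∀ n, CompactSpace (Ms n)] [∀ n, Nonempty (Ms n)]
  [∀ n, ChartedSpace (EuclideanQuadrant d) (Ms n)]
  [∀ n, IsManifold (cornerModel d) ∞ (Ms n)]
  [∀ n, RiemannianBundle (fun x : Ms n ↦ TangentSpace (cornerModel d) x)]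
  [∀ n, IsContMDiffRiemannianBundle (cornerModel d) ∞ (EuclideanSpace ℝ (Fin d))
    (fun x : Ms n ↦ TangentSpace (cornerModel d) x)]
  [∀ n, IsRiemannianManifold (cornerModel d) (Ms n)]
  [∀ n, MeasurableSpace (Ms n)] [∀ n, BorelSpace (Ms n)]
  {M : Type*} [EMetricSpace M] [CompactSpace M]
  [ChartedSpace (EuclideanQuadrant d) M] [IsManifold (cornerModel d) ∞ M]
  [RiemannianBundle (fun x : M ↦ TangentSpace (cornerModel d) x)]
  [IsContMDiffRiemannianBundle (cornerModel d) ∞ (EuclideanSpace ℝ (Fin d))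
    (fun x : M ↦ TangentSpace (cornerModel d) x)]
  [IsRiemannianManifold (cornerModel d) M]
  [MeasurableSpace M] [BorelSpace M]
  {N : Type*} [EMetricSpace N] [CompactSpace N]
  [ChartedSpace (EuclideanQuadrant d) N] [IsManifold (cornerModel d) ∞ N]
  [RiemannianBundle (fun x : N ↦ TangentSpace (cornerModel d) x)]
  [IsContMDiffRiemannianBundle (cornerModel d) ∞ (EuclideanSpace ℝ (Fin d))
    (fun x : N ↦ TangentSpace (cornerModel d) x)]
  [IsRiemannianManifold (cornerModel d) N]
  [MeasurableSpace N] [BorelSpace N]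
  {os : ∀ n, ManifoldOrientation d (Ms n)} {Es : ∀ n, FrameField d (Ms n)}
  {oM : ManifoldOrientation d M} {EM : FrameField d M} {F : ∀ n, PartialEquiv M (Ms n)}
  {oN : ManifoldOrientation d N} {EN : FrameField d N} {G : ∀ n, PartialEquiv N (Ms n)}

set_option maxHeartbeats 800000 in
/-- The limit of the transition maps is differentiable, with differential taking frame to frame,
provided that the domains are large compared to the Lipschitz constants. -/
lemma hasMFDerivAt_limit (hd : 1 ≤ d) (hF : ConvergesVia p os Es oM EM F)
    (hG : ConvergesVia p os Es oN EN G) {H : M → N} (hH : IsUniformLimitAlong F G id H)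
    (hL : Tendsto (fun n ↦ riemVolume d M (F n).sourceᶜ *
      (lipConst (F n) (F n).source * lipConst (G n).symm univ)) atTop (𝓝 0)) (x₀ : M) :
    HasMFDerivAt (cornerModel d) (cornerModel d) H x₀ (frameMap EM EN x₀ (H x₀)) := by
  set y₀ := H x₀ with hy₀
  set z₀ := extChartAt (cornerModel d) x₀ x₀ with hz₀
  -- a neighbourhood of `y₀` in which the chart is controlled
  obtain ⟨C₂, V, hV, hVs, hVC⟩ := exists_nhds_edist_chart_le (d := d) y₀
  obtain ⟨C₃, hC₃, hdC⟩ := eventually_norm_dChart_lt (d := d) y₀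
  obtain ⟨δ, hδ, hδV⟩ := Metric.nhds_basis_closedEBall.mem_iff.1 (inter_mem hV hdC)
  have hδs : Metric.closedEBall y₀ δ ⊆ (extChartAt (cornerModel d) y₀).source :=
    fun y hy ↦ hVs (hδV hy).1
  have hK : IsCompact (Metric.closedEBall y₀ δ) := Metric.isClosed_closedEBall.isCompact
  have hunif : UniformContinuousOn
      (fun y ↦ EN.inChart y₀ (extChartAt (cornerModel d) y₀ y)) (Metric.closedEBall y₀ δ) := by
    refine hK.uniformContinuousOn_of_continuous ?_
    refine (EN.contDiffOn_inChart y₀).continuousOn.comp ((continuousOn_extChartAt y₀).mono hδs) ?_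
    exact fun y hy ↦ (extChartAt (cornerModel d) y₀).map_source (hδs hy)
  -- a neighbourhood of `z₀` in which everything is controlled
  let u : EuclideanSpace ℝ (Fin d) → EuclideanSpace ℝ (Fin d) := fun z ↦
    extChartAt (cornerModel d) y₀ (H ((extChartAt (cornerModel d) x₀).symm z))
  let T : EuclideanSpace ℝ (Fin d) → EuclideanSpace ℝ (Fin d) →L[ℝ] EuclideanSpace ℝ (Fin d) :=
    fun z ↦ (EN.inChart y₀ (u z)).comp (EM.inChart x₀ z).inverse
  let D : Set (EuclideanSpace ℝ (Fin d)) := (extChartAt (cornerModel d) x₀).target ∩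
    (fun z ↦ H ((extChartAt (cornerModel d) x₀).symm z)) ⁻¹'
      (extChartAt (cornerModel d) y₀).source
  have hcH : ContinuousOn (fun z ↦ H ((extChartAt (cornerModel d) x₀).symm z))
      (extChartAt (cornerModel d) x₀).target :=
    hH.1.comp_continuousOn (continuousOn_extChartAt_symm x₀)
  have hu : ContinuousOn u D := (continuousOn_extChartAt y₀).comp (hcH.mono inter_subset_left)
    fun z hz ↦ hz.2
  have hT : ContinuousOn T D := by
    refine ContinuousOn.clm_comp ?_ ((EM.continuousOn_inverse_inChart x₀).mono inter_subset_left)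
    exact (EN.contDiffOn_inChart y₀).continuousOn.comp hu
      fun z hz ↦ (extChartAt (cornerModel d) y₀).map_source hz.2
  have hz₀t : z₀ ∈ (extChartAt (cornerModel d) x₀).target := mem_extChartAt_target x₀
  have hHz₀ : H ((extChartAt (cornerModel d) x₀).symm z₀) = y₀ := by
    rw [hz₀, extChartAt_to_inv]
  have hz₀D : z₀ ∈ D := ⟨hz₀t, by
    change H ((extChartAt (cornerModel d) x₀).symm z₀) ∈ (extChartAt (cornerModel d) y₀).source
    rw [hHz₀]; exact mem_extChartAt_source y₀⟩
  have htn : (extChartAt (cornerModel d) x₀).target ∈ 𝓝[range (cornerModel d)] z₀ :=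
    extChartAt_target_mem_nhdsWithin x₀
  have hballn : ∀ᶠ z in 𝓝[range (cornerModel d)] z₀,
      H ((extChartAt (cornerModel d) x₀).symm z) ∈ Metric.closedEBall y₀ (δ / 2) := by
    have h1 := (hcH z₀ hz₀t).mono_of_mem_nhdsWithin htn
    refine h1.preimage_mem_nhdsWithin ?_
    rw [hHz₀]
    exact Metric.closedEBall_mem_nhds _ (ENNReal.half_pos hδ.ne')
  have hDn : D ∈ 𝓝[range (cornerModel d)] z₀ := by
    filter_upwards [htn, hballn] with z h1 h2
    exact ⟨h1, hδs (Metric.closedEBall_subset_closedEBall ENNReal.half_le_self h2)⟩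
  have hbd : ∀ {W : Type} [SeminormedAddCommGroup W] (f : EuclideanSpace ℝ (Fin d) → W),
      ContinuousOn f D → ∀ᶠ z in 𝓝[range (cornerModel d)] z₀, ‖f z‖ < ‖f z₀‖ + 1 := by
    intro W _ f hf
    have h1 := ((hf z₀ hz₀D).mono_of_mem_nhdsWithin hDn).norm
    exact h1.eventually_lt_const (by linarith)
  obtain ⟨c₀, hc₀, _, _, r₁, hr₁, hball₁⟩ := exists_ball_chartVolumeDensity_bounds (d := d) x₀
  obtain ⟨C₁, r₂, hr₂, hball₂, hC₁⟩ := exists_ball_edist_symm_le (d := d) x₀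
  obtain ⟨r₃, hr₃, hball₃⟩ := Metric.mem_nhdsWithin_iff.1 (inter_mem hDn (inter_mem hballn
    (inter_mem (hbd u hu) (inter_mem (hbd T hT) (hbd _
      ((EM.continuousOn_inverse_inChart x₀).mono inter_subset_left))))))
  set r := min r₁ (min r₂ r₃) with hr
  have hr0 : 0 < r := lt_min hr₁ (lt_min hr₂ hr₃)
  -- The theorem on weak derivatives needs an open set, so corners and boundary are left out until
  -- the end.
  set U := Metric.ball z₀ r ∩ interior (range (cornerModel d)) with hU
  have hUo : IsOpen U := Metric.isOpen_ball.inter isOpen_interior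
  have hUr : ∀ z ∈ U, z ∈ range (cornerModel d) := fun z hz ↦ interior_subset hz.2
  have hU₁ : ∀ z ∈ U, z ∈ (extChartAt (cornerModel d) x₀).target ∧
      c₀ ≤ chartVolumeDensity d M x₀ z := fun z hz ↦ by
    have := hball₁ ⟨Metric.ball_subset_ball (min_le_left _ _) hz.1, hUr z hz⟩
    exact ⟨this.1, this.2.1.le⟩
  have hU₂ : ∀ z ∈ U, z ∈ Metric.ball z₀ r₂ ∩ range (cornerModel d) := fun z hz ↦
    ⟨Metric.ball_subset_ball ((min_le_right _ _).trans (min_le_left _ _)) hz.1, hUr z hz⟩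
  have hU₃ := fun z (hz : z ∈ Metric.ball z₀ r ∩ range (cornerModel d)) ↦ hball₃
    ⟨Metric.ball_subset_ball ((min_le_right _ _).trans (min_le_right _ _)) hz.1, hz.2⟩
  have hUfin : volume U ≠ ⊤ :=
    ((measure_mono inter_subset_left).trans_lt measure_ball_lt_top).ne
  let A : ℕ → Set (EuclideanSpace ℝ (Fin d)) := fun n ↦ (extChartAt (cornerModel d) x₀).target ∩
    (extChartAt (cornerModel d) x₀).symm ⁻¹' (F n).source
  have hsm : ∀ n, MeasurableSet (F n).source := fun n ↦
    (hF.isDiffeoOnto n).isCompact_source.measurableSet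
  have hA : ∀ n, MeasurableSet (A n) := fun n ↦ measurableSet_inter_preimage_of_continuousOn
    (continuousOn_extChartAt_symm x₀) (measurableSet_extChartAt_target x₀) (hsm n)
  have hclose : ∀ ε : ℝ≥0∞, 0 < ε → ∀ᶠ n in atTop, ∀ x ∈ (F n).source,
      edist ((G n).symm (F n x)) (H x) ≤ ε := by
    intro ε hε
    filter_upwards [ENNReal.tendsto_nhds_zero.1 hH.2 ε hε] with n hn x hx
    exact le_trans (le_iSup₂_of_le (f := fun x (_ : x ∈ (F (id n)).source) ↦
      edist ((G (id n)).symm (F (id n) x)) (H x)) x hx le_rfl) hn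
  have hHU : ∀ z ∈ U, H ((extChartAt (cornerModel d) x₀).symm z) ∈
      Metric.closedEBall y₀ (δ / 2) := fun z hz ↦ (hU₃ z ⟨hz.1, hUr z hz⟩).2.1
  have hHU' : ∀ z ∈ U, H ((extChartAt (cornerModel d) x₀).symm z) ∈
      Metric.closedEBall y₀ δ := fun z hz ↦
    Metric.closedEBall_subset_closedEBall ENNReal.half_le_self (hHU z hz)
  have hmem : ∀ᶠ n in atTop, ∀ z ∈ A n ∩ U,
      (G n).symm (F n ((extChartAt (cornerModel d) x₀).symm z)) ∈ Metric.closedEBall y₀ δ := by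
    filter_upwards [hclose (δ / 2) (ENNReal.half_pos hδ.ne')] with n hn z hz
    calc _ ≤ _ := edist_triangle _ (H ((extChartAt (cornerModel d) x₀).symm z)) _
      _ ≤ δ / 2 + δ / 2 := add_le_add (hn _ hz.1.2) (hHU z hz.2)
      _ = δ := ENNReal.add_halves δ
  have hc₀' : ENNReal.ofReal c₀ ≠ 0 := by simpa using hc₀
  have hvolle : ∀ n, volume (U \ A n) ≤
      (riemVolume d M (F n).sourceᶜ) / ENNReal.ofReal c₀ := by
    intro n
    rw [ENNReal.le_div_iff_mul_le (Or.inl hc₀') (Or.inl ENNReal.ofReal_ne_top), mul_comm]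
    have h1 := mul_setLIntegral_chart_le (d := d) (x₀ := x₀) (hUo.measurableSet.diff (hA n))
      (fun z hz ↦ (hU₁ z hz.1).1) (fun z hz ↦ (hU₁ z hz.1).2)
      (f := (F n).sourceᶜ.indicator fun _ ↦ 1) (measurable_const.indicator (hsm n).compl)
    rw [lintegral_indicator_const (hsm n).compl, one_mul] at h1
    refine le_trans (le_of_eq ?_) h1
    congr 1
    rw [← setLIntegral_one]
    refine setLIntegral_congr_fun (hUo.measurableSet.diff (hA n)) fun z hz ↦ ?_
    have hzs : (extChartAt (cornerModel d) x₀).symm z ∈ (F n).sourceᶜ :=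
      fun h ↦ hz.2 ⟨(hU₁ z hz.1).1, h⟩
    rw [indicator_of_mem hzs]
  have hderU : ∀ z ∈ U, HasFDerivAt u (T z) z := by
    intro z hz
    let w : ℕ → EuclideanSpace ℝ (Fin d) → EuclideanSpace ℝ (Fin d) := fun n z ↦
      extChartAt (cornerModel d) y₀ ((G n).symm (F n ((extChartAt (cornerModel d) x₀).symm z)))
    let T' : ℕ → EuclideanSpace ℝ (Fin d) →
        EuclideanSpace ℝ (Fin d) →L[ℝ] EuclideanSpace ℝ (Fin d) := fun n z ↦
      (dChart y₀ ((G n).symm (F n ((extChartAt (cornerModel d) x₀).symm z)))).comp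
        ((transitionDeriv (F n) (G n) ((extChartAt (cornerModel d) x₀).symm z)).comp
          (dChartSymm x₀ z))
    -- The Lipschitz constant `K` comes from the chain chart, `(G n).symm`, `F n`, inverse chart. As
    -- `toNNReal` sends `∞` to `0`, it is valid only once `lipConst (F n)` is finite, that is, for
    -- large `n`.
    refine hasFDerivAt_of_tendsto_euclidean (μ := volume) hUo hUfin (u := u)
      (hu.mono fun z hz ↦ (hU₃ z ⟨hz.1, hUr z hz⟩).1) (T := T)
      (hT.mono fun z hz ↦ (hU₃ z ⟨hz.1, hUr z hz⟩).1) (B := ‖u z₀‖₊ + 1) (C := ‖T z₀‖₊ + 1)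
      (fun z hz ↦ (hU₃ z ⟨hz.1, hUr z hz⟩).2.2.1.le)
      (fun z hz ↦ (hU₃ z ⟨hz.1, hUr z hz⟩).2.2.2.1.le) (A := A) hA
      (K := fun n ↦ C₂ * ((lipConst (G n).symm univ).toNNReal *
        ((lipConst (F n) (F n).source).toNNReal * C₁))) (w := w) ?_ (T' := T') ?_ ?_ ?_ ?_ ?_ ?_ hz
    · filter_upwards [hF.eventually_lipConst_ne_top, hmem] with n hn hnm a ha b hb
      have hGt : lipConst (G n).symm univ ≠ ⊤ := lipConst_ne_top (Es n) (hG.smooth_symm n) _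
      have e1 := hVC _ (hδV (hnm a ha)).1 _ (hδV (hnm b hb)).1
      have e4 := hC₁ a (hU₂ a ha.2) b (hU₂ b hb.2)
      have f4 : edist ((extChartAt (cornerModel d) x₀).symm a)
          ((extChartAt (cornerModel d) x₀).symm b) ≠ ⊤ :=
        ne_top_of_le_ne_top (ENNReal.mul_ne_top ENNReal.coe_ne_top (edist_ne_top _ _)) e4
      have e3 := edist_le_lipConst_mul (f := F n) (s := (F n).source) ha.1.2 hb.1.2 f4
      have e2 := edist_le_lipConst_mul (f := (G n).symm) (mem_univ _) (mem_univ _)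
        (ne_top_of_le_ne_top (ENNReal.mul_ne_top hn f4) e3)
      rw [ENNReal.coe_mul, ENNReal.coe_mul, ENNReal.coe_mul, ENNReal.coe_toNNReal hn,
        ENNReal.coe_toNNReal hGt, mul_assoc, mul_assoc, mul_assoc]
      refine e1.trans ?_
      gcongr
      refine e2.trans ?_
      gcongr
      refine e3.trans ?_
      gcongr
    · filter_upwards [hmem] with n hn z hz
      exact (hasFDerivWithinAt_writtenInCharts hz.1.1 (hδs (hn z hz))
        (hasMFDerivWithinAt_transition (hF.isDiffeoOnto n) (hG.isDiffeoOnto n) hz.1.2)).mono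
        inter_subset_left
    · intro n z hz
      exact ((hF.isDiffeoOnto n).uniqueMDiffOn_source.uniqueDiffOn_target_inter x₀ z hz.1).inter
        (hUo.mem_nhds hz.2)
    · intro ε hε
      have hlt : (0 : ℝ≥0∞) < ε / (C₂ + 1) := ENNReal.div_pos (by simpa using hε.ne') (by finiteness)
      filter_upwards [hmem, hclose _ hlt] with n hnm hn z hz
      have e1 := hVC _ (hδV (hnm z hz)).1 _ (hδV (hHU' z hz.2)).1
      have e2 : edist (w n z) (u z) ≤ ε := by
        refine e1.trans ((mul_le_mul' (le_self_add (b := 1)) (hn _ hz.1.2)).trans ?_)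
        exact ENNReal.mul_div_le
      rw [edist_eq_enorm_sub, ← ofReal_norm, ← ENNReal.ofReal_coe_nnreal] at e2
      exact (ENNReal.ofReal_le_ofReal_iff ε.2).1 e2
    · have h1 := ENNReal.Tendsto.div_const (hF.tendsto_volume_compl hd) (Or.inr hc₀')
      rw [ENNReal.zero_div] at h1
      exact tendsto_of_tendsto_of_tendsto_of_le_of_le tendsto_const_nhds h1 (fun _ ↦ zero_le) hvolle
    · have h1 := ENNReal.Tendsto.mul_const (b := (C₁ * C₂ : ℝ≥0∞))
        (ENNReal.Tendsto.div_const hL (Or.inr hc₀')) (Or.inr (by finiteness))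
      rw [ENNReal.zero_div, zero_mul] at h1
      refine tendsto_of_tendsto_of_tendsto_of_le_of_le tendsto_const_nhds h1 (fun _ ↦ zero_le)
        fun n ↦ ?_
      calc volume (U \ A n) * (C₂ * ((lipConst (G n).symm univ).toNNReal *
            ((lipConst (F n) (F n).source).toNNReal * C₁)) : ℝ≥0)
          ≤ (riemVolume d M (F n).sourceᶜ) / ENNReal.ofReal c₀ *
            (C₂ * (lipConst (G n).symm univ * (lipConst (F n) (F n).source * C₁))) := by
            rw [ENNReal.coe_mul, ENNReal.coe_mul, ENNReal.coe_mul]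
            gcongr
            · exact hvolle n
            · exact ENNReal.coe_toNNReal_le_self
            · exact ENNReal.coe_toNNReal_le_self
        _ = _ := by rw [div_eq_mul_inv, div_eq_mul_inv]; ring
    · intro v
      let S : ℕ → M → ℝ≥0∞ := fun n x ↦ ∑ i, ‖transitionDeriv (F n) (G n) x (EM.frame x i) -
        EN.frame ((G n).symm (F n x)) i‖ₑ
      set κ : ℝ := ‖(EM.inChart x₀ z₀).inverse‖ + 1
      set a : ℝ≥0∞ := ENNReal.ofReal (κ * ‖v‖)
      set b : ℝ≥0∞ := ENNReal.ofReal C₃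
      -- One contribution is the `L¹` error of the frames. The other is the change of the frame of
      -- `N` between the transition map and its limit, small by uniform continuity.
      have key : ∀ η : ℝ≥0, 0 < η → ∀ᶠ n in atTop, ∫⁻ z in A n ∩ U, ‖T' n z v - T z v‖ₑ ≤
          η * (a * (b + volume U)) := by
        intro η hη
        obtain ⟨θ, hθ, hθ'⟩ := EMetric.uniformContinuousOn_iff.1 hunif η (by simpa using hη)
        have tI := ENNReal.Tendsto.div_const
          (tendsto_lintegral_transitionDeriv_frame_sub hd hF hG) (Or.inr hc₀')
        rw [ENNReal.zero_div] at tI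
        have hlt : ∃ θ₁, 0 < θ₁ ∧ θ₁ < θ := exists_between hθ
        obtain ⟨θ₁, hθ₁, hθ₁'⟩ := hlt
        filter_upwards [hmem, hclose θ₁ hθ₁,
          tI.eventually_le_const (show (0 : ℝ≥0∞) < η by simpa using hη)] with n hnm hnc hnI
        have hAU : MeasurableSet (A n ∩ U) := (hA n).inter hUo.measurableSet
        have hpt : ∀ z ∈ A n ∩ U, ‖T' n z v - T z v‖ₑ ≤
            a * (b * S n ((extChartAt (cornerModel d) x₀).symm z) + η) := by
          intro z hz
          refine enorm_inCharts_sub_le EM EN hz.1.1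
            (H ((extChartAt (cornerModel d) x₀).symm z)) (hδs (hnm z hz))
            (transitionDeriv (F n) (G n) ((extChartAt (cornerModel d) x₀).symm z)) v ?_
            (hδV (hnm z hz)).2.le
            (hθ' (hnm z hz) (hHU' z hz.2) ((hnc _ hz.1.2).trans_lt hθ₁')).le
          refine (ContinuousLinearMap.le_opNorm _ _).trans ?_
          gcongr
          exact (hU₃ z ⟨hz.2.1, hUr z hz.2⟩).2.2.2.2.le
        have hS : ∫⁻ z in A n ∩ U, S n ((extChartAt (cornerModel d) x₀).symm z) ≤ η := by
          refine le_trans ?_ hnI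
          rw [ENNReal.le_div_iff_mul_le (Or.inl hc₀') (Or.inl ENNReal.ofReal_ne_top), mul_comm]
          have h1 := mul_setLIntegral_chart_le_of_not_measurable (d := d) (x₀ := x₀) hAU
            (fun z hz ↦ hz.1.1) (fun z hz ↦ (hU₁ z hz.2).2) ((F n).source.indicator (S n))
          rw [lintegral_indicator (hsm n)] at h1
          refine le_trans (le_of_eq ?_) h1
          congr 1
          refine setLIntegral_congr_fun hAU fun z hz ↦ ?_
          exact (indicator_of_mem (s := (F n).source) hz.1.2 (S n)).symm
        calc ∫⁻ z in A n ∩ U, ‖T' n z v - T z v‖ₑ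
            ≤ ∫⁻ z in A n ∩ U, a * (b * S n ((extChartAt (cornerModel d) x₀).symm z) + η) :=
              setLIntegral_mono' hAU hpt
          _ = a * (b * (∫⁻ z in A n ∩ U, S n ((extChartAt (cornerModel d) x₀).symm z)) +
                η * volume (A n ∩ U)) := by
              rw [lintegral_const_mul' _ _ ENNReal.ofReal_ne_top,
                lintegral_add_right _ measurable_const,
                lintegral_const_mul' _ _ ENNReal.ofReal_ne_top, setLIntegral_const]
          _ ≤ a * (b * η + η * volume U) := by
              gcongr
              exact inter_subset_right
          _ = η * (a * (b + volume U)) := by ring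
      rw [ENNReal.tendsto_nhds_zero]
      intro ε hε
      have hfin : a * (b + volume U) ≠ ⊤ := by finiteness
      obtain ⟨η, hη, hηε⟩ := ENNReal.exists_nnreal_pos_mul_lt hfin hε.ne'
      filter_upwards [key η hη] with n hn using hn.trans hηε.le
  have hfd : HasFDerivWithinAt u (T z₀) (range (cornerModel d)) z₀ := by
    -- The derivative extends continuously from the open convex set `s` to its closure, which is a
    -- neighbourhood of `z₀` in the quadrant. So `u` is differentiable at `z₀` within the quadrant,
    -- even at a corner.
    set s := Metric.ball z₀ (r / 2) ∩ interior (range (cornerModel d)) with hs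
    have hsU : s ⊆ U := inter_subset_inter_left _ (Metric.ball_subset_ball (by linarith))
    have hsD : s ⊆ D := fun z hz ↦ (hU₃ z ⟨(hsU hz).1, hUr z (hsU hz)⟩).1
    have hso : IsOpen s := Metric.isOpen_ball.inter isOpen_interior
    have hcl : closure s ⊆ Metric.ball z₀ r ∩ range (cornerModel d) := by
      refine (closure_inter_subset_inter_closure _ _).trans (inter_subset_inter ?_ ?_)
      · exact Metric.closure_ball_subset_closedBall.trans
          (Metric.closedBall_subset_ball (by linarith))
      · exact (closure_mono interior_subset).trans (cornerModel d).isClosed_range.closure_subset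
    have h1 : HasFDerivWithinAt u (T z₀) (closure s) z₀ := by
      refine hasFDerivWithinAt_closure_of_tendsto_fderiv
        (fun z hz ↦ (hderU z (hsU hz)).differentiableAt.differentiableWithinAt)
        ((convex_ball _ _).inter (cornerModel d).convex_range.interior) hso
        (fun z hz ↦ (hu z (hU₃ z (hcl hz)).1).mono hsD) ?_
      refine ((hT z₀ hz₀D).mono hsD).tendsto.congr' ?_
      filter_upwards [self_mem_nhdsWithin] with z hz
      exact (hderU z (hsU hz)).fderiv.symm
    refine h1.mono_of_mem_nhdsWithin ?_
    refine mem_of_superset (inter_mem (mem_nhdsWithin_of_mem_nhds (Metric.ball_mem_nhds z₀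
      (half_pos hr0))) self_mem_nhdsWithin) ?_
    refine (inter_subset_inter_right _ (cornerModel d).range_subset_closure_interior).trans ?_
    exact Metric.isOpen_ball.inter_closure
  -- At their centres both charts have the identity as differential, so the expression in charts is
  -- the map from frame to frame itself.
  have hTz : ∀ v : EuclideanSpace ℝ (Fin d), T z₀ v = frameMap EM EN x₀ y₀ v := by
    intro v
    have hcast : ∀ x', x' = x₀ →
        (frameMap EM EN x' y₀ v : EuclideanSpace ℝ (Fin d)) = frameMap EM EN x₀ y₀ v := by
      rintro x' rfl; rfl
    have h1 := congrArg (fun L ↦ L v) (dChart_comp_frameMap_comp_dChartSymm EM EN hz₀t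
      (mem_extChartAt_source (I := cornerModel d) y₀))
    have h2 : dChart (d := d) y₀ y₀ = ContinuousLinearMap.id ℝ _ := mfderiv_extChartAt_self
    have h3 : (dChartSymm (d := d) x₀ z₀ v : EuclideanSpace ℝ (Fin d)) = v :=
      congrArg (fun L ↦ L v) (mfderivWithin_range_extChartAt_symm (I := cornerModel d) (x := x₀))
    have h4 : u z₀ = extChartAt (cornerModel d) y₀ y₀ := by
      change extChartAt (cornerModel d) y₀ (H ((extChartAt (cornerModel d) x₀).symm z₀)) = _
      rw [hHz₀]
    change (EN.inChart y₀ (u z₀)).comp (EM.inChart x₀ z₀).inverse v = _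
    rw [h4]
    refine h1.symm.trans ?_
    rw [h2]
    exact (congrArg _ h3).trans (hcast _ (extChartAt_to_inv x₀))
  refine ⟨hH.1.continuousAt, ?_⟩
  have hTe : T z₀ = frameMap EM EN x₀ y₀ := ContinuousLinearMap.ext hTz
  rw [← hTe]
  exact hfd

end LimitDerivative

/-! ### Smoothness of frame-preserving maps and their inverses -/

section Bootstrap

variable {d : ℕ} {X : Type*} [EMetricSpace X] [ChartedSpace (EuclideanQuadrant d) X]
  [IsManifold (cornerModel d) ∞ X]
  {Y : Type*} [EMetricSpace Y] [ChartedSpace (EuclideanQuadrant d) Y]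
  [IsManifold (cornerModel d) ∞ Y]
  {EX : FrameField d X} {EY : FrameField d Y} {H : X → Y}

/-- A map whose differential takes one frame field to the other is smooth: in charts it solves a
first-order system with smooth coefficients. -/
lemma contMDiff_of_hasMFDerivAt_frameMap
    (hH : ∀ x, HasMFDerivAt (cornerModel d) (cornerModel d) H x (frameMap EX EY x (H x))) :
    ContMDiff (cornerModel d) (cornerModel d) ∞ H := by
  have hcont : Continuous H := continuous_iff_continuousAt.2 fun x ↦ (hH x).continuousAt
  intro x₀
  rw [contMDiffAt_iff]
  refine ⟨hcont.continuousAt, ?_⟩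
  set s := (extChartAt (cornerModel d) x₀).target ∩ (extChartAt (cornerModel d) x₀).symm ⁻¹'
    (H ⁻¹' (extChartAt (cornerModel d) (H x₀)).source) with hs
  set u : EuclideanSpace ℝ (Fin d) → EuclideanSpace ℝ (Fin d) := fun z ↦
    extChartAt (cornerModel d) (H x₀) (H ((extChartAt (cornerModel d) x₀).symm z)) with hu
  have hopen : IsOpen (H ⁻¹' (extChartAt (cornerModel d) (H x₀)).source) :=
    (isOpen_extChartAt_source _).preimage hcont
  have hsu : UniqueDiffOn ℝ s :=
    (hopen.uniqueMDiffOn (I := cornerModel d)).uniqueDiffOn_target_inter x₀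
  have hus : MapsTo u s (extChartAt (cornerModel d) (H x₀)).target :=
    fun z hz ↦ (extChartAt (cornerModel d) (H x₀)).map_source hz.2
  have hder : ∀ z ∈ s, HasFDerivWithinAt u
      ((EY.inChart (H x₀) (u z)).comp (EX.inChart x₀ z).inverse) s z := by
    intro z hz
    rw [← dChart_comp_frameMap_comp_dChartSymm EX EY hz.1 hz.2]
    exact (hasFDerivWithinAt_writtenInCharts hz.1 hz.2
      ((hH ((extChartAt (cornerModel d) x₀).symm z)).hasMFDerivWithinAt (s := univ))).mono
      fun w hw ↦ ⟨hw.1, mem_univ _⟩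
  have hinv : ContDiffOn ℝ ∞ (fun z ↦ (EX.inChart x₀ z).inverse) s := fun z hz ↦
    ((EX.isInvertible_inChart x₀ hz.1).contDiffAt_map_inverse).comp_contDiffWithinAt z
      ((EX.contDiffOn_inChart x₀ z hz.1).mono inter_subset_left)
  -- The derivative is a smooth expression in `z` and `u z`. If `u` is `C^k`, its derivative is
  -- `C^k`, so `u` is `C^(k+1)`.
  have hsmooth : ∀ k : ℕ, ContDiffOn ℝ k u s := by
    intro k
    induction k with
    | zero => exact contDiffOn_zero.2 fun z hz ↦ (hder z hz).continuousWithinAt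
    | succ k ih =>
      have hk : ((k : ℕ) : WithTop ℕ∞) ≤ ((⊤ : ℕ∞) : WithTop ℕ∞) := mod_cast le_top
      push_cast
      refine (contDiffOn_succ_iff_fderivWithin hsu).2
        ⟨fun z hz ↦ (hder z hz).differentiableWithinAt, by simp, ?_⟩
      refine ContDiffOn.congr (f := fun z ↦
        (EY.inChart (H x₀) (u z)).comp (EX.inChart x₀ z).inverse) ?_
        fun z hz ↦ (hder z hz).fderivWithin (hsu z hz)
      exact (((EY.contDiffOn_inChart (H x₀)).of_le hk).comp ih hus).clm_comp (hinv.of_le hk)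
  have hmem : s ∈ 𝓝[range (cornerModel d)] (extChartAt (cornerModel d) x₀ x₀) := by
    refine inter_mem (extChartAt_target_mem_nhdsWithin x₀) ?_
    refine mem_nhdsWithin_of_mem_nhds ((continuousAt_extChartAt_symm x₀).preimage_mem_nhds ?_)
    rw [extChartAt_to_inv]
    exact hopen.mem_nhds (mem_extChartAt_source (I := cornerModel d) (H x₀))
  exact ((contDiffOn_infty.2 hsmooth) _ (mem_of_mem_nhdsWithin
    (extChartAt_target_subset_range x₀ (mem_extChartAt_target x₀)) hmem)
    ).mono_of_mem_nhdsWithin hmem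

lemma frameMap_frameMap (x : X) (y : Y) (v : TangentSpace (cornerModel d) x) :
    frameMap EY EX y x (frameMap EX EY x y v) = v := by
  have h : (frameMap EY EX y x).toLinearMap ∘ₗ (frameMap EX EY x y).toLinearMap =
      LinearMap.id := by
    refine (EX.frame x).ext fun i ↦ ?_
    change frameMap EY EX y x (frameMap EX EY x y (EX.frame x i)) = EX.frame x i
    rw [frameMap_frame, frameMap_frame]
  exact congrArg (fun L ↦ L v) h

/-- The inverse of a map whose differential takes one frame field to the other. -/
lemma hasMFDerivAt_inverse_frameMap
    (hH : ∀ x, HasMFDerivAt (cornerModel d) (cornerModel d) H x (frameMap EX EY x (H x)))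
    {K : Y → X} (hK : Continuous K) (hHK : ∀ y, H (K y) = y) (y : Y) :
    HasMFDerivAt (cornerModel d) (cornerModel d) K y (frameMap EY EX y (K y)) := by
  let x : X := K y
  let e : EuclideanSpace ℝ (Fin d) ≃L[ℝ] EuclideanSpace ℝ (Fin d) :=
    ContinuousLinearEquiv.equivOfInverse (frameMap EX EY x y) (frameMap EY EX y x)
      (fun v ↦ frameMap_frameMap (EX := EX) (EY := EY) x y v)
      (fun v ↦ frameMap_frameMap (EX := EY) (EY := EX) y x v)
  have hbase : ∀ y', H x = y' → HasFDerivWithinAt (fun z ↦ extChartAt (cornerModel d) y'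
      (H ((extChartAt (cornerModel d) x).symm z)))
      (frameMap EX EY x y' : EuclideanSpace ℝ (Fin d) →L[ℝ] EuclideanSpace ℝ (Fin d))
      (range (cornerModel d)) (extChartAt (cornerModel d) x x) := by
    rintro y' rfl
    exact (hH x).2
  have h1 := hbase y (hHK y)
  refine ⟨hK.continuousAt, ?_⟩
  set ψ := extChartAt (cornerModel d) y
  set φ := extChartAt (cornerModel d) x
  have ha : φ (K (ψ.symm (ψ y))) = φ x := by
    rw [ψ.left_inv (mem_extChartAt_source y)]
  -- Differentiability of `K` follows from its continuity and the invertible derivative of `H`, read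
  -- in charts within the quadrant.
  refine HasFDerivWithinAt.of_local_left_inverse (f' := e)
    (f := fun z ↦ ψ (H (φ.symm z))) (g := fun w ↦ φ (K (ψ.symm w)))
    (t := range (cornerModel d)) ?_ ?_ (mem_range_self _) ?_
  · refine tendsto_nhdsWithin_iff.2 ⟨?_, Eventually.of_forall fun w ↦ mem_range_self _⟩
    refine Tendsto.mono_left ?_ nhdsWithin_le_nhds
    have c1 : ContinuousAt ψ.symm (ψ y) := continuousAt_extChartAt_symm y
    have c2 : ContinuousAt φ (K (ψ.symm (ψ y))) := by
      rw [ψ.left_inv (mem_extChartAt_source y)]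
      exact continuousAt_extChartAt x
    exact ContinuousAt.comp (f := fun w ↦ K (ψ.symm w)) c2 (hK.continuousAt.comp c1)
  · rw [ha]
    exact h1
  · have hKc : ContinuousAt (fun w ↦ K (ψ.symm w)) (ψ y) :=
      hK.continuousAt.comp (continuousAt_extChartAt_symm y)
    have hev : ∀ᶠ w in 𝓝 (ψ y), K (ψ.symm w) ∈ φ.source := by
      refine hKc.preimage_mem_nhds ((isOpen_extChartAt_source x).mem_nhds ?_)
      rw [ψ.left_inv (mem_extChartAt_source y)]
      exact mem_extChartAt_source x
    filter_upwards [mem_nhdsWithin_of_mem_nhds hev, extChartAt_target_mem_nhdsWithin y]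
      with w hw hwt
    rw [φ.left_inv hw, hHK, ψ.right_inv hwt]

end Bootstrap

/-! ### The frame map along the limit does not increase norms -/

section LimitNorm

/-- The combination of the `w i` is the image under `L` of that of the `v i`, up to the errors `L (v
i) - w i`. With `C → 1` and `δ → 0` this is the contraction property. -/
lemma norm_sum_smul_le_of_enorm_sub_le {V W ι : Type*} [NormedAddCommGroup V] [NormedSpace ℝ V]
    [NormedAddCommGroup W] [NormedSpace ℝ W] [Fintype ι] {L : V →L[ℝ] W} {v : ι → V} {w : ι → W}
    {C δ : ℝ≥0} (hL : ‖L‖ₑ ≤ C) (h : ∀ i, ‖L (v i) - w i‖ₑ ≤ δ) (c : ι → ℝ) :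
    ‖∑ i, c i • w i‖ ≤ C * ‖∑ i, c i • v i‖ + δ * ∑ i, |c i| := by
  have hL' : ‖L‖ ≤ C := by exact_mod_cast enorm_le_coe.1 hL
  have h' : ∀ i, ‖L (v i) - w i‖ ≤ δ := fun i ↦ by exact_mod_cast enorm_le_coe.1 (h i)
  have e : ∑ i, c i • w i = L (∑ i, c i • v i) - ∑ i, c i • (L (v i) - w i) := by
    simp [map_sum, smul_sub, Finset.sum_sub_distrib]
  rw [e, Finset.mul_sum]
  refine (norm_sub_le _ _).trans (add_le_add (L.le_of_opNorm_le hL' _) ?_)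
  refine (norm_sum_le _ _).trans (Finset.sum_le_sum fun i _ ↦ ?_)
  rw [norm_smul, mul_comm, Real.norm_eq_abs]
  exact mul_le_mul_of_nonneg_right (h' i) (abs_nonneg _)

variable {d : ℕ} {p : ℝ}
  {Ms : ℕ → Type*} [∀ n, EMetricSpace (Ms n)] [∀ n, CompactSpace (Ms n)] [∀ n, Nonempty (Ms n)]
  [∀ n, ChartedSpace (EuclideanQuadrant d) (Ms n)]
  [∀ n, IsManifold (cornerModel d) ∞ (Ms n)]
  [∀ n, RiemannianBundle (fun x : Ms n ↦ TangentSpace (cornerModel d) x)]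
  [∀ n, IsContMDiffRiemannianBundle (cornerModel d) ∞ (EuclideanSpace ℝ (Fin d))
    (fun x : Ms n ↦ TangentSpace (cornerModel d) x)]
  [∀ n, IsRiemannianManifold (cornerModel d) (Ms n)]
  [∀ n, MeasurableSpace (Ms n)] [∀ n, BorelSpace (Ms n)]
  {M : Type*} [EMetricSpace M] [CompactSpace M]
  [ChartedSpace (EuclideanQuadrant d) M] [IsManifold (cornerModel d) ∞ M]
  [RiemannianBundle (fun x : M ↦ TangentSpace (cornerModel d) x)]
  [IsContMDiffRiemannianBundle (cornerModel d) ∞ (EuclideanSpace ℝ (Fin d))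
    (fun x : M ↦ TangentSpace (cornerModel d) x)]
  [IsRiemannianManifold (cornerModel d) M]
  [MeasurableSpace M] [BorelSpace M]
  {N : Type*} [EMetricSpace N] [CompactSpace N]
  [ChartedSpace (EuclideanQuadrant d) N] [IsManifold (cornerModel d) ∞ N]
  [RiemannianBundle (fun x : N ↦ TangentSpace (cornerModel d) x)]
  [IsContMDiffRiemannianBundle (cornerModel d) ∞ (EuclideanSpace ℝ (Fin d))
    (fun x : N ↦ TangentSpace (cornerModel d) x)]
  [IsRiemannianManifold (cornerModel d) N]
  [MeasurableSpace N] [BorelSpace N]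
  {os : ∀ n, ManifoldOrientation d (Ms n)} {Es : ∀ n, FrameField d (Ms n)}
  {oM : ManifoldOrientation d M} {EM : FrameField d M} {F : ∀ n, PartialEquiv M (Ms n)}
  {oN : ManifoldOrientation d N} {EN : FrameField d N} {G : ∀ n, PartialEquiv N (Ms n)}

/-- Points at which the frames are nearly preserved exist near every point. -/
lemma exists_tendsto_mem_goodSets (hd : 1 ≤ d) (hF : ConvergesVia p os Es oM EM F)
    {S : ∀ n, Set (Ms n)} (hS : ∀ n, MeasurableSet (S n))
    (hSlim : Tendsto (fun n ↦ riemVolume d (Ms n) (S n)) atTop (𝓝 0)) (x : M) :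
    ∃ a : ℕ → M, (∀ n, a n ∈ (F n).source) ∧ Tendsto a atTop (𝓝 x) ∧
      ∀ᶠ n in atTop, a n ∈ (F n).symm '' (S n)ᶜ := by
  have hvol : Tendsto (fun n ↦ riemVolume d M ((F n).symm '' (S n)ᶜ)ᶜ) atTop (𝓝 0) := by
    have h1 := (hF.tendsto_volume_compl hd).add (hF.tendsto_volume_image_symm hd hS hSlim)
    rw [add_zero] at h1
    refine tendsto_of_tendsto_of_tendsto_of_le_of_le tendsto_const_nhds h1 (fun _ ↦ zero_le)
      fun n ↦ (measure_mono ?_).trans (measure_union_le _ _)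
    intro y hy
    by_cases hys : y ∈ (F n).source
    · refine Or.inr ⟨F n y, ?_, (F n).left_inv hys⟩
      by_contra hyS
      exact hy ⟨F n y, hyS, (F n).left_inv hys⟩
    · exact Or.inl hys
  have hinf : Tendsto (fun n ↦ Metric.infEDist x ((F n).symm '' (S n)ᶜ)) atTop (𝓝 0) :=
    ENNReal.tendsto_nhds_zero.2 fun ε hε ↦
      (eventually_forall_infEDist_le hvol hε).mono fun n hn ↦ hn x
  -- For small `n` the good set may be empty or at infinite distance from `x`. An arbitrary point of
  -- the source then serves as a default.
  have hex : ∀ n : ℕ, ∃ a ∈ (F n).source, Metric.infEDist x ((F n).symm '' (S n)ᶜ) ≠ ⊤ →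
      a ∈ (F n).symm '' (S n)ᶜ ∧
        edist x a ≤ Metric.infEDist x ((F n).symm '' (S n)ᶜ) + ((n : ℝ≥0∞) + 1)⁻¹ := by
    intro n
    by_cases hn : Metric.infEDist x ((F n).symm '' (S n)ᶜ) = ⊤
    · exact ⟨_, (hF.isDiffeoOnto n).symm_mem (Classical.arbitrary (Ms n)), fun h ↦ (h hn).elim⟩
    · have hlt : Metric.infEDist x ((F n).symm '' (S n)ᶜ) <
          Metric.infEDist x ((F n).symm '' (S n)ᶜ) + ((n : ℝ≥0∞) + 1)⁻¹ :=
        ENNReal.lt_add_right hn (by simp)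
      obtain ⟨a, ha, hax⟩ := Metric.infEDist_lt_iff.1 hlt
      refine ⟨a, ?_, fun _ ↦ ⟨ha, hax.le⟩⟩
      obtain ⟨y, -, rfl⟩ := ha
      exact (hF.isDiffeoOnto n).symm_mem y
  choose a has ha using hex
  have hfin : ∀ᶠ n in atTop, Metric.infEDist x ((F n).symm '' (S n)ᶜ) ≠ ⊤ :=
    (hinf.eventually_lt_const ENNReal.zero_lt_top).mono fun n hn ↦ hn.ne
  refine ⟨a, has, ?_, hfin.mono fun n hn ↦ (ha n hn).1⟩
  rw [tendsto_iff_edist_tendsto_0]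
  have h2 : Tendsto (fun n : ℕ ↦ ((n : ℝ≥0∞) + 1)⁻¹) atTop (𝓝 0) := by
    have := (tendsto_add_atTop_iff_nat 1).2 ENNReal.tendsto_inv_nat_nhds_zero
    simpa using this
  have h3 := hinf.add h2
  rw [add_zero] at h3
  refine tendsto_of_tendsto_of_tendsto_of_le_of_le' tendsto_const_nhds h3
    (Eventually.of_forall fun _ ↦ zero_le) ?_
  filter_upwards [hfin] with n hn
  rw [edist_comm]
  exact (ha n hn).2

/-- The map taking one frame to the other along the limit does not increase norms. -/
lemma norm_sum_smul_frame_le (hd : 1 ≤ d) (hF : ConvergesVia p os Es oM EM F)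
    (hG : ConvergesVia p os Es oN EN G) {H : M → N} (hH : IsUniformLimitAlong F G id H) (x : M)
    (c : Fin d → ℝ) :
    ‖∑ i, c i • EN.frame (H x) i‖ ≤ ‖∑ i, c i • EM.frame x i‖ := by
  have key : ∀ ε : ℝ≥0, 0 < ε → ε ≤ 1 → ‖∑ i, c i • EN.frame (H x) i‖ ≤
      ((1 + ε) * (1 + ε) : ℝ≥0) * ‖∑ i, c i • EM.frame x i‖ + (5 * ε : ℝ≥0) * ∑ i, |c i| := by
    intro ε hε hε1
    obtain ⟨S, hS, hSlim, hgood⟩ := exists_goodSets hd hF hG hε hε1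
    obtain ⟨a, has, hax, ha⟩ := exists_tendsto_mem_goodSets hd hF hS hSlim x
    have t1 := ((continuous_norm_sum_smul (d := d) c EN.continuous_section).tendsto (H x)).comp
      (tendsto_transition_approx hH has hax)
    have t2 := ((continuous_norm_sum_smul (d := d) c EM.continuous_section).tendsto x).comp hax
    refine le_of_tendsto_of_tendsto t1 ((t2.const_mul _).add_const _) ?_
    filter_upwards [ha] with n hn
    obtain ⟨g1, g2⟩ := hgood n (a n) hn
    exact norm_sum_smul_le_of_enorm_sub_le (V := TangentSpace (cornerModel d) (a n))
      (W := TangentSpace (cornerModel d) ((G n).symm (F n (a n))))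
      (L := transitionDeriv (F n) (G n) (a n)) (v := fun i ↦ EM.frame (a n) i)
      (w := fun i ↦ EN.frame ((G n).symm (F n (a n))) i) (by exact_mod_cast g1)
      (fun i ↦ by exact_mod_cast g2 i) c
  have hlim : Tendsto (fun ε : ℝ≥0 ↦ ((1 + ε) * (1 + ε) : ℝ≥0) * ‖∑ i, c i • EM.frame x i‖ +
      (5 * ε : ℝ≥0) * ∑ i, |c i|) (𝓝[>] 0) (𝓝 ‖∑ i, c i • EM.frame x i‖) := by
    have : Continuous (fun ε : ℝ≥0 ↦ (((1 + ε) * (1 + ε) : ℝ≥0) : ℝ) *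
        ‖∑ i, c i • EM.frame x i‖ + ((5 * ε : ℝ≥0) : ℝ) * ∑ i, |c i|) := by fun_prop
    have h := this.tendsto 0
    simp only [add_zero, mul_zero, mul_one, NNReal.coe_one, NNReal.coe_zero, zero_mul, one_mul] at h
    exact h.mono_left nhdsWithin_le_nhds
  refine ge_of_tendsto hlim ?_
  filter_upwards [self_mem_nhdsWithin, mem_nhdsWithin_of_mem_nhds (Iic_mem_nhds (zero_lt_one))]
    with ε hε hε1 using key ε hε hε1

end LimitNorm

/-! ### The limit is a frame-preserving Riemannian isometry -/

section LimitIsometry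

variable {d : ℕ} {p : ℝ}
  {Ms : ℕ → Type*} [∀ n, EMetricSpace (Ms n)] [∀ n, CompactSpace (Ms n)] [∀ n, Nonempty (Ms n)]
  [∀ n, ChartedSpace (EuclideanQuadrant d) (Ms n)]
  [∀ n, IsManifold (cornerModel d) ∞ (Ms n)]
  [∀ n, RiemannianBundle (fun x : Ms n ↦ TangentSpace (cornerModel d) x)]
  [∀ n, IsContMDiffRiemannianBundle (cornerModel d) ∞ (EuclideanSpace ℝ (Fin d))
    (fun x : Ms n ↦ TangentSpace (cornerModel d) x)]
  [∀ n, IsRiemannianManifold (cornerModel d) (Ms n)]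
  [∀ n, MeasurableSpace (Ms n)] [∀ n, BorelSpace (Ms n)]
  {M : Type*} [EMetricSpace M] [CompactSpace M]
  [ChartedSpace (EuclideanQuadrant d) M] [IsManifold (cornerModel d) ∞ M]
  [RiemannianBundle (fun x : M ↦ TangentSpace (cornerModel d) x)]
  [IsContMDiffRiemannianBundle (cornerModel d) ∞ (EuclideanSpace ℝ (Fin d))
    (fun x : M ↦ TangentSpace (cornerModel d) x)]
  [IsRiemannianManifold (cornerModel d) M]
  [MeasurableSpace M] [BorelSpace M]
  {N : Type*} [EMetricSpace N] [CompactSpace N]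
  [ChartedSpace (EuclideanQuadrant d) N] [IsManifold (cornerModel d) ∞ N]
  [RiemannianBundle (fun x : N ↦ TangentSpace (cornerModel d) x)]
  [IsContMDiffRiemannianBundle (cornerModel d) ∞ (EuclideanSpace ℝ (Fin d))
    (fun x : N ↦ TangentSpace (cornerModel d) x)]
  [IsRiemannianManifold (cornerModel d) N]
  [MeasurableSpace N] [BorelSpace N]
  {os : ∀ n, ManifoldOrientation d (Ms n)} {Es : ∀ n, FrameField d (Ms n)}
  {oM : ManifoldOrientation d M} {EM : FrameField d M} {F : ∀ n, PartialEquiv M (Ms n)}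
  {oN : ManifoldOrientation d N} {EN : FrameField d N} {G : ∀ n, PartialEquiv N (Ms n)}

lemma IsUniformLimitAlong.comp {H : M → N} (hH : IsUniformLimitAlong F G id H) {ψ : ℕ → ℕ}
    (hψ : StrictMono ψ) :
    IsUniformLimitAlong (fun n ↦ F (ψ n)) (fun n ↦ G (ψ n)) id H :=
  ⟨hH.1, hH.2.comp hψ.tendsto_atTop⟩

/-- The product of the Lipschitz constants is at most the sum of their squares. The square for `F`
is controlled by `hF`, and the one for `G.symm` by `hG` after replacing the volume by the larger one
in `N`. -/
lemma tendsto_volume_compl_mul_lipConst (hF : ConvergesVia p os Es oM EM F)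
    (hG : ConvergesVia p os Es oN EN G)
    (h : ∀ n, riemVolume d M (F n).sourceᶜ ≤ riemVolume d N (G n).sourceᶜ) :
    Tendsto (fun n ↦ riemVolume d M (F n).sourceᶜ *
      (lipConst (F n) (F n).source * lipConst (G n).symm univ)) atTop (𝓝 0) := by
  have h1 := hF.covers.add hG.covers_symm
  rw [add_zero] at h1
  refine tendsto_of_tendsto_of_tendsto_of_le_of_le tendsto_const_nhds h1 (fun _ ↦ zero_le)
    fun n ↦ ?_
  have hab : ∀ a b : ℝ≥0∞, a * b ≤ a ^ 2 + b ^ 2 := by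
    intro a b
    rcases le_total a b with hab | hab
    · exact (mul_le_mul' hab le_rfl).trans ((pow_two b).ge.trans le_add_self)
    · exact (mul_le_mul' le_rfl hab).trans ((pow_two a).ge.trans le_self_add)
  refine (mul_le_mul' le_rfl (hab _ _)).trans ?_
  rw [mul_add]
  exact add_le_add le_rfl (mul_le_mul' (h n) le_rfl)

/-- The limit of the transition maps is differentiable, with differential taking frame to frame. -/
lemma hasMFDerivAt_of_isUniformLimitAlong (hd : 1 ≤ d) (hF : ConvergesVia p os Es oM EM F)
    (hG : ConvergesVia p os Es oN EN G) {H : M → N} (hH : IsUniformLimitAlong F G id H) (x : M) :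
    HasMFDerivAt (cornerModel d) (cornerModel d) H x (frameMap EM EN x (H x)) := by
  -- One of the two comparisons of uncovered volumes holds for infinitely many `n`. Restricting to
  -- these `n` does not change the limit. In the second case the roles of `M` and `N` are exchanged
  -- and the derivative of the inverse `K` is inverted.
  by_cases hfr : ∃ᶠ n in atTop, riemVolume d M (F n).sourceᶜ ≤ riemVolume d N (G n).sourceᶜ
  · obtain ⟨ψ, hψ, hle⟩ := extraction_of_frequently_atTop hfr
    exact hasMFDerivAt_limit hd (hF.comp hψ) (hG.comp hψ) (hH.comp hψ)
      (tendsto_volume_compl_mul_lipConst (hF.comp hψ) (hG.comp hψ) hle) x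
  · have hfr' : ∃ᶠ n in atTop, riemVolume d N (G n).sourceᶜ ≤ riemVolume d M (F n).sourceᶜ :=
      ((not_frequently.1 hfr).mono fun n hn ↦ (not_le.1 hn).le).frequently
    obtain ⟨ψ, hψ, hle⟩ := extraction_of_frequently_atTop hfr'
    have hF' := hF.isApproxIsometry hd
    have hG' := hG.isApproxIsometry hd
    have hiso := hH.isometry hF' hG'
    obtain ⟨K, hHK⟩ := (hH.surjective hF' hG').hasRightInverse
    have hK := hH.symm hF' hG' hHK
    refine hasMFDerivAt_inverse_frameMap (H := K) (K := H) (fun y ↦ ?_) hH.1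
      (fun x ↦ hiso.injective (hHK (H x))) x
    exact hasMFDerivAt_limit hd (hG.comp hψ) (hF.comp hψ) (hK.comp hψ)
      (tendsto_volume_compl_mul_lipConst (hG.comp hψ) (hF.comp hψ) hle) y

/-- The limit of the transition maps is an isometry of Riemannian manifolds which takes one frame
field to the other. -/
lemma isRiemannianIsometry_of_isUniformLimitAlong (hd : 1 ≤ d)
    (hF : ConvergesVia p os Es oM EM F) (hG : ConvergesVia p os Es oN EN G) {H : M → N}
    (hH : IsUniformLimitAlong F G id H) :
    IsRiemannianIsometry (d := d) H ∧ ∀ (x : M) (i : Fin d),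
      mfderiv (cornerModel d) (cornerModel d) H x (EM.frame x i) = EN.frame (H x) i := by
  have hF' := hF.isApproxIsometry hd
  have hG' := hG.isApproxIsometry hd
  have hiso := hH.isometry hF' hG'
  obtain ⟨K, hHK⟩ := (hH.surjective hF' hG').hasRightInverse
  have hKH : ∀ x, K (H x) = x := fun x ↦ hiso.injective (hHK (H x))
  have hK := hH.symm hF' hG' hHK
  have hder := hasMFDerivAt_of_isUniformLimitAlong hd hF hG hH
  have hframe : ∀ (x : M) (i : Fin d),
      mfderiv (cornerModel d) (cornerModel d) H x (EM.frame x i) = EN.frame (H x) i := by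
    intro x i
    rw [(hder x).mfderiv, frameMap_frame]
  refine ⟨⟨⟨⟨⟨H, K, hKH, hHK⟩, contMDiff_of_hasMFDerivAt_frameMap hder,
    contMDiff_of_hasMFDerivAt_frameMap (hasMFDerivAt_of_isUniformLimitAlong hd hG hF hK)⟩,
    fun x ↦ rfl⟩, fun x v ↦ ?_⟩, hframe⟩
  have hv : mfderiv (cornerModel d) (cornerModel d) H x v =
      ∑ i, (EM.frame x).repr v i • EN.frame (H x) i := by
    rw [← sum_repr_smul_apply (EM.frame x)]
    exact Finset.sum_congr rfl fun i _ ↦ by rw [hframe]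
  have hcast : ∀ x', x' = x → ∀ c : Fin d → ℝ,
      ‖∑ i, c i • EM.frame x' i‖ = ‖∑ i, c i • EM.frame x i‖ := by
    rintro x' rfl c; rfl
  -- Applied to `H` and to its inverse, the contraction property gives equality of norms.
  have h1 := norm_sum_smul_frame_le hd hF hG hH x ((EM.frame x).repr v)
  have h2 := norm_sum_smul_frame_le hd hG hF hK (H x) ((EM.frame x).repr v)
  rw [hcast _ (hKH x)] at h2
  rw [hv, le_antisymm h1 h2, (EM.frame x).sum_repr v]

end LimitIsometry

end WeitzenbockLimit

end

theorem lemma4p7 {d : ℕ} (hd : 1 ≤ d) (p : ℝ)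
    -- the compact Riemannian manifolds `(Mₙ, gₙ)`
    {Ms : ℕ → Type*} [∀ n, EMetricSpace (Ms n)] [∀ n, CompactSpace (Ms n)] [∀ n, Nonempty (Ms n)]
    [∀ n, ChartedSpace (EuclideanQuadrant d) (Ms n)]
    [∀ n, IsManifold (WeitzenbockLimit.cornerModel d) ∞ (Ms n)]
    [∀ n, RiemannianBundle (fun x : Ms n ↦ TangentSpace (WeitzenbockLimit.cornerModel d) x)]
    [∀ n, IsContMDiffRiemannianBundle (WeitzenbockLimit.cornerModel d) ∞
      (EuclideanSpace ℝ (Fin d))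
      (fun x : Ms n ↦ TangentSpace (WeitzenbockLimit.cornerModel d) x)]
    [∀ n, IsRiemannianManifold (WeitzenbockLimit.cornerModel d) (Ms n)]
    [∀ n, MeasurableSpace (Ms n)] [∀ n, BorelSpace (Ms n)]
    -- the compact Riemannian manifold `(M, g)`
    {M : Type*} [EMetricSpace M] [CompactSpace M]
    [ChartedSpace (EuclideanQuadrant d) M] [IsManifold (WeitzenbockLimit.cornerModel d) ∞ M]
    [RiemannianBundle (fun x : M ↦ TangentSpace (WeitzenbockLimit.cornerModel d) x)]
    [IsContMDiffRiemannianBundle (WeitzenbockLimit.cornerModel d) ∞ (EuclideanSpace ℝ (Fin d))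
      (fun x : M ↦ TangentSpace (WeitzenbockLimit.cornerModel d) x)]
    [IsRiemannianManifold (WeitzenbockLimit.cornerModel d) M]
    [MeasurableSpace M] [BorelSpace M]
    -- the compact Riemannian manifold `(N, h)`
    {N : Type*} [EMetricSpace N] [CompactSpace N]
    [ChartedSpace (EuclideanQuadrant d) N] [IsManifold (WeitzenbockLimit.cornerModel d) ∞ N]
    [RiemannianBundle (fun x : N ↦ TangentSpace (WeitzenbockLimit.cornerModel d) x)]
    [IsContMDiffRiemannianBundle (WeitzenbockLimit.cornerModel d) ∞ (EuclideanSpace ℝ (Fin d))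
      (fun x : N ↦ TangentSpace (WeitzenbockLimit.cornerModel d) x)]
    [IsRiemannianManifold (WeitzenbockLimit.cornerModel d) N]
    [MeasurableSpace N] [BorelSpace N]
    -- orientations and frame fields
    (os : ∀ n, WeitzenbockLimit.ManifoldOrientation d (Ms n))
    (oM : WeitzenbockLimit.ManifoldOrientation d M)
    (oN : WeitzenbockLimit.ManifoldOrientation d N)
    (Es : ∀ n, WeitzenbockLimit.FrameField d (Ms n))
    (EM : WeitzenbockLimit.FrameField d M) (EN : WeitzenbockLimit.FrameField d N)
    -- the two convergences
    (F : ∀ n, PartialEquiv M (Ms n)) (G : ∀ n, PartialEquiv N (Ms n))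
    (hF : WeitzenbockLimit.ConvergesVia p os Es oM EM F)
    (hG : WeitzenbockLimit.ConvergesVia p os Es oN EN G) :
    (∃ φ : ℕ → ℕ, StrictMono φ ∧
      ∃ H : M → N, WeitzenbockLimit.IsUniformLimitAlong F G φ H) ∧
    ∀ φ : ℕ → ℕ, StrictMono φ → ∀ H : M → N, WeitzenbockLimit.IsUniformLimitAlong F G φ H →
      WeitzenbockLimit.IsRiemannianIsometry (d := d) H ∧
      ∀ (x : M) (i : Fin d),
        mfderiv (WeitzenbockLimit.cornerModel d) (WeitzenbockLimit.cornerModel d) H x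
          (EM.frame x i) = EN.frame (H x) i := by
  refine ⟨WeitzenbockLimit.exists_isUniformLimitAlong (hF.isApproxIsometry hd)
    (hG.isApproxIsometry hd), fun φ hφ H hH ↦ ?_⟩
  -- A uniform limit along `φ` is by definition a uniform limit of the full sequence of the maps `F
  -- (φ n)`, `G (φ n)`, which still satisfy both convergences.
  exact WeitzenbockLimit.isRiemannianIsometry_of_isUniformLimitAlong hd (hF.comp hφ) (hG.comp hφ) hH
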